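/- **Setting.** Fix a Lévy measure $\rho$ on $(0,\infty)$ (that is, $\int\min(1,u)\,\rho(du)<\infty$), write $\overline\rho(u)=\rho((u,\infty))$ and $M_1=\int_0^\infty u\,\rho(du)$, and let $\mathrm{ID}(0,\rho)$ be the law on $[0,\infty)$ with Laplace transform $\exp\big(-\int(1-e^{-wt})\rho(dw)\big)$, $t\ge 0$. For $L$ hidden layers, input and output dimensions $p_0=d_{\mathrm{in}}$, $p_{L+1}=d_{\mathrm{out}}$, widths $\mathbf p=(p_1,\dots,p_L)$ with $p_l\ge 1$, an activation $\phi:\mathbb R\to\mathbb R$, $\sigma_v>0$, $\sigma_b\ge 0$ and an input $\mathbf x\in\mathbb R^{d_{\mathrm{in}}}$, consider for each $\mathbf p$ the random network $$Z^{(1)}_k=\sum_{j=1}^{d_{\mathrm{in}}}\tfrac{1}{\sqrt{d_{\mathrm{in}}}}V^{(1)}_{jk}x_j+B^{(1)}_k,\qquad Z^{(l)}_k=\sum_{j=1}^{p_{l-1}}\sqrt{\lambda^{(l-1)}_{p_{l-1},j}}\,V^{(l)}_{jk}\,\phi(Z^{(l-1)}_j)+B^{(l)}_k\quad(2\le l\le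 L+1),$$ where all $V^{(l)}_{jk}\sim\mathcal N(0,\sigma_v^2)$, $B^{(l)}_k\sim\mathcal N(0,\sigma_b^2)$ ($B^{(l)}_k=0$ if $\sigma_b=0$) and $\lambda^{(l)}_{p_l,j}\sim\mu^{(l)}_{p_l}$ are independent, the $\mu^{(l)}_{n}$ being probability laws on $[0,\infty)$. For $\epsilon>0$ the $\epsilon$-pruned network $Z^{*(l)}_k$ is defined with the same variables, by $Z^{*(1)}_k=Z^{(1)}_k$ and, for $2\le l\le L+1$, $Z^{*(l)}_k=\sum_{j=1}^{p_{l-1}}\sqrt{\lambda^{(l-1)}_{p_{l-1},j}}\,\mathbf 1_{\{\lambda^{(l-1)}_{p_{l-1},j}>\epsilon\}}V^{(l)}_{jk}\phi(Z^{*(l-1)}_j)+B^{(l)}_k$. Put $U^{(l)}=\sup_{\mathbf p}\mathbf E[(Z^{(l)}_1)^2]$ and $C_{\mathrm{Lip}}=\max(|\phi(1)|,|\phi(-1)|)$. **Assumptions.** * (UI) $M_1<\infty$; and for each layer $l=1,\dots,L$, $N^{(l)}_{n}:=\mathbf E\big[\sum_{j=1}^{n}\lambda^{(l)}_{n,j}\big]<\infty$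 for all $n$, and $N^{(l)}_{n}\to M_1$ as $n\to\infty$. * (A1) $\phi(\gamma x)=\gamma\phi(x)$ for all $\gamma>0$, $x\in\mathbb R$. * (A2) For each $l=1,\dots,L$, $\sum_{j=1}^{p_l}\lambda^{(l)}_{p_l,j}$ converges in distribution to $\mathrm{ID}(0,\rho)$ as $p_l\to\infty$ (so $a^{(l)}=0$ and all layers share the same $\rho$). * (A3) $\overline\rho(u)\sim u^{-\alpha}\mathcal L(1/u)$ as $u\to 0^+$, for some $\alpha\in[0,1)$ and some function $\mathcal L$ slowly varying at infinity. **Statement.** For every $\delta\in(0,1-\alpha)$ there is $\epsilon_0>0$, depending only on $\rho,\alpha,\delta$, such that for every $0<\epsilon<\epsilon_0$, every such family of networks satisfying (UI), (A1)–(A3), every input $\mathbf x$, every $l=1,\dots,L$ and every node $k\ge 1$ of layer $l+1$ ($k\le d_{\mathrm{out}}$ if $l=L$): $U^{(1)},\dots,U^{(l)}$ are finite and $$\limsup_{\min\mathbf p\to\infty}\mathbf E\Big[\big|Z^{(l+1)}_k-Z^{*(l+1)}_k\big|^2\Big]\le D(l)\,\epsilon^{1-(\alpha+\delta)},$$ where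 $$D(l)=\frac{\sigma_v^2C_{\mathrm{Lip}}^2}{1-(\alpha+\delta)}\Big(U^{(l)}+(\sigma_v^2C_{\mathrm{Lip}}^2M_1)U^{(l-1)}+\cdots+(\sigma_v^2C_{\mathrm{Lip}}^2M_1)^{l-1}U^{(1)}\Big)$$ does not depend on $\epsilon$. Moreover, if $\rho(\{\epsilon\})=0$, then the limit as $\min\mathbf p\to\infty$ of $\mathbf E\big[|Z^{(l+1)}_k-Z^{*(l+1)}_k|^2\big]$ exists, and it satisfies the same bound. -/

import Mathlib

open MeasureTheory ProbabilityTheory Filter Topology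
open scoped NNReal ENNReal

namespace MoGP

/-! ### Lévy measures and infinitely divisible laws on the half-line -/

/-- A Lévy measure on `(0, ∞)`, seen as a measure on `ℝ` that does not charge `(-∞, 0]`:
`∫ min(1, x) ρ(dx) < ∞`. -/
structure IsLevyMeasure (ρ : Measure ℝ) : Prop where
  null_nonpos : ρ (Set.Iic 0) = 0
  lintegral_min_lt_top : ∫⁻ x, ENNReal.ofReal (min 1 x) ∂ρ < ⊤

/-- The tail Lévy measure `x ↦ ρ((x, ∞))`; it is finite for `x > 0` when `ρ` is a Lévy measure. -/
noncomputable def tail (ρ : Measure ℝ) (x : ℝ) : ℝ := (ρ (Set.Ioi x)).toReal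

/-- The first moment `M₁ = ∫ u ρ(du)`, with values in `[0, ∞]`. -/
noncomputable def firstMoment (ρ : Measure ℝ) : ℝ≥0∞ := ∫⁻ u, ENNReal.ofReal u ∂ρ

/-- The Laplace exponent `ψ(t) = ∫ (1 - e^{-wt}) ρ(dw)`. -/
noncomputable def laplaceExponent (ρ : Measure ℝ) (t : ℝ) : ℝ := ∫ w, (1 - Real.exp (-(w * t))) ∂ρ

/-- `ν` is the law `ID(a, ρ)` on `[0, ∞)`, the one with Laplace transform
`E[e^{-tX}] = e^{-ta - ψ(t)}` for all `t ≥ 0`. -/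
def IsID (ν : ProbabilityMeasure ℝ≥0) (a : ℝ≥0) (ρ : Measure ℝ) : Prop :=
  ∀ t : ℝ, 0 ≤ t →
    ∫ x : ℝ≥0, Real.exp (-(t * x)) ∂(ν : Measure ℝ≥0)
      = Real.exp (-(t * a) - laplaceExponent ρ t)

/-- `L` is slowly varying (at infinity). -/
def SlowlyVarying (L : ℝ → ℝ) : Prop :=
  ∀ γ : ℝ, 0 < γ → Tendsto (fun x => L (γ * x) / L x) atTop (𝓝 1)

/-- `ρ̄(u) ~ u^{-α} L(1/u)` as `u → 0+`. -/
def TailRegularAtZero (ρ : Measure ℝ) (α : ℝ) (L : ℝ → ℝ) : Prop :=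
  Tendsto (fun u : ℝ => tail ρ u / (u ^ (-α) * L (1 / u))) (𝓝[>] 0) (𝓝 1)

/-! ### The sum of the node variances of one layer

A layer is described by the laws `μ n` of a single node variance when the layer has width `n`. -/

/-- The law of `∑_{j ≤ n} λ_{n,j}` for `λ_{n,1}, …, λ_{n,n}` iid with law `μ n`. -/
noncomputable def sumLaw (μ : ℕ+ → ProbabilityMeasure ℝ≥0) (n : ℕ+) : ProbabilityMeasure ℝ≥0 :=
  (ProbabilityMeasure.pi fun _ : Fin n => μ n).map
    (f := fun v : Fin n → ℝ≥0 => ∑ j, v j) (by fun_prop)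

/-- `∑_{j ≤ n} λ_{n,j}` converges in distribution to `ID(a, ρ)` as `n → ∞`. -/
def SumTendstoID (μ : ℕ+ → ProbabilityMeasure ℝ≥0) (a : ℝ≥0) (ρ : Measure ℝ) : Prop :=
  ∃ ν : ProbabilityMeasure ℝ≥0, IsID ν a ρ ∧ Tendsto (sumLaw μ) atTop (𝓝 ν)

/-- `N_n = E[∑_{j ≤ n} λ_{n,j}]`. -/
noncomputable def meanSum (μ : ℕ+ → ProbabilityMeasure ℝ≥0) (n : ℕ+) : ℝ≥0∞ :=
  ∫⁻ s : ℝ≥0, (s : ℝ≥0∞) ∂(sumLaw μ n : Measure ℝ≥0)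

/-- The assumption (UI) for one layer: `M₁ < ∞`, `N_n < ∞` for all `n`, and `N_n → a + M₁`. -/
structure UI (μ : ℕ+ → ProbabilityMeasure ℝ≥0) (a : ℝ≥0) (ρ : Measure ℝ) : Prop where
  firstMoment_lt_top : firstMoment ρ < ⊤
  meanSum_lt_top : ∀ n, meanSum μ n < ⊤
  tendsto_meanSum : Tendsto (meanSum μ) atTop (𝓝 (a + firstMoment ρ))

/-! ### The network

Layers are numbered `0, …, L + 1`: layer `0` is the input, layers `1, …, L` are hidden and
layer `L + 1` is the output. Nodes within a layer are numbered from `0`. -/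

def PosHomogeneous (φ : ℝ → ℝ) : Prop := ∀ γ x : ℝ, 0 < γ → φ (γ * x) = γ * φ x

/-- `C_Lip = max(|φ(1)|, |φ(-1)|)`. -/
noncomputable def cLip (φ : ℝ → ℝ) : ℝ := max |φ 1| |φ (-1)|

/-- The number of nodes at each layer. -/
def width {L : ℕ} (din dout : ℕ+) (p : Fin L → ℕ+) : ℕ → ℕ
  | 0 => din
  | l + 1 => if h : l < L then p ⟨l, h⟩ else dout

/-- The random parameters of a network on `Ω`: node variances `lam l j` (of node `j` at the hidden
layer `l`), the Gaussian factors `V l j k` (from node `j` at layer `l - 1` to node `k` at layer `l`)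
and the biases `B l k`. Only the entries with `ParamIdx.InRange` below are meaningful. -/
structure Params (Ω : Type*) where
  lam : ℕ → ℕ → Ω → ℝ≥0
  V : ℕ → ℕ → ℕ → Ω → ℝ
  B : ℕ → ℕ → Ω → ℝ

/-- Names of the parameters. -/
inductive ParamIdx where
  | lam (l j : ℕ)
  | V (l j k : ℕ)
  | B (l k : ℕ)

/-- The parameters that belong to the network of widths `p`. -/
def ParamIdx.InRange {L : ℕ} (din dout : ℕ+) (p : Fin L → ℕ+) : ParamIdx → Prop
  | .lam l j => 1 ≤ l ∧ l ≤ L ∧ j < width din dout p l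
  | .V l j k => 1 ≤ l ∧ l ≤ L + 1 ∧ j < width din dout p (l - 1) ∧ k < width din dout p l
  | .B l k => 1 ≤ l ∧ l ≤ L + 1 ∧ k < width din dout p l

/-- The real random variable with a given name. -/
def Params.value {Ω : Type*} (θ : Params Ω) : ParamIdx → Ω → ℝ
  | .lam l j => fun ω => θ.lam l j ω
  | .V l j k => θ.V l j k
  | .B l k => θ.B l k

/-- The distribution of the parameters of the network of widths `p`: `V ~ N(0, σv²)`,
`B ~ N(0, σb²)` (which is the point mass at `0` when `σb = 0`), the node variances of the `i`-th
hidden layer have law `μ i (p i)`, and all of these random variables are independent. -/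
structure IsMoGP {L : ℕ} (din dout : ℕ+) (σb σv : ℝ≥0)
    (μ : Fin L → ℕ+ → ProbabilityMeasure ℝ≥0) (p : Fin L → ℕ+)
    {Ω : Type*} [MeasurableSpace Ω] (P : Measure Ω) (θ : Params Ω) : Prop where
  measurable_value : ∀ i : ParamIdx, i.InRange din dout p → Measurable (θ.value i)
  law_V : ∀ l j k : ℕ, (ParamIdx.V l j k).InRange din dout p →
    P.map (θ.V l j k) = gaussianReal 0 (σv ^ 2)
  law_B : ∀ l k : ℕ, (ParamIdx.B l k).InRange din dout p →
    P.map (θ.B l k) = gaussianReal 0 (σb ^ 2)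
  law_lam : ∀ (i : Fin L) (j : ℕ), j < p i →
    P.map (θ.lam (i + 1) j) = (μ i (p i) : Measure ℝ≥0)
  indep : iIndepFun (fun i : {i : ParamIdx // i.InRange din dout p} => θ.value i) P

section Network

variable {L : ℕ} (din dout : ℕ+) (p : Fin L → ℕ+) {Ω : Type*} (θ : Params Ω)
  (φ : ℝ → ℝ) (x : Fin din → ℝ)

/-- The first-layer pre-activation `∑_j W⁽¹⁾_{jk} x_j + B⁽¹⁾_k`, where
`W⁽¹⁾_{jk} = √(1 / din) V⁽¹⁾_{jk}`. -/
noncomputable def firstPreact (k : ℕ) (ω : Ω) : ℝ :=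
  ∑ j : Fin din, (Real.sqrt (1 / (din : ℕ)) * θ.V 1 j k ω) * x j + θ.B 1 k ω

/-- The pre-activation `Z⁽ˡ⁾_k(x; p)` of node `k` at layer `l ≥ 1` (the value at `l = 0` is a
dummy): `Z⁽ˡ⁾_k = ∑_j W⁽ˡ⁾_{jk} φ(Z⁽ˡ⁻¹⁾_j) + B⁽ˡ⁾_k` with `W⁽ˡ⁾_{jk} = √λ⁽ˡ⁻¹⁾_j V⁽ˡ⁾_{jk}`. -/
noncomputable def preact : ℕ → ℕ → Ω → ℝ
  | 0, _, _ => 0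
  | 1, k, ω => firstPreact din θ x k ω
  | l + 2, k, ω =>
      ∑ j ∈ Finset.range (width din dout p (l + 1)),
        (Real.sqrt (θ.lam (l + 1) j ω) * θ.V (l + 2) j k ω) * φ (preact (l + 1) j ω)
      + θ.B (l + 2) k ω

open Classical in
/-- The pre-activation `Z*⁽ˡ⁾_k(x; p, ε)` of the `ε`-pruned network, which keeps the hidden nodes
whose node variance is `> ε`. -/
noncomputable def prunedPreact (ε : ℝ) : ℕ → ℕ → Ω → ℝ
  | 0, _, _ => 0
  | 1, k, ω => firstPreact din θ x k ω
  | l + 2, k, ω =>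
      ∑ j ∈ Finset.range (width din dout p (l + 1)),
        (Real.sqrt (θ.lam (l + 1) j ω) * (if ε < (θ.lam (l + 1) j ω : ℝ) then 1 else 0)
          * θ.V (l + 2) j k ω) * φ (prunedPreact ε (l + 1) j ω)
      + θ.B (l + 2) k ω

/-- The pruning error `E[|Z⁽ˡ⁾_k - Z*⁽ˡ⁾_k|²]`, with values in `[0, ∞]`. -/
noncomputable def pruningError [MeasurableSpace Ω] (P : Measure Ω) (ε : ℝ) (l k : ℕ) : ℝ≥0∞ :=
  ∫⁻ ω, ENNReal.ofReal
    (|preact din dout p θ φ x l k ω - prunedPreact din dout p θ φ x ε l k ω| ^ 2) ∂P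

end Network

/-- `U⁽ˡ⁾ = sup_p E[(Z⁽ˡ⁾_1(x; p))²]`, with values in `[0, ∞]`, for a family of networks, one for
each vector of widths (node `1` in the usual numbering is node `0` here). -/
noncomputable def supSecondMoment {L : ℕ} (din dout : ℕ+)
    {Ω : (Fin L → ℕ+) → Type*} [∀ p, MeasurableSpace (Ω p)] (P : ∀ p, Measure (Ω p))
    (θ : ∀ p, Params (Ω p)) (φ : ℝ → ℝ) (x : Fin din → ℝ) (l : ℕ) : ℝ≥0∞ :=
  ⨆ p : Fin L → ℕ+, ∫⁻ ω, ENNReal.ofReal ((preact din dout p (θ p) φ x l 0 ω) ^ 2) ∂(P p)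

/-- The constant
`D(l) = σv² C² / (1 - (α + δ)) * (U⁽ˡ⁾ + (σv² C² M₁) U⁽ˡ⁻¹⁾ + ⋯ + (σv² C² M₁)^{l-1} U⁽¹⁾)`. -/
noncomputable def pruningConst (σv C M₁ α δ : ℝ) (U : ℕ → ℝ) (l : ℕ) : ℝ :=
  σv ^ 2 * C ^ 2 / (1 - (α + δ)) *
    ∑ i ∈ Finset.range l, (σv ^ 2 * C ^ 2 * M₁) ^ i * U (l - i)

end MoGP

/-! Why the bound holds. Given the variables up to the node variances of layer `l`, the difference
of the two pre-activations of a node of layer `l + 1` is a linear combination of fresh centred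
Gaussian variables, since the biases cancel. Its second moment is therefore a sum over the nodes of
layer `l`, without cross terms. A pruned node contributes `λ φ(Z)²` and a kept node `λ (φ(Z) -
φ(Z*))²`, never both. Positive homogeneity makes `φ` Lipschitz with constant `cLip φ` and zero at
the origin, and `λ` is independent of the pre-activations of its own layer. Writing `E_l` for the
error at layer `l`, this gives `E_{l+1} ≤ σv² C² (n E[λ; λ ≤ ε] U_l + N_n E_l)` with `E_1 = 0`
(`IsMoGP.lintegral_sq_net_sub_net_le`). Unrolled, the recursion is the geometric-type sum in
`pruningConst` (`pruningError_le_errBound`), as soon as the limits of the two coefficients are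
controlled. By (UI), `N_n → M₁`.

The coefficient `n E[λ; λ ≤ ε]`. The Laplace transform of the sum is an `n`-th power, so its
convergence says that `n ∫ (1 - e^{-tx}) dμ_n → ψ(t)`. Polynomials in `e^{-x}` are dense among
continuous functions of `e^{-x}`, so `n μ_n` converges to `ρ` against every `f(e^{-x}) (1 - e^{-x})`
with `f` continuous (`tendsto_integral_comp_exp`). It follows that `n E[λ; λ ≤ a]` tends to the
integral of `u` over `(0, a]` against `ρ` whenever `a` is not an atom (`tendsto_setMean_Iic`). A
Potter bound on the tail (`exists_tail_le_rpow`) and the layer-cake formula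
(`setLIntegral_Iic_le_rpow`) bound this integral by `a^{1-(α+δ)} / (1-(α+δ))`.

Why the limit exists when `ρ {ε} = 0`. Suppose first that the weights take finitely many values and
vanish on all other nodes. The numbers of nodes of each nonzero type then have a Poisson limit, and
given the types the next layer is a Gaussian mixture over the layer below. Induction on the layers
shows that the expectation of any measurable function of quadratic growth of finitely many nodes
converges (`exists_tendsto_lintegral_netPair`). In general `√λ` is replaced by a step function on a
geometric grid that has `ε` among its nodes, so that pruning is decided by the type. By `L²`
stability of the network in its weights (`exists_lintegral_sq_net_sub_le`) the pruning error is
eventually within any `η` of a convergent quantity, hence converges (`exists_tendsto_pruningError`).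
-/

namespace MoGP

/-! ### The tail of a Lévy measure -/

lemma IsLevyMeasure.measure_Ioi_lt_top {ρ : Measure ℝ} (hρ : IsLevyMeasure ρ) {u : ℝ}
    (hu : 0 < u) : ρ (Set.Ioi u) < ⊤ := by
  have hc : 0 < min 1 u := lt_min one_pos hu
  have h := mul_meas_ge_le_lintegral (μ := ρ) (f := fun x => ENNReal.ofReal (min 1 x))
    (by fun_prop) (ENNReal.ofReal (min 1 u))
  have h1 : ρ {x | ENNReal.ofReal (min 1 u) ≤ ENNReal.ofReal (min 1 x)} < ⊤ := by
    by_contra hcon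
    rw [not_lt_top_iff] at hcon
    rw [hcon, ENNReal.mul_top (by simpa using hu)] at h
    exact absurd (h.trans_lt hρ.lintegral_min_lt_top) (lt_irrefl _)
  refine (measure_mono ?_).trans_lt h1
  intro x hx
  exact ENNReal.ofReal_le_ofReal (min_le_min_left _ (le_of_lt hx))

lemma IsLevyMeasure.ofReal_tail {ρ : Measure ℝ} (hρ : IsLevyMeasure ρ) {u : ℝ}
    (hu : 0 < u) : ENNReal.ofReal (tail ρ u) = ρ (Set.Ioi u) :=
  ENNReal.ofReal_toReal (hρ.measure_Ioi_lt_top hu).ne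

lemma IsLevyMeasure.tail_le_tail {ρ : Measure ℝ} (hρ : IsLevyMeasure ρ) {u v : ℝ}
    (hu : 0 < u) (huv : u ≤ v) : tail ρ v ≤ tail ρ u :=
  ENNReal.toReal_mono (hρ.measure_Ioi_lt_top hu).ne (measure_mono (Set.Ioi_subset_Ioi huv))

/-- The asymptotic equivalence is used at `u / 2` and at `u`; slow variation with factor `2` cancels
the two values of `S`, and the powers leave `2 ^ α`. -/
lemma TailRegularAtZero.tendsto_tail_half_div {ρ : Measure ℝ} {α : ℝ} {S : ℝ → ℝ}
    (hS : SlowlyVarying S) (h : TailRegularAtZero ρ α S) :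
    Tendsto (fun u => tail ρ (u / 2) / tail ρ u) (𝓝[>] 0) (𝓝 (2 ^ α)) := by
  have hhalf : Tendsto (fun u : ℝ => u / 2) (𝓝[>] 0) (𝓝[>] 0) := by
    refine tendsto_nhdsWithin_iff.2 ⟨?_, ?_⟩
    · have : Tendsto (fun u : ℝ => u / 2) (𝓝 0) (𝓝 (0 / 2)) := by
        exact (continuous_id.div_const 2).tendsto 0
      rw [zero_div] at this
      exact this.mono_left nhdsWithin_le_nhds
    · filter_upwards [self_mem_nhdsWithin] with u hu
      exact half_pos (Set.mem_Ioi.1 hu)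
  have h2 := h.comp hhalf
  have hinv : Tendsto (fun u : ℝ => 1 / u) (𝓝[>] 0) atTop := by
    simpa using tendsto_inv_nhdsGT_zero (𝕜 := ℝ)
  have h3 := (hS 2 two_pos).comp hinv
  have h4 := (h2.mul (h3.const_mul (2 ^ α : ℝ))).div h one_ne_zero
  simp only [mul_one, one_mul, div_one] at h4
  refine h4.congr' ?_
  -- No sign or nonvanishing of `S` is assumed. Since `x / 0 = 0`, a quotient tending to `1` has a
  -- nonzero numerator and a nonzero denominator near `0`, which is all that the cancellation needs.
  have hne : ∀ᶠ u in 𝓝[>] (0 : ℝ), tail ρ u / (u ^ (-α) * S (1 / u)) ≠ 0 :=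
    h.eventually_ne one_ne_zero
  filter_upwards [hne, hhalf.eventually hne, self_mem_nhdsWithin] with u hu1 hu2 hu
  rw [Set.mem_Ioi] at hu
  have e1 : (1 : ℝ) / (u / 2) = 2 * (1 / u) := by field_simp
  have e2 : (u / 2) ^ (-α) = u ^ (-α) * 2 ^ α := by
    rw [Real.div_rpow hu.le two_pos.le, Real.rpow_neg two_pos.le, div_inv_eq_mul]
  simp only [e1, e2] at hu2
  simp only [Pi.div_apply, Function.comp, e1, e2]
  have a1 : tail ρ u ≠ 0 := fun h => hu1 (by rw [h, zero_div])
  have a2 : u ^ (-α) * S (1 / u) ≠ 0 := fun h => hu1 (by rw [h, div_zero])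
  have a3 : u ^ (-α) ≠ 0 := left_ne_zero_of_mul a2
  have a4 : S (1 / u) ≠ 0 := right_ne_zero_of_mul a2
  have a5 : u ^ (-α) * 2 ^ α * S (2 * (1 / u)) ≠ 0 := fun h => hu2 (by rw [h, div_zero])
  have a6 : S (2 * (1 / u)) ≠ 0 := right_ne_zero_of_mul a5
  have a7 : (2 : ℝ) ^ α ≠ 0 := (Real.rpow_pos_of_pos two_pos _).ne'
  clear hu1 hu2 a2 a5 e1 e2 h2 h3 h4 hne
  generalize S (2 * (1 / u)) = s2 at *
  generalize S (1 / u) = s1 at *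
  generalize u ^ (-α) = v at *
  generalize (2 : ℝ) ^ α = w at *
  field_simp

/-- A bound of Potter type. -/
lemma exists_tail_le_rpow {ρ : Measure ℝ} (hρ : IsLevyMeasure ρ) {α : ℝ} (hα : 0 ≤ α) {S : ℝ → ℝ}
    (hS : SlowlyVarying S) (h : TailRegularAtZero ρ α S) {δ : ℝ} (hδ : 0 < δ) :
    ∃ ε₀ : ℝ, 0 < ε₀ ∧ ∀ u, 0 < u → u < ε₀ → tail ρ u ≤ u ^ (-(α + δ)) := by
  -- One half of `δ` gives room above the limit ratio `2 ^ α`; the other half absorbs the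
  -- multiplicative constant at the end.
  set γ := α + δ / 2 with hγ
  have hγ0 : 0 < γ := by positivity
  have hlt : (2 : ℝ) ^ α < 2 ^ γ := Real.rpow_lt_rpow_of_exponent_lt one_lt_two (by linarith)
  have hev : ∀ᶠ u in 𝓝[>] (0 : ℝ), tail ρ (u / 2) ≤ 2 ^ γ * tail ρ u := by
    have hne : ∀ᶠ u in 𝓝[>] (0 : ℝ), tail ρ u / (u ^ (-α) * S (1 / u)) ≠ 0 :=
      Tendsto.eventually_ne h one_ne_zero
    filter_upwards [(h.tendsto_tail_half_div hS).eventually_lt_const hlt, hne] with u hu hu1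
    have hpos : 0 < tail ρ u :=
      lt_of_le_of_ne ENNReal.toReal_nonneg (fun h => hu1 (by simp [← h]))
    exact ((div_lt_iff₀ hpos).1 hu).le
  obtain ⟨u₀, hu₀, hu₀'⟩ := mem_nhdsGT_iff_exists_Ioc_subset.1 hev
  rw [Set.mem_Ioi] at hu₀
  have hiter : ∀ n : ℕ, tail ρ (u₀ * (1 / 2) ^ n) ≤ ((2 : ℝ) ^ γ) ^ n * tail ρ u₀ := by
    intro n
    induction n with
    | zero => simp
    | succ n ih =>
      have hmem : u₀ * (1 / 2) ^ n ∈ Set.Ioc 0 u₀ :=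
        ⟨by positivity, mul_le_of_le_one_right hu₀.le (pow_le_one₀ (by norm_num) (by norm_num))⟩
      have := hu₀' hmem
      change tail ρ (u₀ * (1 / 2) ^ n / 2) ≤ _ at this
      calc tail ρ (u₀ * (1 / 2) ^ (n + 1)) = tail ρ (u₀ * (1 / 2) ^ n / 2) := by
            congr 1; ring
        _ ≤ 2 ^ γ * tail ρ (u₀ * (1 / 2) ^ n) := this
        _ ≤ 2 ^ γ * (((2 : ℝ) ^ γ) ^ n * tail ρ u₀) := by gcongr
        _ = _ := by ring
  -- Between two consecutive dyadic points the tail is monotone, so passing to the lower one costs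
  -- only a factor `2 ^ γ`. Halving alone suffices, without uniformity in slow variation.
  have hbound : ∀ u, 0 < u → u < u₀ → tail ρ u ≤ (2 * u₀) ^ γ * tail ρ u₀ * u ^ (-γ) := by
    intro u hu huu
    obtain ⟨n, hn1, hn2⟩ := exists_nat_pow_near_of_lt_one (x := u / u₀) (y := (1 / 2 : ℝ))
      (by positivity) ((div_le_one hu₀).2 huu.le) (by norm_num) (by norm_num)
    have h1 : tail ρ u ≤ ((2 : ℝ) ^ γ) ^ (n + 1) * tail ρ u₀ := by
      refine (hρ.tail_le_tail (by positivity) ?_).trans (hiter (n + 1))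
      rw [lt_div_iff₀ hu₀] at hn1
      linarith
    have h2 : ((2 : ℝ) ^ γ) ^ (n + 1) ≤ (2 * u₀) ^ γ * u ^ (-γ) := by
      rw [← Real.rpow_natCast, ← Real.rpow_mul two_pos.le, mul_comm γ, Real.rpow_mul two_pos.le,
        Real.rpow_neg hu.le, ← div_eq_mul_inv, ← Real.div_rpow (by positivity) hu.le,
        Real.rpow_natCast]
      refine Real.rpow_le_rpow (by positivity) ?_ hγ0.le
      rw [div_le_iff₀ hu₀] at hn2
      rw [le_div_iff₀ hu]
      calc (2 : ℝ) ^ (n + 1) * u ≤ 2 ^ (n + 1) * ((1 / 2) ^ n * u₀) := by gcongr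
        _ = 2 * u₀ * (2 ^ n * (1 / 2) ^ n) := by ring
        _ = 2 * u₀ := by rw [← mul_pow]; norm_num
    calc tail ρ u ≤ _ := h1
      _ ≤ ((2 * u₀) ^ γ * u ^ (-γ)) * tail ρ u₀ := by gcongr; exact ENNReal.toReal_nonneg
      _ = _ := by ring
  set K := (2 * u₀) ^ γ * tail ρ u₀ with hK
  have hsmall : ∀ᶠ u in 𝓝[>] (0 : ℝ), K * u ^ (δ / 2) < 1 := by
    have : Tendsto (fun u : ℝ => K * u ^ (δ / 2)) (𝓝 0) (𝓝 (K * 0 ^ (δ / 2))) :=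
      ((Real.continuous_rpow_const (by positivity)).tendsto 0).const_mul K
    rw [Real.zero_rpow (by positivity), mul_zero] at this
    exact (this.mono_left nhdsWithin_le_nhds).eventually_lt_const one_pos
  obtain ⟨u₁, hu₁, hu₁'⟩ := mem_nhdsGT_iff_exists_Ioc_subset.1 hsmall
  refine ⟨min u₀ u₁, lt_min hu₀ hu₁, fun u hu huu => ?_⟩
  have h1 := hbound u hu (huu.trans_le (min_le_left _ _))
  have h2 : K * u ^ (δ / 2) < 1 := hu₁' ⟨hu, (huu.trans_le (min_le_right _ _)).le⟩
  have h3 : u ^ (-γ) = u ^ (δ / 2) * u ^ (-(α + δ)) := by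
    rw [← Real.rpow_add hu]; congr 1; rw [hγ]; ring
  rw [h3] at h1
  have h4 : 0 < u ^ (-(α + δ)) := Real.rpow_pos_of_pos hu _
  nlinarith

/-- The mass that small jumps contribute to the first moment. -/
lemma setLIntegral_Iic_le_rpow {ρ : Measure ℝ} (hρ : IsLevyMeasure ρ) {η ε₀ : ℝ} (hη : η < 1)
    (h : ∀ u, 0 < u → u < ε₀ → tail ρ u ≤ u ^ (-η)) {ε : ℝ} (hε : 0 < ε) (hεε : ε ≤ ε₀) :
    ∫⁻ x in Set.Iic ε, ENNReal.ofReal x ∂ρ ≤ ENNReal.ofReal (ε ^ (1 - η) / (1 - η)) := by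
  have hpos : 0 ≤ᵐ[ρ.restrict (Set.Iic ε)] fun x => x := by
    refine ae_restrict_of_ae ?_
    have : ∀ᵐ x ∂ρ, x ∉ Set.Iic (0 : ℝ) := measure_eq_zero_iff_ae_notMem.1 hρ.null_nonpos
    filter_upwards [this] with x hx
    exact (not_le.1 hx).le
  -- Layer cake: the integral becomes that of `t ↦ ρ((t, ε])`, which vanishes for `t ≥ ε` and is at
  -- most `t ^ (-η)` below.
  rw [lintegral_eq_lintegral_meas_lt _ hpos aemeasurable_id']
  have hle : ∀ t ∈ Set.Ioi (0 : ℝ), (ρ.restrict (Set.Iic ε)) {a | t < a}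
      ≤ (Set.Ioc 0 ε).indicator (fun t => ENNReal.ofReal (t ^ (-η))) t := by
    intro t ht
    rw [Set.mem_Ioi] at ht
    change (ρ.restrict (Set.Iic ε)) (Set.Ioi t) ≤ _
    rw [Measure.restrict_apply measurableSet_Ioi]
    rcases lt_or_ge t ε with hlt | hge
    · rw [Set.indicator_of_mem (show t ∈ Set.Ioc 0 ε from ⟨ht, hlt.le⟩)]
      refine (measure_mono Set.inter_subset_left).trans ?_
      refine (hρ.ofReal_tail ht).symm.le.trans ?_
      exact ENNReal.ofReal_le_ofReal (h t ht (hlt.trans_le hεε))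
    · rw [Set.Ioi_inter_Iic, Set.Ioc_eq_empty (not_lt.2 hge)]
      simp
  refine (setLIntegral_mono' measurableSet_Ioi hle).trans ?_
  refine (setLIntegral_le_lintegral _ _).trans ?_
  rw [lintegral_indicator measurableSet_Ioc]
  have hint : IntervalIntegrable (fun t : ℝ => t ^ (-η)) volume 0 ε :=
    intervalIntegral.intervalIntegrable_rpow' (by linarith)
  have hint' := (intervalIntegrable_iff_integrableOn_Ioc_of_le hε.le).1 hint
  rw [← ofReal_integral_eq_lintegral_ofReal hint']
  · refine ENNReal.ofReal_le_ofReal ?_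
    rw [← intervalIntegral.integral_of_le hε.le, integral_rpow (Or.inl (by linarith)),
      Real.zero_rpow (by linarith), sub_zero, show -η + 1 = 1 - η by ring]
  · filter_upwards [ae_restrict_mem measurableSet_Ioc] with t ht
    exact Real.rpow_nonneg ht.1.le _

/-! ### Convergence of the node variances of one layer -/

lemma integral_exp_sumLaw (μ : ℕ+ → ProbabilityMeasure ℝ≥0) (n : ℕ+) (t : ℝ) :
    ∫ s : ℝ≥0, Real.exp (-(t * s)) ∂(sumLaw μ n : Measure ℝ≥0)
      = (∫ x : ℝ≥0, Real.exp (-(t * x)) ∂(μ n : Measure ℝ≥0)) ^ (n : ℕ) := by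
  rw [sumLaw, ProbabilityMeasure.toMeasure_map, integral_map (by fun_prop) (by fun_prop)]
  have h : ∀ v : Fin n → ℝ≥0, Real.exp (-(t * ((∑ j, v j : ℝ≥0) : ℝ)))
      = ∏ j, Real.exp (-(t * (v j : ℝ))) := by
    intro v
    rw [← Real.exp_sum, NNReal.coe_sum, Finset.mul_sum, Finset.sum_neg_distrib]
  simp_rw [h]
  have := integral_fintype_prod_eq_pow (ι := Fin n) (μ := (μ n : Measure ℝ≥0))
    (fun x : ℝ≥0 => Real.exp (-(t * (x : ℝ))))
  rw [Fintype.card_fin] at this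
  exact this

lemma meanSum_eq (μ : ℕ+ → ProbabilityMeasure ℝ≥0) (n : ℕ+) :
    meanSum μ n = n * ∫⁻ x : ℝ≥0, x ∂(μ n : Measure ℝ≥0) := by
  rw [meanSum, sumLaw, ProbabilityMeasure.toMeasure_map, lintegral_map (by fun_prop) (by fun_prop)]
  simp_rw [ENNReal.ofNNReal_finsetSum]
  rw [lintegral_finsetSum _ (fun j _ => by fun_prop)]
  have h : ∀ j : Fin n, ∫⁻ v : Fin n → ℝ≥0, (v j : ℝ≥0∞)
      ∂(ProbabilityMeasure.pi fun _ : Fin n => μ n : Measure (Fin n → ℝ≥0))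
      = ∫⁻ x : ℝ≥0, x ∂(μ n : Measure ℝ≥0) := by
    intro j
    exact (measurePreserving_eval (fun _ : Fin n => (μ n : Measure ℝ≥0)) j).lintegral_comp
      (f := fun x : ℝ≥0 => (x : ℝ≥0∞)) (by fun_prop)
  simp_rw [h]
  simp

lemma pnat_coe_tendsto_atTop : Tendsto (fun n : ℕ+ => (n : ℝ)) atTop atTop :=
  tendsto_natCast_atTop_atTop.comp tendsto_PNat_val_atTop_atTop

/-- With `u = -log (a n)`, the hypothesis says `n u → c`, so `u → 0`, and `u - u² ≤ 1 - e^{-u} ≤ u`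
squeezes `n (1 - a n)`. -/
lemma tendsto_mul_one_sub_of_tendsto_pow {a : ℕ+ → ℝ} {c : ℝ} (h0 : ∀ n, 0 < a n)
    (h1 : ∀ n, a n ≤ 1) (h : Tendsto (fun n => a n ^ (n : ℕ)) atTop (𝓝 (Real.exp (-c)))) :
    Tendsto (fun n : ℕ+ => (n : ℝ) * (1 - a n)) atTop (𝓝 c) := by
  have hu : Tendsto (fun n : ℕ+ => (n : ℝ) * (-Real.log (a n))) atTop (𝓝 c) := by
    have := ((Real.continuousAt_log (Real.exp_pos (-c)).ne').tendsto.comp h).neg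
    rw [Real.log_exp, neg_neg] at this
    refine this.congr fun n => ?_
    simp [Real.log_pow]
  have hu0 : Tendsto (fun n : ℕ+ => -Real.log (a n)) atTop (𝓝 0) := by
    have := hu.mul (tendsto_inv_atTop_zero.comp pnat_coe_tendsto_atTop)
    rw [mul_zero] at this
    refine this.congr fun n => ?_
    have : (n : ℝ) ≠ 0 := by exact_mod_cast n.ne_zero
    simp only [Function.comp]
    field_simp
  have hlow : Tendsto (fun n : ℕ+ => (n : ℝ) * (-Real.log (a n))
      - (n : ℝ) * (-Real.log (a n)) * (-Real.log (a n))) atTop (𝓝 c) := by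
    simpa using hu.sub (hu.mul hu0)
  refine tendsto_of_tendsto_of_tendsto_of_le_of_le' hlow hu ?_ ?_
  · filter_upwards [hu0.eventually_lt_const one_pos] with n hn
    have hl : Real.log (a n) ≤ 0 := Real.log_nonpos (h0 n).le (h1 n)
    have := Real.abs_exp_sub_one_sub_id_le (x := Real.log (a n)) (by
      rw [abs_of_nonpos hl]; exact hn.le)
    rw [Real.exp_log (h0 n), abs_le] at this
    have hn0 : (0 : ℝ) ≤ n := by positivity
    nlinarith [this.2]
  · refine Eventually.of_forall fun n => ?_
    have := Real.add_one_le_exp (Real.log (a n))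
    rw [Real.exp_log (h0 n)] at this
    have hn0 : (0 : ℝ) ≤ n := by positivity
    nlinarith

lemma IsLevyMeasure.ae_pos {ρ : Measure ℝ} (hρ : IsLevyMeasure ρ) : ∀ᵐ x ∂ρ, 0 < x := by
  filter_upwards [measure_eq_zero_iff_ae_notMem.1 hρ.null_nonpos] with x hx
  exact not_le.1 hx

lemma IsLevyMeasure.integrable_id {ρ : Measure ℝ} (hρ : IsLevyMeasure ρ)
    (hM : firstMoment ρ < ⊤) : Integrable (fun x : ℝ => x) ρ := by
  refine ⟨by fun_prop, ?_⟩
  rw [hasFiniteIntegral_iff_ofReal (hρ.ae_pos.mono fun x hx => hx.le)]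
  exact hM

lemma IsLevyMeasure.integrable_one_sub_exp {ρ : Measure ℝ} (hρ : IsLevyMeasure ρ)
    (hM : firstMoment ρ < ⊤) {t : ℝ} (ht : 0 ≤ t) :
    Integrable (fun x : ℝ => 1 - Real.exp (-(x * t))) ρ := by
  refine ((hρ.integrable_id hM).mul_const t).mono' (by fun_prop) ?_
  filter_upwards [hρ.ae_pos] with x hx
  have h1 : Real.exp (-(x * t)) ≤ 1 := Real.exp_le_one_iff.2 (by nlinarith)
  rw [Real.norm_eq_abs, abs_of_nonneg (by linarith)]
  linarith [Real.add_one_le_exp (-(x * t))]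

lemma tendsto_mul_integral_one_sub_exp {ρ : Measure ℝ} {μ : ℕ+ → ProbabilityMeasure ℝ≥0}
    (h : SumTendstoID μ 0 ρ) {t : ℝ} (ht : 0 ≤ t) :
    Tendsto (fun n : ℕ+ => (n : ℝ) * ∫ x : ℝ≥0, (1 - Real.exp (-(x * t))) ∂(μ n : Measure ℝ≥0))
      atTop (𝓝 (laplaceExponent ρ t)) := by
  obtain ⟨ν, hν, hlim⟩ := h
  have hle : ∀ x : ℝ≥0, Real.exp (-(t * x)) ≤ 1 := fun x =>
    Real.exp_le_one_iff.2 (by have := mul_nonneg ht x.coe_nonneg; linarith)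
  have hint : ∀ n, Integrable (fun x : ℝ≥0 => Real.exp (-(t * x))) (μ n : Measure ℝ≥0) := fun n =>
    (integrable_const (1 : ℝ)).mono' (by fun_prop) (Eventually.of_forall fun x => by
      rw [Real.norm_eq_abs, abs_of_pos (Real.exp_pos _)]; exact hle x)
  let f : BoundedContinuousFunction ℝ≥0 ℝ :=
    BoundedContinuousFunction.ofNormedAddCommGroup (fun x : ℝ≥0 => Real.exp (-(t * x)))
      (by fun_prop) 1 (fun x => by
        rw [Real.norm_eq_abs, abs_of_pos (Real.exp_pos _)]; exact hle x)
  have h1 := ProbabilityMeasure.tendsto_iff_forall_integral_tendsto.1 hlim f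
  have h2 : Tendsto (fun n => (∫ x : ℝ≥0, Real.exp (-(t * x)) ∂(μ n : Measure ℝ≥0)) ^ (n : ℕ))
      atTop (𝓝 (Real.exp (-laplaceExponent ρ t))) := by
    have e : ∫ x : ℝ≥0, f x ∂(ν : Measure ℝ≥0) = Real.exp (-laplaceExponent ρ t) := by
      have := hν t ht
      simp only [NNReal.coe_zero, mul_zero, neg_zero, zero_sub] at this
      exact this
    rw [e] at h1
    exact h1.congr fun n => integral_exp_sumLaw μ n t
  have h3 := tendsto_mul_one_sub_of_tendsto_pow (fun n => integral_exp_pos (hint n)) (fun n => by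
      have := integral_mono (hint n) (integrable_const (1 : ℝ)) hle
      simpa using this) h2
  refine h3.congr fun n => ?_
  rw [integral_sub (integrable_const _) (by simpa [mul_comm] using hint n)]
  simp [mul_comm]

/-! ### Convergence of `n μ_n` to `ρ` against `f(e^{-x}) (1 - e^{-x})` -/

section Continuous

variable {ρ : Measure ℝ} (hρ : IsLevyMeasure ρ) (hM : firstMoment ρ < ⊤)
  {μ : ℕ+ → ProbabilityMeasure ℝ≥0} (hμ : SumTendstoID μ 0 ρ)

lemma exp_neg_mem_Icc {x : ℝ} (hx : 0 ≤ x) : Real.exp (-x) ∈ Set.Icc (0 : ℝ) 1 :=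
  ⟨(Real.exp_pos _).le, Real.exp_le_one_iff.2 (by linarith)⟩

lemma exists_bound_comp_exp {f : ℝ → ℝ} (hf : Continuous f) :
    ∃ C, 0 ≤ C ∧ ∀ x : ℝ, 0 ≤ x → |f (Real.exp (-x))| ≤ C := by
  obtain ⟨C, hC⟩ := isCompact_Icc.exists_bound_of_continuousOn (s := Set.Icc (0 : ℝ) 1)
    hf.continuousOn
  exact ⟨C, (norm_nonneg _).trans (hC 0 (by simp)), fun x hx => hC _ (exp_neg_mem_Icc hx)⟩

include hρ hM in
lemma integrable_comp_exp_mul {f : ℝ → ℝ} (hf : Continuous f) :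
    Integrable (fun x : ℝ => f (Real.exp (-x)) * (1 - Real.exp (-x))) ρ := by
  obtain ⟨C, hC0, hC⟩ := exists_bound_comp_exp hf
  have := (hρ.integrable_one_sub_exp hM zero_le_one).const_mul C
  simp only [mul_one] at this
  refine this.mono' (by fun_prop) ?_
  filter_upwards [hρ.ae_pos] with x hx
  have := (exp_neg_mem_Icc hx.le).2
  rw [Real.norm_eq_abs, abs_mul, abs_of_nonneg (sub_nonneg.2 this)]
  exact mul_le_mul_of_nonneg_right (hC x hx.le) (sub_nonneg.2 this)

lemma integrable_comp_exp_mul_nnreal (ν : Measure ℝ≥0) [IsFiniteMeasure ν] {f : ℝ → ℝ}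
    (hf : Continuous f) :
    Integrable (fun x : ℝ≥0 => f (Real.exp (-x)) * (1 - Real.exp (-x))) ν := by
  obtain ⟨C, hC0, hC⟩ := exists_bound_comp_exp hf
  refine (integrable_const C).mono' (by fun_prop) (Eventually.of_forall fun x => ?_)
  have h1 := exp_neg_mem_Icc x.coe_nonneg
  have h2 : |1 - Real.exp (-x)| ≤ 1 := by
    rw [abs_of_nonneg (sub_nonneg.2 h1.2)]
    linarith [h1.1]
  rw [Real.norm_eq_abs, abs_mul]
  calc _ ≤ C * 1 := mul_le_mul (hC x x.coe_nonneg) h2 (abs_nonneg _) hC0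
    _ = C := mul_one C

include hρ hM hμ in
-- With `y = e^{-x}`, `y^k (1 - y) = (1 - y^{k+1}) - (1 - y^k)`, so each monomial reduces to the
-- Laplace exponent at the integers `k + 1` and `k`.
lemma tendsto_integral_polynomial_comp_exp (p : Polynomial ℝ) :
    Tendsto (fun n : ℕ+ => (n : ℝ) *
      ∫ x : ℝ≥0, p.eval (Real.exp (-x)) * (1 - Real.exp (-x)) ∂(μ n : Measure ℝ≥0)) atTop
      (𝓝 (∫ x, p.eval (Real.exp (-x)) * (1 - Real.exp (-x)) ∂ρ)) := by
  induction p using Polynomial.induction_on' with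
  | add p q hp hq =>
    simp only [Polynomial.eval_add, add_mul]
    rw [integral_add (integrable_comp_exp_mul hρ hM p.continuous)
      (integrable_comp_exp_mul hρ hM q.continuous)]
    refine (hp.add hq).congr fun n => ?_
    rw [integral_add (integrable_comp_exp_mul_nnreal _ p.continuous)
      (integrable_comp_exp_mul_nnreal _ q.continuous), mul_add]
  | monomial k a =>
    have key : ∀ x : ℝ, (Polynomial.monomial k a).eval (Real.exp (-x)) * (1 - Real.exp (-x))
        = a * ((1 - Real.exp (-(x * (k + 1 : ℕ)))) - (1 - Real.exp (-(x * (k : ℕ))))) := by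
      intro x
      have e1 : Real.exp (-(x * (k + 1 : ℕ))) = Real.exp (-x) ^ (k + 1) := by
        rw [← Real.exp_nat_mul]; congr 1; ring
      have e2 : Real.exp (-(x * (k : ℕ))) = Real.exp (-x) ^ k := by
        rw [← Real.exp_nat_mul]; congr 1; ring
      rw [e1, e2, Polynomial.eval_monomial]
      ring
    have hint : ∀ (n : ℕ+) (m : ℕ), Integrable (fun x : ℝ≥0 => 1 - Real.exp (-(x * (m : ℕ))))
        (μ n : Measure ℝ≥0) := by
      intro n m
      refine (integrable_const (1 : ℝ)).mono' (by fun_prop) (Eventually.of_forall fun x => ?_)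
      have h1 := exp_neg_mem_Icc (mul_nonneg x.coe_nonneg (Nat.cast_nonneg m))
      rw [Real.norm_eq_abs, abs_of_nonneg (sub_nonneg.2 h1.2)]
      linarith [h1.1]
    simp only [key]
    rw [integral_const_mul, integral_sub (hρ.integrable_one_sub_exp hM (Nat.cast_nonneg _))
      (hρ.integrable_one_sub_exp hM (Nat.cast_nonneg _))]
    refine (((tendsto_mul_integral_one_sub_exp hμ (Nat.cast_nonneg (k + 1))).sub
      (tendsto_mul_integral_one_sub_exp hμ (Nat.cast_nonneg k))).const_mul a).congr fun n => ?_
    rw [integral_const_mul, integral_sub (hint n (k + 1)) (hint n k)]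
    ring

lemma abs_integral_comp_exp_sub_le (ν : Measure ℝ≥0) [IsFiniteMeasure ν] {f g : ℝ → ℝ}
    (hf : Continuous f) (hg : Continuous g) {η : ℝ}
    (h : ∀ y ∈ Set.Icc (0 : ℝ) 1, |f y - g y| ≤ η) :
    |∫ x : ℝ≥0, f (Real.exp (-x)) * (1 - Real.exp (-x)) ∂ν
      - ∫ x : ℝ≥0, g (Real.exp (-x)) * (1 - Real.exp (-x)) ∂ν|
      ≤ η * ∫ x : ℝ≥0, (1 - Real.exp (-(x * (1 : ℝ)))) ∂ν := by
  rw [← integral_sub (integrable_comp_exp_mul_nnreal _ hf) (integrable_comp_exp_mul_nnreal _ hg),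
    ← integral_const_mul]
  rw [← Real.norm_eq_abs]
  refine norm_integral_le_of_norm_le (Integrable.const_mul ?_ _) (Eventually.of_forall fun x => ?_)
  · simpa using integrable_comp_exp_mul_nnreal ν (f := fun _ => 1) continuous_const
  · have h1 := exp_neg_mem_Icc x.coe_nonneg
    rw [← sub_mul, norm_mul, mul_one, Real.norm_eq_abs, Real.norm_eq_abs,
      abs_of_nonneg (sub_nonneg.2 h1.2)]
    exact mul_le_mul_of_nonneg_right (h _ h1) (sub_nonneg.2 h1.2)

include hρ hM in
lemma abs_integral_comp_exp_sub_le' {f g : ℝ → ℝ}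
    (hf : Continuous f) (hg : Continuous g) {η : ℝ}
    (h : ∀ y ∈ Set.Icc (0 : ℝ) 1, |f y - g y| ≤ η) :
    |∫ x, f (Real.exp (-x)) * (1 - Real.exp (-x)) ∂ρ
      - ∫ x, g (Real.exp (-x)) * (1 - Real.exp (-x)) ∂ρ| ≤ η * laplaceExponent ρ 1 := by
  rw [← integral_sub (integrable_comp_exp_mul hρ hM hf) (integrable_comp_exp_mul hρ hM hg),
    laplaceExponent, ← integral_const_mul]
  rw [← Real.norm_eq_abs]
  refine norm_integral_le_of_norm_le
    ((hρ.integrable_one_sub_exp hM zero_le_one).const_mul _) ?_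
  filter_upwards [hρ.ae_pos] with x hx
  have h1 := exp_neg_mem_Icc hx.le
  rw [← sub_mul, norm_mul, mul_one, Real.norm_eq_abs, Real.norm_eq_abs,
    abs_of_nonneg (sub_nonneg.2 h1.2)]
  exact mul_le_mul_of_nonneg_right (h _ h1) (sub_nonneg.2 h1.2)

include hρ hM hμ in
-- Weierstrass approximation of `f` on `[0, 1]`. The error is uniform in `n` because the masses `n ∫
-- (1 - e^{-x}) dμ_n` converge and so are eventually bounded.
lemma tendsto_integral_comp_exp {f : ℝ → ℝ} (hf : Continuous f) :
    Tendsto (fun n : ℕ+ => (n : ℝ) *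
      ∫ x : ℝ≥0, f (Real.exp (-x)) * (1 - Real.exp (-x)) ∂(μ n : Measure ℝ≥0)) atTop
      (𝓝 (∫ x, f (Real.exp (-x)) * (1 - Real.exp (-x)) ∂ρ)) := by
  have hψ := tendsto_mul_integral_one_sub_exp hμ zero_le_one
  have hψ0 : 0 ≤ laplaceExponent ρ 1 := integral_nonneg_of_ae (by
    filter_upwards [hρ.ae_pos] with x hx
    rw [mul_one]
    exact sub_nonneg.2 (exp_neg_mem_Icc hx.le).2)
  rw [Metric.tendsto_atTop']
  intro ε hε
  -- A positive number that strictly exceeds the limit mass, hence eventually the masses themselves.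
  set c := laplaceExponent ρ 1 + 1 with hc
  have hc0 : 0 < c := by positivity
  obtain ⟨p, hp⟩ := exists_polynomial_near_of_continuousOn 0 1 f hf.continuousOn (ε / (3 * c))
    (by positivity)
  have h1 := (Metric.tendsto_nhds.1 (tendsto_integral_polynomial_comp_exp hρ hM hμ p) (ε / 3)
    (by positivity)).and (hψ.eventually_lt_const (show laplaceExponent ρ 1 < c by linarith))
  obtain ⟨N, hN⟩ := eventually_atTop.1 h1
  refine ⟨N, fun n hn => ?_⟩
  obtain ⟨h2, h3⟩ := hN n hn.le
  have h4 := abs_integral_comp_exp_sub_le (μ n : Measure ℝ≥0) p.continuous hf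
    (fun y hy => (hp y hy).le)
  have h5 := abs_integral_comp_exp_sub_le' hρ hM p.continuous hf (fun y hy => (hp y hy).le)
  rw [Real.dist_eq] at h2 ⊢
  have hn0 : (0 : ℝ) < n := by exact_mod_cast n.pos
  have h6 := mul_le_mul_of_nonneg_left h4 hn0.le
  have e3 : ε / (3 * c) * c = ε / 3 := by field_simp
  have h7 : (n : ℝ) * (ε / (3 * c) * ∫ x : ℝ≥0, (1 - Real.exp (-(x * (1 : ℝ)))) ∂(μ n : Measure ℝ≥0))
      < ε / 3 := by
    rw [mul_left_comm, ← e3]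
    exact mul_lt_mul_of_pos_left h3 (by positivity)
  have h8 : ε / (3 * c) * laplaceExponent ρ 1 ≤ ε / 3 := by
    rw [← e3]
    exact mul_le_mul_of_nonneg_left (by linarith) (by positivity)
  rw [← abs_of_pos hn0, ← abs_mul, abs_of_pos hn0, mul_sub] at h6
  rw [abs_lt] at h2 ⊢
  rw [abs_le] at h5 h6
  constructor <;> linarith [h2.1, h2.2, h5.1, h5.2, h6.1, h6.2]

end Continuous

/-- `n E[λ_n; λ_n ∈ s]`, the contribution of the node variances in `s` to `N_n`. -/
noncomputable def setMean (μ : ℕ+ → ProbabilityMeasure ℝ≥0) (s : Set ℝ) (n : ℕ+) : ℝ≥0∞ :=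
  n * ∫⁻ x in ((↑) : ℝ≥0 → ℝ) ⁻¹' s, (x : ℝ≥0∞) ∂(μ n : Measure ℝ≥0)

lemma setMean_add_setMean_compl (μ : ℕ+ → ProbabilityMeasure ℝ≥0) {s : Set ℝ}
    (hs : MeasurableSet s) (n : ℕ+) : setMean μ s n + setMean μ sᶜ n = meanSum μ n := by
  rw [setMean, setMean, meanSum_eq, ← mul_add, Set.preimage_compl,
    lintegral_add_compl _ (hs.preimage (by fun_prop))]

lemma setMean_mono (μ : ℕ+ → ProbabilityMeasure ℝ≥0) {s t : Set ℝ} (h : s ⊆ t) (n : ℕ+) :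
    setMean μ s n ≤ setMean μ t n := by
  unfold setMean
  gcongr

/-! ### Truncated first moments, tail counts and atoms -/

section Step

variable {ρ : Measure ℝ} (hρ : IsLevyMeasure ρ) (hM : firstMoment ρ < ⊤)
  {μ : ℕ+ → ProbabilityMeasure ℝ≥0} (hμ : SumTendstoID μ 0 ρ)

/-- The continuous ramp with values in `[0, 1]`, from `0` at `b - 1 / m` to `1` at `b`. -/
noncomputable def ramp (m b y : ℝ) : ℝ := max 0 (min 1 (1 + m * (y - b)))

@[fun_prop]
lemma continuous_ramp (m b : ℝ) : Continuous (ramp m b) := by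
  unfold ramp; fun_prop

lemma ramp_nonneg (m b y : ℝ) : 0 ≤ ramp m b y := le_max_left _ _

lemma ramp_le_one (m b y : ℝ) : ramp m b y ≤ 1 := max_le zero_le_one (min_le_left _ _)

lemma ramp_of_le {m b y : ℝ} (hm : 0 ≤ m) (h : b ≤ y) : ramp m b y = 1 := by
  have : 0 ≤ m * (y - b) := mul_nonneg hm (sub_nonneg.2 h)
  rw [ramp, min_eq_left (by linarith), max_eq_right zero_le_one]

lemma ramp_eq_zero {m b y : ℝ} (h : 1 + m * (y - b) ≤ 0) : ramp m b y = 0 := by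
  rw [ramp, max_eq_left (min_le_of_right_le h)]

include hρ hM hμ in
-- Portmanteau-type sandwich: in `y = e^{-x}` the cutoff is `c ≤ y`, which lies between two
-- continuous ramps. As `g ≥ 0`, this orders the integrals, and as `a` is not an atom, both ramps
-- give the same limit under `ρ`.
lemma tendsto_integral_step {g : ℝ → ℝ} (hg : Continuous g) (hg0 : ∀ y, 0 ≤ g y) {a : ℝ}
    (ha : ρ {a} = 0) :
    Tendsto (fun n : ℕ+ => (n : ℝ) *
      ∫ x : ℝ≥0, (if (x : ℝ) ≤ a then g (Real.exp (-x)) * (1 - Real.exp (-x)) else 0)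
        ∂(μ n : Measure ℝ≥0)) atTop
      (𝓝 (∫ x, (if x ≤ a then g (Real.exp (-x)) * (1 - Real.exp (-x)) else 0) ∂ρ)) := by
  set c := Real.exp (-a) with hc
  have hxc : ∀ x : ℝ, x ≤ a ↔ c ≤ Real.exp (-x) := fun x => by
    rw [hc, Real.exp_le_exp, neg_le_neg_iff]
  set G : ℝ → ℝ := fun x => g (Real.exp (-x)) * (1 - Real.exp (-x)) with hG
  have hG0 : ∀ x, 0 ≤ x → 0 ≤ G x := fun x hx =>
    mul_nonneg (hg0 _) (sub_nonneg.2 (exp_neg_mem_Icc hx).2)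
  have hintμ : ∀ (n : ℕ+) (h : ℝ → ℝ), Continuous h → Integrable
      (fun x : ℝ≥0 => (h (Real.exp (-x)) * g (Real.exp (-x))) * (1 - Real.exp (-x)))
      (μ n : Measure ℝ≥0) :=
    fun n h hh => integrable_comp_exp_mul_nnreal _ (f := fun y => h y * g y) (hh.mul hg)
  have hstep : ∀ n : ℕ+, Integrable (fun x : ℝ≥0 => if (x : ℝ) ≤ a then G x else 0)
      (μ n : Measure ℝ≥0) := by
    intro n
    have h1 := (integrable_comp_exp_mul_nnreal (μ n : Measure ℝ≥0) hg).indicator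
      (s := {x : ℝ≥0 | (x : ℝ) ≤ a}) (measurableSet_le (by fun_prop) measurable_const)
    refine h1.congr (Eventually.of_forall fun x => ?_)
    simp [Set.indicator_apply, hG]
  have hlim : ∀ b : ℕ → ℝ,
      (∀ x : ℝ, x ≠ a → Tendsto (fun m : ℕ => ramp m (b m) (Real.exp (-x))) atTop
        (𝓝 (if x ≤ a then 1 else 0))) →
      Tendsto (fun m : ℕ => ∫ x, (ramp m (b m) (Real.exp (-x)) * g (Real.exp (-x)))
        * (1 - Real.exp (-x)) ∂ρ) atTop (𝓝 (∫ x, (if x ≤ a then G x else 0) ∂ρ)) := by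
    intro b hb
    refine tendsto_integral_of_dominated_convergence G (fun m => by fun_prop)
      (integrable_comp_exp_mul hρ hM hg) (fun m => ?_) ?_
    · filter_upwards [hρ.ae_pos] with x hx
      rw [mul_assoc, norm_mul, Real.norm_eq_abs, Real.norm_eq_abs, abs_of_nonneg (ramp_nonneg _ _ _),
        abs_of_nonneg (hG0 x hx.le)]
      exact mul_le_of_le_one_left (hG0 x hx.le) (ramp_le_one _ _ _)
    · filter_upwards [measure_eq_zero_iff_ae_notMem.1 ha] with x hx
      have := (hb x hx).mul_const (G x)
      simp only [ite_mul, one_mul, zero_mul] at this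
      refine this.congr fun m => ?_
      rw [hG, mul_assoc]
  -- The ramp that reaches `1` at `c` lies above the indicator.
  have hup := hlim (fun _ => c) (fun x hx => by
    by_cases h : x ≤ a
    · rw [if_pos h]
      exact tendsto_const_nhds.congr fun m => (ramp_of_le (Nat.cast_nonneg m) ((hxc x).1 h)).symm
    · rw [if_neg h]
      refine tendsto_const_nhds.congr' ?_
      have hlt : Real.exp (-x) < c := not_le.1 fun h' => h ((hxc x).2 h')
      filter_upwards [(tendsto_natCast_atTop_atTop (R := ℝ)).eventually_ge_atTop
        (1 / (c - Real.exp (-x)))] with m hm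
      refine (ramp_eq_zero ?_).symm
      rw [div_le_iff₀ (by linarith)] at hm
      linarith)
  -- The ramp that starts from `0` at `c` lies below the indicator. The value `m = 0` is meaningless
  -- here, as `1 / 0 = 0`, and is discarded by the filter.
  have hlo := hlim (fun m => c + 1 / m) (fun x hx => by
    by_cases h : x ≤ a
    · rw [if_pos h]
      have hlt : c < Real.exp (-x) := by
        rw [hc, Real.exp_lt_exp]; exact neg_lt_neg (lt_of_le_of_ne h hx)
      refine tendsto_const_nhds.congr' ?_
      filter_upwards [(tendsto_natCast_atTop_atTop (R := ℝ)).eventually_ge_atTop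
        (1 / (Real.exp (-x) - c)), eventually_gt_atTop 0] with m hm hm0
      refine (ramp_of_le (Nat.cast_nonneg m) ?_).symm
      have hm0' : (0 : ℝ) < m := by exact_mod_cast hm0
      rw [div_le_iff₀ (by linarith)] at hm
      have : 1 / (m : ℝ) ≤ Real.exp (-x) - c := by
        rw [div_le_iff₀ hm0']; linarith
      linarith
    · rw [if_neg h]
      have hlt : Real.exp (-x) < c := not_le.1 fun h' => h ((hxc x).2 h')
      refine tendsto_const_nhds.congr' ?_
      filter_upwards [eventually_gt_atTop 0] with m hm0
      have hm0' : (0 : ℝ) < m := by exact_mod_cast hm0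
      refine (ramp_eq_zero ?_).symm
      have : (m : ℝ) * (Real.exp (-x) - (c + 1 / m)) = m * (Real.exp (-x) - c) - 1 := by
        field_simp; ring
      rw [this]
      nlinarith)
  rw [tendsto_order]
  constructor
  · intro r hr
    obtain ⟨m, hm, hm0⟩ := ((hlo.eventually_const_lt hr).and (eventually_gt_atTop 0)).exists
    have hm0' : (0 : ℝ) < m := by exact_mod_cast hm0
    have hcont : Continuous (ramp m (c + 1 / m)) := by fun_prop
    have := tendsto_integral_comp_exp hρ hM hμ (hcont.mul hg)
    filter_upwards [this.eventually_const_lt hm] with n hn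
    refine hn.trans_le (mul_le_mul_of_nonneg_left ?_ (by positivity))
    refine integral_mono (hintμ n _ hcont) (hstep n) fun x => ?_
    simp only [Pi.mul_apply, mul_assoc]
    split_ifs with h
    · exact mul_le_of_le_one_left (hG0 x x.coe_nonneg) (ramp_le_one _ _ _)
    · have hlt : Real.exp (-x) < c := not_le.1 fun h' => h ((hxc x).2 h')
      rw [ramp_eq_zero, zero_mul]
      have : (m : ℝ) * (Real.exp (-x) - (c + 1 / m)) = m * (Real.exp (-x) - c) - 1 := by
        field_simp; ring
      rw [this]
      nlinarith
  · intro r hr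
    obtain ⟨m, hm⟩ := (hup.eventually_lt_const hr).exists
    have hcont : Continuous (ramp m c) := by fun_prop
    have := tendsto_integral_comp_exp hρ hM hμ (hcont.mul hg)
    filter_upwards [this.eventually_lt_const hm] with n hn
    refine lt_of_le_of_lt (mul_le_mul_of_nonneg_left ?_ (by positivity)) hn
    refine integral_mono (hstep n) (hintμ n _ hcont) fun x => ?_
    simp only [Pi.mul_apply, mul_assoc]
    split_ifs with h
    · rw [ramp_of_le (Nat.cast_nonneg m) ((hxc x).1 h), one_mul]
    · exact mul_nonneg (ramp_nonneg _ _ _) (hG0 x x.coe_nonneg)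

/-- `dslope` fills the removable singularity of `log y / (y - 1)` at `y = 1`; the truncation at `c`
keeps the argument away from the singularity of the logarithm at `0`. -/
lemma continuous_dslope_log_max {c : ℝ} (hc : 0 < c) :
    Continuous (fun y : ℝ => dslope Real.log 1 (max y c)) := by
  have h : ContinuousOn (dslope Real.log 1) (Set.Ioi 0) :=
    (continuousOn_dslope (Ioi_mem_nhds one_pos)).2
      ⟨Real.continuousOn_log.mono fun y hy => ne_of_gt hy,
        Real.differentiableAt_log one_ne_zero⟩
  exact h.comp_continuous (by fun_prop) fun y => lt_max_of_lt_right hc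

include hρ hM hμ in
-- On `[0, a]` the function `x = -log y`, with `y = e^{-x}`, is of the admissible form `g(y) (1 -
-- y)`, where `g` is the difference quotient of `log` at `1`; truncating `g` does not change it
-- there.
lemma tendsto_setMean_Iic {a : ℝ} (ha : ρ {a} = 0) :
    Tendsto (setMean μ (Set.Iic a)) atTop (𝓝 (∫⁻ x in Set.Iic a, ENNReal.ofReal x ∂ρ)) := by
  set c := Real.exp (-a) with hc
  have key : ∀ x : ℝ, 0 ≤ x → x ≤ a →
      max 0 (dslope Real.log 1 (max (Real.exp (-x)) c)) * (1 - Real.exp (-x)) = x := by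
    intro x hx hxa
    rw [max_eq_left (Real.exp_le_exp.2 (neg_le_neg hxa)),
      max_mul_of_nonneg _ _ (sub_nonneg.2 (exp_neg_mem_Icc hx).2), zero_mul]
    have := sub_smul_dslope Real.log 1 (Real.exp (-x))
    rw [Real.log_exp, Real.log_one, smul_eq_mul] at this
    rw [max_eq_right] <;> nlinarith
  have h := tendsto_integral_step hρ hM hμ
    (continuous_const.max (continuous_dslope_log_max (Real.exp_pos (-a))))
    (fun y => le_max_left 0 _) ha
  have h' := ENNReal.tendsto_ofReal h
  have e1 : ∫⁻ x in Set.Iic a, ENNReal.ofReal x ∂ρ = ENNReal.ofReal (∫ x, (if x ≤ a then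
      max 0 (dslope Real.log 1 (max (Real.exp (-x)) (Real.exp (-a)))) * (1 - Real.exp (-x))
      else 0) ∂ρ) := by
    have : ∫ x, (if x ≤ a then
      max 0 (dslope Real.log 1 (max (Real.exp (-x)) (Real.exp (-a)))) * (1 - Real.exp (-x))
      else 0) ∂ρ = ∫ x in Set.Iic a, x ∂ρ := by
      rw [← integral_indicator measurableSet_Iic]
      refine integral_congr_ae ?_
      filter_upwards [hρ.ae_pos] with x hx
      rw [Set.indicator_apply]
      by_cases h : x ≤ a
      · rw [if_pos h, if_pos (Set.mem_Iic.2 h), key x hx.le h]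
      · rw [if_neg h, if_neg (fun h' => h (Set.mem_Iic.1 h'))]
    rw [this, ofReal_integral_eq_lintegral_ofReal (hρ.integrable_id hM).integrableOn
      (ae_restrict_of_ae (hρ.ae_pos.mono fun x hx => hx.le))]
  rw [e1]
  refine h'.congr fun n => ?_
  have hms : MeasurableSet (((↑) : ℝ≥0 → ℝ) ⁻¹' Set.Iic a) := measurableSet_Iic.preimage (by fun_prop)
  have e2 : ∫ x : ℝ≥0, (if (x : ℝ) ≤ a then
      max 0 (dslope Real.log 1 (max (Real.exp (-x)) (Real.exp (-a)))) * (1 - Real.exp (-x))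
      else 0) ∂(μ n : Measure ℝ≥0) = ∫ x in ((↑) : ℝ≥0 → ℝ) ⁻¹' Set.Iic a, (x : ℝ)
        ∂(μ n : Measure ℝ≥0) := by
    rw [← integral_indicator hms]
    refine integral_congr_ae (Eventually.of_forall fun x => ?_)
    by_cases h : (x : ℝ) ≤ a
    · rw [Set.indicator_of_mem (show x ∈ ((↑) : ℝ≥0 → ℝ) ⁻¹' Set.Iic a from h)]
      simp only [if_pos h]
      exact key x x.coe_nonneg h
    · rw [Set.indicator_of_notMem (show x ∉ ((↑) : ℝ≥0 → ℝ) ⁻¹' Set.Iic a from h)]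
      simp only [if_neg h]
  rw [e2, ENNReal.ofReal_mul (by positivity), ENNReal.ofReal_natCast,
    ofReal_integral_eq_lintegral_ofReal]
  · simp only [ENNReal.ofReal_coe_nnreal]
    rfl
  · refine Measure.integrableOn_of_bounded (M := a) (measure_ne_top _ _) (by fun_prop) ?_
    filter_upwards [ae_restrict_mem hms] with x hx
    rw [Real.norm_eq_abs, abs_of_nonneg x.coe_nonneg]
    exact hx
  · exact Eventually.of_forall fun x => x.coe_nonneg

lemma setLIntegral_Iic_add_Ioi (ρ : Measure ℝ) (a : ℝ) : ∫⁻ x in Set.Iic a, ENNReal.ofReal x ∂ρ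
    + ∫⁻ x in Set.Ioi a, ENNReal.ofReal x ∂ρ = firstMoment ρ := by
  rw [← Set.compl_Iic, lintegral_add_compl _ measurableSet_Iic, firstMoment]

include hρ hM hμ in
-- The functions tested so far are bounded in `x` and cannot see mass escaping to infinity.
-- Convergence of the total mean excludes this, and the part above `a` is obtained by subtraction.
lemma tendsto_setMean_Ioi (hN : Tendsto (meanSum μ) atTop (𝓝 (firstMoment ρ)))
    {a : ℝ} (ha : ρ {a} = 0) :
    Tendsto (setMean μ (Set.Ioi a)) atTop (𝓝 (∫⁻ x in Set.Ioi a, ENNReal.ofReal x ∂ρ)) := by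
  have h1 := tendsto_setMean_Iic hρ hM hμ ha
  have hsum := setLIntegral_Iic_add_Ioi ρ a
  have hfin : ∫⁻ x in Set.Iic a, ENNReal.ofReal x ∂ρ ≠ ⊤ := by
    refine ((setLIntegral_le_lintegral _ _).trans_lt ?_).ne
    exact hM
  have h2 := ENNReal.Tendsto.sub hN h1 (Or.inl hM.ne)
  rw [← hsum, ENNReal.add_sub_cancel_left hfin] at h2
  refine h2.congr' ?_
  filter_upwards [h1.eventually_lt_const hfin.lt_top] with n hn
  rw [← setMean_add_setMean_compl μ measurableSet_Iic n, Set.compl_Iic,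
    ENNReal.add_sub_cancel_left hn.ne]

include hρ hM hμ in
-- A continuous `g` equal to `1 / (1 - y)` for `y ≤ e^{-a}` makes the test function equal to `1`
-- above `a`; subtracting its part on `x ≤ a` leaves the indicator.
lemma tendsto_mul_measure_Ioi {a : ℝ} (ha0 : 0 < a) (ha : ρ {a} = 0) :
    Tendsto (fun n : ℕ+ => (n : ℝ) * (μ n : Measure ℝ≥0).real (((↑) : ℝ≥0 → ℝ) ⁻¹' Set.Ioi a))
      atTop (𝓝 (ρ.real (Set.Ioi a))) := by
  set c := Real.exp (-a) with hc
  have hc1 : c < 1 := Real.exp_lt_one_iff.2 (by linarith)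
  set g : ℝ → ℝ := fun y => 1 / (1 - min y c) with hg
  have hpos : ∀ y, 0 < 1 - min y c := fun y => by linarith [min_le_right y c]
  have hgc : Continuous g :=
    continuous_const.div (by fun_prop) fun y => (hpos y).ne'
  have hg0 : ∀ y, 0 ≤ g y := fun y => div_nonneg zero_le_one (hpos y).le
  have key : ∀ x : ℝ, ¬ x ≤ a → g (Real.exp (-x)) * (1 - Real.exp (-x)) = 1 := by
    intro x hx
    have : Real.exp (-x) ≤ c := Real.exp_le_exp.2 (neg_le_neg (not_le.1 hx).le)
    rw [hg]
    simp only
    rw [min_eq_left this, one_div_mul_cancel]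
    linarith
  have h := (tendsto_integral_comp_exp hρ hM hμ hgc).sub (tendsto_integral_step hρ hM hμ hgc hg0 ha)
  have e0 : ∀ x : ℝ, g (Real.exp (-x)) * (1 - Real.exp (-x))
      - (if x ≤ a then g (Real.exp (-x)) * (1 - Real.exp (-x)) else 0)
      = (Set.Ioi a).indicator 1 x := by
    intro x
    rw [Set.indicator_apply]
    by_cases h : x ≤ a
    · rw [if_pos h, sub_self, if_neg (fun h' => not_lt.2 h (Set.mem_Ioi.1 h'))]
    · rw [if_neg h, sub_zero, key x h, if_pos (Set.mem_Ioi.2 (not_le.1 h))]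
      rfl
  have hst : ∀ x : ℝ, (if x ≤ a then g (Real.exp (-x)) * (1 - Real.exp (-x)) else 0)
      = (Set.Iic a).indicator (fun x => g (Real.exp (-x)) * (1 - Real.exp (-x))) x := by
    intro x
    simp [Set.indicator_apply]
  rw [← integral_sub (integrable_comp_exp_mul hρ hM hgc)
    (((integrable_comp_exp_mul hρ hM hgc).indicator measurableSet_Iic).congr
      (Eventually.of_forall fun x => (hst x).symm))] at h
  simp only [e0] at h
  rw [integral_indicator_one measurableSet_Ioi] at h
  refine h.congr fun n => ?_
  have hint := integrable_comp_exp_mul_nnreal (μ n : Measure ℝ≥0) hgc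
  have hms : MeasurableSet (((↑) : ℝ≥0 → ℝ) ⁻¹' Set.Iic a) := measurableSet_Iic.preimage (by fun_prop)
  have hms' : MeasurableSet (((↑) : ℝ≥0 → ℝ) ⁻¹' Set.Ioi a) := measurableSet_Ioi.preimage (by fun_prop)
  rw [← mul_sub, ← integral_sub hint ((hint.indicator hms).congr
    (Eventually.of_forall fun x => (hst x).symm))]
  simp only [e0]
  rw [← integral_indicator_one hms']
  rfl

include hρ in
-- All atoms are positive, and `ρ` is finite on each half-line `(1 / (n + 1), ∞)`.
lemma countable_atoms : {a : ℝ | 0 < ρ {a}}.Countable := by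
  have h : {a : ℝ | 0 < ρ {a}} ⊆
      ⋃ n : ℕ, {a : ℝ | 0 < (ρ.restrict (Set.Ioi (1 / (n + 1 : ℝ)))) {a}} := by
    intro a ha
    have ha0 : 0 < a := by
      by_contra hcon
      have := measure_mono_null (Set.singleton_subset_iff.2 (Set.mem_Iic.2 (not_lt.1 hcon)))
        hρ.null_nonpos
      exact (ne_of_gt ha) this
    obtain ⟨n, hn⟩ := exists_nat_one_div_lt ha0
    refine Set.mem_iUnion.2 ⟨n, ?_⟩
    change 0 < (ρ.restrict (Set.Ioi (1 / (n + 1 : ℝ)))) {a}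
    rw [Measure.restrict_apply (measurableSet_singleton a),
      Set.inter_eq_left.2 (Set.singleton_subset_iff.2 (Set.mem_Ioi.2 hn))]
    exact ha
  refine (Set.countable_iUnion fun n => ?_).mono h
  have : IsFiniteMeasure (ρ.restrict (Set.Ioi (1 / (n + 1 : ℝ)))) :=
    ⟨by rw [Measure.restrict_apply_univ]; exact hρ.measure_Ioi_lt_top (by positivity)⟩
  exact Measure.countable_meas_pos_of_disjoint_iUnion (fun a => measurableSet_singleton a)
    (fun a b hab => Set.disjoint_singleton.2 hab)

lemma exists_mem_Ioo_notMem {S : Set ℝ} (hS : S.Countable) {u v : ℝ} (huv : u < v) :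
    ∃ a, u < a ∧ a < v ∧ a ∉ S := by
  obtain ⟨a, ha, ha'⟩ := (hS.dense_compl ℝ).exists_between huv
  exact ⟨a, ha'.1, ha'.2, ha⟩

include hρ in
lemma exists_null_singleton {u v : ℝ} (huv : u < v) : ∃ a, u < a ∧ a < v ∧ ρ {a} = 0 := by
  obtain ⟨a, h1, h2, h3⟩ := exists_mem_Ioo_notMem (countable_atoms hρ) huv
  exact ⟨a, h1, h2, by simpa using h3⟩

end Step

/-! ### Discretisation of the node variances

The half-line is cut at the points `ε * exp (h * i)`; node variances outside of the finitely many
cells with `|i| ≤ N` are discarded. -/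

/-- The index of the cell that contains `x`. -/
noncomputable def gridIdx (ε h : ℝ) (x : ℝ≥0) : ℤ := ⌈Real.log (x / ε) / h⌉

/-- The cell that contains `x`, if it is retained. -/
noncomputable def gridType (ε h : ℝ) (N : ℕ) (x : ℝ≥0) : Option (Finset.Icc (-(N : ℤ)) N) :=
  if hx : 0 < x ∧ gridIdx ε h x ∈ Finset.Icc (-(N : ℤ)) N then some ⟨gridIdx ε h x, hx.2⟩ else none

/-- The square root of the left end point of a cell. -/
noncomputable def gridWeight (ε h : ℝ) (i : ℤ) : ℝ := Real.sqrt (ε * Real.exp (h * (i - 1)))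

/-- The weight that a function of the type gives to a node; discarded nodes have weight `0`. -/
def typeWeight {T : Type*} (typ : ℝ≥0 → Option T) (wt : T → ℝ) (x : ℝ≥0) : ℝ :=
  (typ x).elim 0 wt

section Grid

variable {ε h : ℝ} (hε : 0 < ε) (hh : 0 < h)

include hε hh in
lemma gridIdx_eq_iff {x : ℝ≥0} (hx : 0 < x) (i : ℤ) :
    gridIdx ε h x = i ↔ ε * Real.exp (h * (i - 1)) < x ∧ (x : ℝ) ≤ ε * Real.exp (h * i) := by
  have hx' : (0 : ℝ) < x := hx
  have hq : 0 < (x : ℝ) / ε := by positivity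
  rw [gridIdx, Int.ceil_eq_iff, lt_div_iff₀ hh, div_le_iff₀ hh, Real.lt_log_iff_exp_lt hq,
    Real.log_le_iff_le_exp hq, lt_div_iff₀ hε, div_le_iff₀ hε, mul_comm h, mul_comm h,
    mul_comm ε, mul_comm ε]

include hε hh in
lemma gridType_eq_some_iff {N : ℕ} {x : ℝ≥0} {i : Finset.Icc (-(N : ℤ)) N} :
    gridType ε h N x = some i ↔
      ε * Real.exp (h * ((i : ℤ) - 1)) < x ∧ (x : ℝ) ≤ ε * Real.exp (h * (i : ℤ)) := by
  constructor
  · intro hx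
    rw [gridType] at hx
    split_ifs at hx with hc
    rw [Option.some_inj] at hx
    exact (gridIdx_eq_iff hε hh hc.1 _).1 (congrArg Subtype.val hx)
  · intro hx
    have hx0 : 0 < x := by
      have : (0 : ℝ) < x := lt_trans (by positivity) hx.1
      exact_mod_cast this
    have := (gridIdx_eq_iff hε hh hx0 _).2 hx
    rw [gridType, dif_pos ⟨hx0, by rw [this]; exact i.2⟩]
    simp [this]

include hε hh in
lemma measurableSet_gridType_some {N : ℕ} (i : Finset.Icc (-(N : ℤ)) N) :
    MeasurableSet (gridType ε h N ⁻¹' {some i}) := by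
  have : gridType ε h N ⁻¹' {some i} = ((↑) : ℝ≥0 → ℝ) ⁻¹'
      Set.Ioc (ε * Real.exp (h * ((i : ℤ) - 1))) (ε * Real.exp (h * (i : ℤ))) := by
    ext x
    exact gridType_eq_some_iff hε hh
  rw [this]
  exact measurableSet_Ioc.preimage (by fun_prop)

include hε hh in
lemma measurableSet_gridType {N : ℕ} (o : Option (Finset.Icc (-(N : ℤ)) N)) :
    MeasurableSet (gridType ε h N ⁻¹' {o}) := by
  cases o with
  | some i => exact measurableSet_gridType_some hε hh i
  | none =>
    have : gridType ε h N ⁻¹' {none} = (⋃ i, gridType ε h N ⁻¹' {some i})ᶜ := by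
      ext x
      simp only [Set.mem_preimage, Set.mem_singleton_iff, Set.mem_compl_iff, Set.mem_iUnion,
        not_exists]
      cases gridType ε h N x <;> simp
    rw [this]
    exact (MeasurableSet.iUnion fun i => measurableSet_gridType_some hε hh i).compl

include hε hh in
-- In a retained cell with left end point `t`, `(√x - √t)² ≤ x - t ≤ (1 - e^{-h}) x ≤ h x`. A
-- discarded `x` has error `x`, paid for by one of the two indicators since it lies below or above
-- the retained range.
lemma sq_sqrt_sub_typeWeight_le (N : ℕ) (x : ℝ≥0) :
    (Real.sqrt x - typeWeight (gridType ε h N) (fun i => gridWeight ε h i) x) ^ 2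
      ≤ h * x + (Set.Iic (ε * Real.exp (h * (-N - 1)))).indicator (fun x => x) (x : ℝ)
        + (Set.Ioi (ε * Real.exp (h * N))).indicator (fun x => x) (x : ℝ) := by
  have hx := x.coe_nonneg
  have hI1 : 0 ≤ (Set.Iic (ε * Real.exp (h * (-N - 1)))).indicator (fun x => x) (x : ℝ) :=
    Set.indicator_apply_nonneg fun _ => hx
  have hI2 : 0 ≤ (Set.Ioi (ε * Real.exp (h * N))).indicator (fun x => x) (x : ℝ) :=
    Set.indicator_apply_nonneg fun _ => hx
  have hhx : 0 ≤ h * x := by positivity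
  rcases hT : gridType ε h N x with _ | i
  · rw [typeWeight, hT, Option.elim_none, sub_zero, Real.sq_sqrt hx]
    rcases eq_or_lt_of_le (show 0 ≤ x from zero_le) with h0 | h0
    · have h00 : (x : ℝ) = 0 := by rw [← h0]; rfl
      exact h00.le.trans (add_nonneg (add_nonneg hhx hI1) hI2)
    · have hnot : gridIdx ε h x ∉ Finset.Icc (-(N : ℤ)) N := by
        intro hmem
        rw [gridType, dif_pos ⟨h0, hmem⟩] at hT
        exact absurd hT (by simp)
      obtain ⟨h1, h2⟩ := (gridIdx_eq_iff hε hh h0 _).1 rfl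
      rw [Finset.mem_Icc, not_and_or, not_le, not_le] at hnot
      rcases hnot with hlt | hgt
      · have : (gridIdx ε h x : ℝ) ≤ -N - 1 := by
          have : gridIdx ε h x ≤ -(N : ℤ) - 1 := by omega
          exact_mod_cast this
        rw [Set.indicator_of_mem]
        · linarith
        · refine Set.mem_Iic.2 (h2.trans ?_)
          gcongr
      · have : (N : ℝ) ≤ (gridIdx ε h x : ℝ) - 1 := by
          have : (N : ℤ) ≤ gridIdx ε h x - 1 := by omega
          exact_mod_cast this
        rw [Set.indicator_of_mem (s := Set.Ioi _)]
        · linarith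
        · refine Set.mem_Ioi.2 (lt_of_le_of_lt ?_ h1)
          gcongr
  · obtain ⟨h1, h2⟩ := (gridType_eq_some_iff hε hh).1 hT
    rw [typeWeight, hT, Option.elim_some, gridWeight]
    set t := ε * Real.exp (h * ((i : ℤ) - 1)) with ht
    have ht0 : 0 < t := by positivity
    have hle : Real.sqrt t ≤ Real.sqrt x := Real.sqrt_le_sqrt h1.le
    have h3 : (Real.sqrt x - Real.sqrt t) ^ 2 ≤ x - t := by
      nlinarith [Real.sq_sqrt hx, Real.sq_sqrt ht0.le, Real.sqrt_nonneg t, Real.sqrt_nonneg (x : ℝ)]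
    have h4 : (x : ℝ) * Real.exp (-h) ≤ t := by
      calc (x : ℝ) * Real.exp (-h) ≤ ε * Real.exp (h * (i : ℤ)) * Real.exp (-h) := by gcongr
        _ = t := by rw [ht, mul_assoc, ← Real.exp_add]; congr 2; ring
    have h5 := Real.add_one_le_exp (-h)
    nlinarith

include hε hh in
lemma typeWeight_gridType_mem (N : ℕ) (x : ℝ≥0) :
    0 ≤ typeWeight (gridType ε h N) (fun i => gridWeight ε h i) x ∧
      typeWeight (gridType ε h N) (fun i => gridWeight ε h i) x ≤ Real.sqrt x := by
  rcases hT : gridType ε h N x with _ | i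
  · simp [typeWeight, hT]
  · obtain ⟨h1, h2⟩ := (gridType_eq_some_iff hε hh).1 hT
    rw [typeWeight, hT, Option.elim_some, gridWeight]
    exact ⟨Real.sqrt_nonneg _, Real.sqrt_le_sqrt h1.le⟩

open Classical in
include hε hh in
-- The threshold `ε` is the right end point of cell `0`, so whether a node is pruned depends only on
-- its cell.
lemma typeWeight_pruned (N : ℕ) (x : ℝ≥0) :
    typeWeight (gridType ε h N) (fun i => gridWeight ε h i * if 1 ≤ (i : ℤ) then 1 else 0) x
      = typeWeight (gridType ε h N) (fun i => gridWeight ε h i) x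
        * if ε < (x : ℝ) then 1 else 0 := by
  rcases hT : gridType ε h N x with _ | i
  · simp [typeWeight, hT]
  · obtain ⟨h1, h2⟩ := (gridType_eq_some_iff hε hh).1 hT
    rw [typeWeight, typeWeight, hT, Option.elim_some, Option.elim_some]
    congr 1
    have : 1 ≤ (i : ℤ) ↔ ε < (x : ℝ) := by
      constructor
      · intro hi
        refine lt_of_le_of_lt ?_ h1
        have : (0 : ℝ) ≤ h * ((i : ℤ) - 1) := by
          have : (1 : ℝ) ≤ (i : ℤ) := by exact_mod_cast hi
          exact mul_nonneg hh.le (by linarith)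
        exact le_mul_of_one_le_right hε.le (Real.one_le_exp this)
      · intro hx
        by_contra hi
        have hi' : ((i : ℤ) : ℝ) ≤ 0 := by
          have : (i : ℤ) ≤ 0 := by omega
          exact_mod_cast this
        have : Real.exp (h * (i : ℤ)) ≤ 1 :=
          Real.exp_le_one_iff.2 (mul_nonpos_of_nonneg_of_nonpos hh.le hi')
        have := mul_le_of_le_one_right hε.le this
        linarith
    simp only [this]

/-- `n E[(w(λ_n) - w'(λ_n))²]`. -/
noncomputable def weightErr (μ : ℕ+ → ProbabilityMeasure ℝ≥0) (w w' : ℝ≥0 → ℝ) (n : ℕ+) : ℝ≥0∞ :=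
  n * ∫⁻ x, ENNReal.ofReal ((w x - w' x) ^ 2) ∂(μ n : Measure ℝ≥0)

include hε hh in
lemma weightErr_sqrt_typeWeight_le (N : ℕ) (μ : ℕ+ → ProbabilityMeasure ℝ≥0) (n : ℕ+) :
    weightErr μ (fun x => Real.sqrt x) (typeWeight (gridType ε h N) (fun i => gridWeight ε h i)) n
      ≤ ENNReal.ofReal h * meanSum μ n + setMean μ (Set.Iic (ε * Real.exp (h * (-N - 1)))) n
        + setMean μ (Set.Ioi (ε * Real.exp (h * N))) n := by
  set s := Set.Iic (ε * Real.exp (h * (-N - 1))) with hs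
  set t := Set.Ioi (ε * Real.exp (h * N)) with ht
  have hsm : MeasurableSet (((↑) : ℝ≥0 → ℝ) ⁻¹' s) := measurableSet_Iic.preimage (by fun_prop)
  have htm : MeasurableSet (((↑) : ℝ≥0 → ℝ) ⁻¹' t) := measurableSet_Ioi.preimage (by fun_prop)
  have hind : ∀ (u : Set ℝ) (x : ℝ≥0), ENNReal.ofReal (u.indicator (fun x => x) (x : ℝ))
      = (((↑) : ℝ≥0 → ℝ) ⁻¹' u).indicator (fun x : ℝ≥0 => (x : ℝ≥0∞)) x := by
    intro u x
    by_cases hx : (x : ℝ) ∈ u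
    · rw [Set.indicator_of_mem hx,
        Set.indicator_of_mem (show x ∈ ((↑) : ℝ≥0 → ℝ) ⁻¹' u from hx), ENNReal.ofReal_coe_nnreal]
    · rw [Set.indicator_of_notMem hx,
        Set.indicator_of_notMem (show x ∉ ((↑) : ℝ≥0 → ℝ) ⁻¹' u from hx), ENNReal.ofReal_zero]
  have hnn : ∀ (u : Set ℝ) (x : ℝ≥0), 0 ≤ u.indicator (fun x => x) (x : ℝ) := fun u x =>
    Set.indicator_apply_nonneg fun _ => x.coe_nonneg
  rw [weightErr, meanSum_eq, setMean, setMean, mul_left_comm, ← mul_add, ← mul_add]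
  gcongr
  calc _ ≤ ∫⁻ x : ℝ≥0, (ENNReal.ofReal h * x
        + (((↑) : ℝ≥0 → ℝ) ⁻¹' s).indicator (fun x : ℝ≥0 => (x : ℝ≥0∞)) x
        + (((↑) : ℝ≥0 → ℝ) ⁻¹' t).indicator (fun x : ℝ≥0 => (x : ℝ≥0∞)) x)
          ∂(μ n : Measure ℝ≥0) := by
        refine lintegral_mono fun x => ?_
        rw [← hind, ← hind]
        refine (ENNReal.ofReal_le_ofReal (sq_sqrt_sub_typeWeight_le hε hh N x)).trans_eq ?_
        rw [ENNReal.ofReal_add (add_nonneg (by positivity) (hnn _ _)) (hnn _ _),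
          ENNReal.ofReal_add (by positivity) (hnn _ _), ENNReal.ofReal_mul hh.le,
          ENNReal.ofReal_coe_nnreal]
    _ = _ := by
        have hm : Measurable (fun x : ℝ≥0 => (x : ℝ≥0∞)) := by fun_prop
        rw [lintegral_add_right _ (hm.indicator htm), lintegral_add_right _ (hm.indicator hsm),
          lintegral_const_mul _ hm, lintegral_indicator hsm, lintegral_indicator htm]

end Grid

/-! ### Fine grids that avoid the atoms, and the limits of the cell counts -/

section Limit

variable {ρ : Measure ℝ} (hρ : IsLevyMeasure ρ) (hM : firstMoment ρ < ⊤)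

include hρ hM in
lemma tendsto_setLIntegral_zero_of_eventually_notMem {S : ℕ → Set ℝ}
    (hS : ∀ n, MeasurableSet (S n)) (h : ∀ x, 0 < x → ∀ᶠ n in atTop, x ∉ S n) :
    Tendsto (fun n => ∫⁻ x in S n, ENNReal.ofReal x ∂ρ) atTop (𝓝 0) := by
  have := tendsto_lintegral_filter_of_dominated_convergence (μ := ρ) (l := atTop)
    (F := fun n => (S n).indicator fun x => ENNReal.ofReal x) (f := fun _ => 0)
    (fun x => ENNReal.ofReal x)
    (Eventually.of_forall fun n => (by fun_prop : Measurable fun x => ENNReal.ofReal x).indicator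
      (hS n))
    (Eventually.of_forall fun n => Eventually.of_forall fun x => Set.indicator_le_self _ _ _)
    hM.ne (by
      filter_upwards [hρ.ae_pos] with x hx
      refine tendsto_const_nhds.congr' ?_
      filter_upwards [h x hx] with n hn
      rw [Set.indicator_of_notMem hn])
  rw [lintegral_zero] at this
  refine this.congr fun n => ?_
  rw [lintegral_indicator (hS n)]

include hρ in
-- For each `i ≠ 0` only countably many `h` put the `i`-th grid point on an atom. The point `i = 0`
-- is `ε` for every `h`, hence the hypothesis on `ε`.
lemma exists_null_grid {ε : ℝ} (hε : 0 < ε) (hρε : ρ {ε} = 0) {u : ℝ} (hu : 0 < u) :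
    ∃ h, 0 < h ∧ h < u ∧ ∀ i : ℤ, ρ {ε * Real.exp (h * i)} = 0 := by
  have hcount : (⋃ i : ℤ, {h : ℝ | i ≠ 0 ∧ ε * Real.exp (h * i) ∈ {a | 0 < ρ {a}}}).Countable := by
    refine Set.countable_iUnion fun i => ?_
    by_cases hi : i = 0
    · simp [hi]
    · have : Function.Injective fun h : ℝ => ε * Real.exp (h * i) := by
        intro a b hab
        have h1 := Real.exp_injective (mul_left_cancel₀ hε.ne' hab)
        exact mul_right_cancel₀ (by exact_mod_cast hi) h1
      refine ((countable_atoms hρ).preimage_of_injOn this.injOn).mono ?_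
      intro h hh
      exact hh.2
  obtain ⟨h, h0, hu, hn⟩ := exists_mem_Ioo_notMem hcount hu
  refine ⟨h, h0, hu, fun i => ?_⟩
  by_cases hi : i = 0
  · simpa [hi] using hρε
  · by_contra hcon
    exact hn (Set.mem_iUnion.2 ⟨i, hi, pos_iff_ne_zero.2 hcon⟩)

include hρ hM in
/-- A fine grid approximates the square root well, uniformly in the width of the layer. -/
lemma exists_grid {ε : ℝ} (hε : 0 < ε) (hρε : ρ {ε} = 0) {η : ℝ≥0∞} (hη : 0 < η) :
    ∃ (h : ℝ) (N : ℕ), 0 < h ∧ (∀ i : ℤ, ρ {ε * Real.exp (h * i)} = 0) ∧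
      ∀ μ : ℕ+ → ProbabilityMeasure ℝ≥0, SumTendstoID μ 0 ρ →
        Tendsto (meanSum μ) atTop (𝓝 (firstMoment ρ)) →
        ∀ᶠ n in atTop, weightErr μ (fun x => Real.sqrt x)
          (typeWeight (gridType ε h N) (fun i => gridWeight ε h i)) n ≤ η := by
  have hη3 : 0 < η / 3 := ENNReal.div_pos hη.ne' (by norm_num)
  have ht : Tendsto (fun u : ℝ => ENNReal.ofReal u * firstMoment ρ) (𝓝[>] 0) (𝓝 0) := by
    have h1 : Tendsto (fun u : ℝ => ENNReal.ofReal u) (𝓝[>] 0) (𝓝 0) := by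
      have := (ENNReal.continuous_ofReal.tendsto 0).mono_left
        (nhdsWithin_le_nhds (s := Set.Ioi (0 : ℝ)))
      simpa using this
    simpa using ENNReal.Tendsto.mul_const h1 (Or.inr hM.ne)
  -- The mesh `h < u` is fixed first, so that `h M₁ < η / 3`; only then is `N` chosen, to make both
  -- discarded ends small.
  obtain ⟨u, hu, hu0⟩ := ((ht.eventually_lt_const hη3).and self_mem_nhdsWithin).exists
  obtain ⟨h, hh, hhu, hnull⟩ := exists_null_grid hρ hε hρε (Set.mem_Ioi.1 hu0)
  have h1 : ENNReal.ofReal h * firstMoment ρ < η / 3 :=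
    lt_of_le_of_lt (by gcongr) hu
  have hcast : Tendsto (fun N : ℕ => h * (N : ℝ)) atTop atTop :=
    tendsto_natCast_atTop_atTop.const_mul_atTop hh
  have h2 := tendsto_setLIntegral_zero_of_eventually_notMem hρ hM
    (S := fun N : ℕ => Set.Iic (ε * Real.exp (h * (-N - 1)))) (fun _ => measurableSet_Iic)
    (fun x hx => by
      filter_upwards [hcast.eventually_gt_atTop (-Real.log (x / ε))] with N hN
      simp only [Set.mem_Iic, not_le]
      rw [mul_comm, ← lt_div_iff₀ hε, ← Real.lt_log_iff_exp_lt (by positivity)]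
      linarith)
  have h3 := tendsto_setLIntegral_zero_of_eventually_notMem hρ hM
    (S := fun N : ℕ => Set.Ioi (ε * Real.exp (h * N))) (fun _ => measurableSet_Ioi)
    (fun x hx => by
      filter_upwards [hcast.eventually_gt_atTop (Real.log (x / ε))] with N hN
      simp only [Set.mem_Ioi, not_lt]
      rw [mul_comm, ← div_le_iff₀ hε, ← Real.log_le_iff_le_exp (by positivity)]
      exact hN.le)
  obtain ⟨N, hN2, hN3⟩ := ((h2.eventually_lt_const hη3).and (h3.eventually_lt_const hη3)).exists
  refine ⟨h, N, hh, hnull, fun μ hμ hμN => ?_⟩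
  have n1 := hnull (-N - 1)
  have n2 := hnull N
  push_cast at n1 n2
  have h4 := tendsto_setMean_Iic hρ hM hμ n1
  have h5 := tendsto_setMean_Ioi hρ hM hμ hμN n2
  have h6 : Tendsto (fun n => ENNReal.ofReal h * meanSum μ n) atTop
      (𝓝 (ENNReal.ofReal h * firstMoment ρ)) :=
    ENNReal.Tendsto.const_mul hμN (Or.inr ENNReal.ofReal_ne_top)
  filter_upwards [h4.eventually_lt_const hN2, h5.eventually_lt_const hN3,
    h6.eventually_lt_const h1] with n a1 a2 a3
  refine (weightErr_sqrt_typeWeight_le hε hh N μ n).trans ?_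
  calc _ ≤ η / 3 + η / 3 + η / 3 := by gcongr
    _ = η := ENNReal.add_thirds η

include hρ hM in
lemma tendsto_mul_measure_gridType {ε h : ℝ} (hε : 0 < ε) (hh : 0 < h)
    (hnull : ∀ i : ℤ, ρ {ε * Real.exp (h * i)} = 0) {μ : ℕ+ → ProbabilityMeasure ℝ≥0}
    (hμ : SumTendstoID μ 0 ρ) (N : ℕ) (i : Finset.Icc (-(N : ℤ)) N) :
    ∃ r : ℝ, Tendsto (fun n : ℕ+ =>
      (n : ℝ) * (μ n : Measure ℝ≥0).real (gridType ε h N ⁻¹' {some i})) atTop (𝓝 r) := by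
  have n1 := hnull ((i : ℤ) - 1)
  have n2 := hnull i
  push_cast at n1
  have hlt : ε * Real.exp (h * ((i : ℤ) - 1)) ≤ ε * Real.exp (h * (i : ℤ)) := by
    gcongr; linarith
  refine ⟨_, ((tendsto_mul_measure_Ioi hρ hM hμ (by positivity) n1).sub
    (tendsto_mul_measure_Ioi hρ hM hμ (by positivity) n2)).congr fun n => ?_⟩
  have hsub : ((↑) : ℝ≥0 → ℝ) ⁻¹' Set.Ioi (ε * Real.exp (h * (i : ℤ)))
      ⊆ ((↑) : ℝ≥0 → ℝ) ⁻¹' Set.Ioi (ε * Real.exp (h * ((i : ℤ) - 1))) :=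
    Set.preimage_mono (Set.Ioi_subset_Ioi hlt)
  rw [← mul_sub, ← measureReal_sdiff hsub (measurableSet_Ioi.preimage (by fun_prop))]
  congr 2
  ext x
  rw [Set.mem_preimage, Set.mem_singleton_iff, gridType_eq_some_iff hε hh, Set.mem_sdiff,
    Set.mem_preimage, Set.mem_preimage, Set.mem_Ioi, Set.mem_Ioi, not_lt]

end Limit

/-! ### Positively homogeneous activations -/

namespace PosHomogeneous

variable {φ : ℝ → ℝ} (hφ : PosHomogeneous φ)
include hφ

lemma apply_zero : φ 0 = 0 := by
  have := hφ 2 0 two_pos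
  rw [mul_zero] at this
  linarith

lemma apply_of_nonneg {x : ℝ} (hx : 0 ≤ x) : φ x = x * φ 1 := by
  rcases hx.eq_or_lt with h | h
  · rw [← h, hφ.apply_zero, zero_mul]
  · simpa using hφ x 1 h

lemma apply_of_nonpos {x : ℝ} (hx : x ≤ 0) : φ x = -x * φ (-1) := by
  rcases hx.eq_or_lt with h | h
  · rw [h, hφ.apply_zero, neg_zero, zero_mul]
  · simpa using hφ (-x) (-1) (by linarith)

omit hφ in
lemma cLip_nonneg (φ : ℝ → ℝ) : 0 ≤ cLip φ := (abs_nonneg _).trans (le_max_left _ _)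

lemma abs_sub_le_of_nonneg_of_nonpos {a b : ℝ} (ha : 0 ≤ a) (hb : b ≤ 0) :
    |φ a - φ b| ≤ cLip φ * (a - b) := by
  rw [hφ.apply_of_nonneg ha, hφ.apply_of_nonpos hb]
  have h1 : |φ 1| ≤ cLip φ := le_max_left _ _
  have h2 : |φ (-1)| ≤ cLip φ := le_max_right _ _
  have h3 := abs_le.1 h1
  have h4 := abs_le.1 h2
  rw [abs_le]
  constructor <;> nlinarith

/-- On each half-line `φ` is linear with slope at most `cLip φ` in absolute value; for arguments of
opposite signs the two half-line estimates add up, because `φ 0 = 0`. -/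
lemma abs_sub_le (a b : ℝ) : |φ a - φ b| ≤ cLip φ * |a - b| := by
  have h1 : |φ 1| ≤ cLip φ := le_max_left _ _
  have h2 : |φ (-1)| ≤ cLip φ := le_max_right _ _
  rcases le_total 0 a with ha | ha <;> rcases le_total 0 b with hb | hb
  · rw [hφ.apply_of_nonneg ha, hφ.apply_of_nonneg hb, ← sub_mul, abs_mul, mul_comm]
    gcongr
  · rw [abs_of_nonneg (sub_nonneg.2 (hb.trans ha))]
    exact hφ.abs_sub_le_of_nonneg_of_nonpos ha hb
  · rw [abs_sub_comm, abs_sub_comm a, abs_of_nonneg (sub_nonneg.2 (ha.trans hb))]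
    exact hφ.abs_sub_le_of_nonneg_of_nonpos hb ha
  · rw [hφ.apply_of_nonpos ha, hφ.apply_of_nonpos hb, ← sub_mul, abs_mul, mul_comm,
      neg_sub_neg, abs_sub_comm b]
    gcongr

lemma sq_sub_le (a b : ℝ) : (φ a - φ b) ^ 2 ≤ cLip φ ^ 2 * (a - b) ^ 2 := by
  rw [← mul_pow, sq_le_sq, abs_mul, abs_of_nonneg (cLip_nonneg φ)]
  exact hφ.abs_sub_le a b

lemma sq_le (a : ℝ) : φ a ^ 2 ≤ cLip φ ^ 2 * a ^ 2 := by
  simpa [hφ.apply_zero] using hφ.sq_sub_le a 0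

lemma measurable : Measurable φ := by
  have : LipschitzWith (cLip φ).toNNReal φ := LipschitzWith.of_dist_le_mul fun a b => by
    rw [Real.dist_eq, Real.dist_eq, Real.coe_toNNReal _ (cLip_nonneg φ)]
    exact hφ.abs_sub_le a b
  exact this.continuous.measurable

end PosHomogeneous

/-! ### Independence and Gaussian coefficients -/

section Independence

variable {Ω : Type*} [MeasurableSpace Ω] {P : Measure Ω} [IsProbabilityMeasure P]

lemma lintegral_of_indepFun {β γ : Type*} [MeasurableSpace β] [MeasurableSpace γ]
    {X : Ω → β} {Y : Ω → γ} (hX : Measurable X) (hY : Measurable Y) (h : IndepFun X Y P)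
    {F : β × γ → ℝ≥0∞} (hF : Measurable F) :
    ∫⁻ ω, F (X ω, Y ω) ∂P = ∫⁻ ω, ∫⁻ y, F (X ω, y) ∂(P.map Y) ∂P := by
  have h1 := (indepFun_iff_map_prod_eq_prod_map_map hX.aemeasurable hY.aemeasurable).1 h
  have : IsProbabilityMeasure (P.map Y) := Measure.isProbabilityMeasure_map hY.aemeasurable
  rw [← lintegral_map (f := F) (g := fun ω => (X ω, Y ω)) hF (hX.prodMk hY), h1,
    lintegral_prod _ hF.aemeasurable, lintegral_map hF.lintegral_prod_right' hX]

lemma lintegral_sq_pi_gaussianReal {Q : Type*} [Fintype Q] (v : Q → ℝ≥0) (c : Q → ℝ) :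
    ∫⁻ y : Q → ℝ, ENNReal.ofReal ((∑ q, c q * y q) ^ 2)
        ∂(Measure.pi fun q => gaussianReal 0 (v q))
      = ∑ q, ENNReal.ofReal (c q ^ 2) * v q := by
  have hL : ∀ q, MemLp (fun y : ℝ => c q * y) 2 (gaussianReal 0 (v q)) := fun q =>
    (memLp_id_gaussianReal 2).const_mul (c q)
  have hL' : ∀ q, MemLp (fun y : Q → ℝ => c q * y q) 2
      (Measure.pi fun q => gaussianReal 0 (v q)) := fun q =>
    (hL q).comp_measurePreserving (measurePreserving_eval _ q)
  have hS : MemLp (fun y : Q → ℝ => ∑ q, c q * y q) 2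
      (Measure.pi fun q => gaussianReal 0 (v q)) := memLp_finsetSum _ fun q _ => hL' q
  have hmean : ∫ y : Q → ℝ, ∑ q, c q * y q ∂(Measure.pi fun q => gaussianReal 0 (v q)) = 0 := by
    rw [integral_finsetSum _ fun q _ => (hL' q).integrable one_le_two]
    refine Finset.sum_eq_zero fun q _ => ?_
    rw [integral_const_mul]
    have := integral_comp_eval (μ := fun q => gaussianReal 0 (v q)) (i := q) (f := fun y : ℝ => y)
      (by fun_prop)
    rw [this, integral_id_gaussianReal, mul_zero]
  have hvar := variance_sum_pi hL
  have e : (∑ q, fun y : Q → ℝ => c q * y q) = fun y : Q → ℝ => ∑ q, c q * y q := by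
    ext y; simp
  rw [e, variance_of_integral_eq_zero hS.aestronglyMeasurable.aemeasurable hmean] at hvar
  rw [← ofReal_integral_eq_lintegral_ofReal hS.integrable_sq
    (Eventually.of_forall fun y => sq_nonneg _), hvar,
    ENNReal.ofReal_sum_of_nonneg fun q _ => variance_nonneg _ _]
  refine Finset.sum_congr rfl fun q _ => ?_
  rw [variance_const_mul, ← ENNReal.ofReal_coe_nnreal, ← ENNReal.ofReal_mul (sq_nonneg _)]
  congr 2
  exact variance_id_gaussianReal

/-- Conditionally on `D` the sum is a combination of independent centred Gaussians, so the cross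
terms vanish. No moment of `D` has to be finite. -/
lemma lintegral_sq_sum_of_indepFun {Q : Type*} [Fintype Q] {v : Q → ℝ≥0} {D W : Ω → Q → ℝ}
    (hD : Measurable D) (hW : Measurable W) (h : IndepFun D W P)
    (hlaw : P.map W = Measure.pi fun q => gaussianReal 0 (v q)) :
    ∫⁻ ω, ENNReal.ofReal ((∑ q, D ω q * W ω q) ^ 2) ∂P
      = ∑ q, (∫⁻ ω, ENNReal.ofReal (D ω q ^ 2) ∂P) * v q := by
  rw [lintegral_of_indepFun hD hW h
    (F := fun z : (Q → ℝ) × (Q → ℝ) => ENNReal.ofReal ((∑ q, z.1 q * z.2 q) ^ 2)) (by fun_prop),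
    hlaw]
  simp_rw [lintegral_sq_pi_gaussianReal]
  rw [lintegral_finsetSum _ fun q _ => by fun_prop]
  refine Finset.sum_congr rfl fun q _ => ?_
  rw [lintegral_mul_const _ (by fun_prop)]

end Independence

/-! ### Networks with a general weight function -/

/-- The pre-activations of the network in which node `j` has weight `w λ_j` in place of `√λ_j`. -/
noncomputable def net {L : ℕ} (din dout : ℕ+) (p : Fin L → ℕ+) {Ω : Type*} (θ : Params Ω)
    (φ : ℝ → ℝ) (x : Fin din → ℝ) (w : ℝ≥0 → ℝ) : ℕ → ℕ → Ω → ℝ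
  | 0, _, _ => 0
  | 1, k, ω => firstPreact din θ x k ω
  | l + 2, k, ω =>
      ∑ j ∈ Finset.range (width din dout p (l + 1)),
        (w (θ.lam (l + 1) j ω) * θ.V (l + 2) j k ω) * φ (net din dout p θ φ x w (l + 1) j ω)
      + θ.B (l + 2) k ω

section Net

variable {L : ℕ} (din dout : ℕ+) (p : Fin L → ℕ+) {Ω : Type*} (θ : Params Ω)
  (φ : ℝ → ℝ) (x : Fin din → ℝ)

lemma preact_eq_net (l : ℕ) :
    preact din dout p θ φ x l = net din dout p θ φ x (fun a => Real.sqrt a) l := by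
  induction l with
  | zero => ext k ω; rw [preact, net]
  | succ l ih =>
    cases l with
    | zero => ext k ω; rw [preact, net]
    | succ l => ext k ω; rw [preact, net, ih]

open Classical in
lemma prunedPreact_eq_net (ε : ℝ) (l : ℕ) :
    prunedPreact din dout p θ φ x ε l = net din dout p θ φ x
      (fun a => Real.sqrt a * if ε < (a : ℝ) then 1 else 0) l := by
  induction l with
  | zero => ext k ω; rw [prunedPreact, net]
  | succ l ih =>
    cases l with
    | zero => ext k ω; rw [prunedPreact, net]
    | succ l => ext k ω; rw [prunedPreact, net, ih]

/-- The position of a parameter in the order in which the network uses them. -/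
def ParamIdx.rank : ParamIdx → ℕ
  | .lam l _ => 2 * l + 1
  | .V l _ _ => 2 * l
  | .B l _ => 2 * l

variable {din dout p θ φ x}

lemma measurable_net [MeasurableSpace Ω] (hφ : Measurable φ) {w : ℝ≥0 → ℝ} (hw : Measurable w)
    {l : ℕ} (hl : l ≤ L + 1)
    (h : ∀ i : ParamIdx, i.InRange din dout p → i.rank ≤ 2 * l → Measurable (θ.value i))
    {k : ℕ} (hk : k < width din dout p l) : Measurable (net din dout p θ φ x w l k) := by
  induction l generalizing k with
  | zero => exact measurable_const
  | succ l ih =>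
    cases l with
    | zero =>
      have h1 : Measurable fun ω => firstPreact din θ x k ω := by
        unfold firstPreact
        refine (Finset.measurable_sum _ fun j _ => ((Measurable.const_mul ?_ _).mul_const _)).add ?_
        · exact h (.V 1 j k) ⟨le_rfl, by omega, j.2, hk⟩ le_rfl
        · exact h (.B 1 k) ⟨le_rfl, by omega, hk⟩ le_rfl
      exact h1
    | succ l =>
      have h1 : Measurable fun ω => ∑ j ∈ Finset.range (width din dout p (l + 1)),
          (w (θ.lam (l + 1) j ω) * θ.V (l + 2) j k ω) * φ (net din dout p θ φ x w (l + 1) j ω)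
          + θ.B (l + 2) k ω := by
        refine (Finset.measurable_sum _ fun j hj => ?_).add ?_
        · rw [Finset.mem_range] at hj
          refine (Measurable.mul (hw.comp ?_) ?_).mul (hφ.comp ?_)
          · have := (h (.lam (l + 1) j) ⟨by omega, by omega, hj⟩
              (by simp only [ParamIdx.rank]; omega)).real_toNNReal
            simpa [Params.value] using this
          · exact h (.V (l + 2) j k) ⟨by omega, by omega, hj, hk⟩ le_rfl
          · exact ih (by omega) (fun i hi hr => h i hi (by omega)) hj
        · exact h (.B (l + 2) k) ⟨by omega, by omega, hk⟩ le_rfl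
      exact h1

variable (din dout p θ) in
/-- The σ-algebra generated by the parameters with rank in `S`. -/
@[reducible] def rankAlgebra (S : Set ℕ) : MeasurableSpace Ω :=
  ⨆ i ∈ {i : {i : ParamIdx // i.InRange din dout p} | i.1.rank ∈ S},
    MeasurableSpace.comap (θ.value i) inferInstance

lemma measurable_value_rankAlgebra {S : Set ℕ} {i : ParamIdx} (hi : i.InRange din dout p)
    (hS : i.rank ∈ S) : Measurable[rankAlgebra din dout p θ S] (θ.value i) := by
  refine Measurable.mono (comap_measurable (θ.value i)) ?_ le_rfl
  exact le_iSup₂_of_le (⟨i, hi⟩ : {i : ParamIdx // i.InRange din dout p}) hS le_rfl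

lemma measurable_lam_rankAlgebra {S : Set ℕ} {l j : ℕ}
    (hi : (ParamIdx.lam l j).InRange din dout p) (hS : 2 * l + 1 ∈ S) :
    Measurable[rankAlgebra din dout p θ S] (θ.lam l j) := by
  have := @Measurable.real_toNNReal Ω (rankAlgebra din dout p θ S) _
    (measurable_value_rankAlgebra hi hS)
  simpa [Params.value] using this

/-- Layer `l` uses ranks up to `2 l`, its node variances have rank `2 l + 1` and the edges into the
next layer rank `2 l + 2`. Disjoint sets of ranks are independent, so each new block of variables is
independent of everything computed before it. -/
lemma measurable_net_rankAlgebra (hφ : Measurable φ) {w : ℝ≥0 → ℝ} (hw : Measurable w)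
    {S : Set ℕ} {l : ℕ} (hl : l ≤ L + 1) (hS : Set.Iic (2 * l) ⊆ S)
    {k : ℕ} (hk : k < width din dout p l) :
    Measurable[rankAlgebra din dout p θ S] (net din dout p θ φ x w l k) :=
  @measurable_net L din dout p Ω θ φ x (rankAlgebra din dout p θ S) hφ w hw l hl
    (fun _ hi hr => measurable_value_rankAlgebra hi (hS hr)) k hk

end Net

/-- The variances of the Gaussian variables on the edges into one node; `none` is the bias. -/
def edgeVar {κ : Type*} (σb σv : ℝ≥0) (o : Option κ) : ℝ≥0 := o.elim (σb ^ 2) fun _ => σv ^ 2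

/-- The Gaussian variables on the edges, from the nodes `e` of the layer before, into the nodes
`ι` of layer `l`, with the biases. -/
def Params.edge {Ω : Type*} (θ : Params Ω) (l : ℕ) {κ κ' : Type*} (e : κ → ℕ) (ι : κ' → ℕ)
    (ω : Ω) (q : Option κ × κ') : ℝ :=
  q.1.elim (θ.B l (ι q.2) ω) fun j => θ.V l (e j) (ι q.2) ω

lemma measurable_edge_rankAlgebra {L : ℕ} {din dout : ℕ+} {p : Fin L → ℕ+} {Ω : Type*}
    {θ : Params Ω} {S : Set ℕ} {l : ℕ} (hl : 1 ≤ l) (hl' : l ≤ L + 1) (hS : 2 * l ∈ S)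
    {κ κ' : Type*} {e : κ → ℕ} {ι : κ' → ℕ} (he : ∀ j, e j < width din dout p (l - 1))
    (hι : ∀ i, ι i < width din dout p l) :
    Measurable[rankAlgebra din dout p θ S] (θ.edge l e ι) := by
  refine @measurable_pi_lambda _ _ _ (rankAlgebra din dout p θ S) _ _ fun q => ?_
  rcases q with ⟨_ | j, i⟩
  · exact measurable_value_rankAlgebra (i := .B l (ι i)) ⟨hl, hl', hι i⟩ hS
  · exact measurable_value_rankAlgebra (i := .V l (e j) (ι i)) ⟨hl, hl', he j, hι i⟩ hS

namespace IsMoGP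

variable {L : ℕ} {din dout : ℕ+} {σb σv : ℝ≥0} {μ : Fin L → ℕ+ → ProbabilityMeasure ℝ≥0}
  {p : Fin L → ℕ+} {Ω : Type*} [MeasurableSpace Ω] {P : Measure Ω} [IsProbabilityMeasure P]
  {θ : Params Ω} (h : IsMoGP din dout σb σv μ p P θ)
include h

omit [IsProbabilityMeasure P] in
lemma rankAlgebra_le (S : Set ℕ) : rankAlgebra din dout p θ S ≤ ‹MeasurableSpace Ω› :=
  iSup₂_le fun i _ => (h.measurable_value i.1 i.2).comap_le

omit [IsProbabilityMeasure P] in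
lemma indep_rankAlgebra {S T : Set ℕ} (hST : Disjoint S T) :
    Indep (rankAlgebra din dout p θ S) (rankAlgebra din dout p θ T) P := by
  have hind := h.indep.iIndep
  refine indep_iSup_of_disjoint (m := fun i : {i : ParamIdx // i.InRange din dout p} =>
    MeasurableSpace.comap (θ.value i) inferInstance)
    (fun i => (h.measurable_value i.1 i.2).comap_le) hind ?_
  exact Set.disjoint_left.2 fun i hi hi' => Set.disjoint_left.1 hST hi hi'

omit [IsProbabilityMeasure P] in
lemma indepFun_of_rank {S T : Set ℕ} (hST : Disjoint S T) {β γ : Type*} [MeasurableSpace β]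
    [MeasurableSpace γ] {X : Ω → β} {Y : Ω → γ} (hX : Measurable[rankAlgebra din dout p θ S] X)
    (hY : Measurable[rankAlgebra din dout p θ T] Y) : IndepFun X Y P := by
  rw [IndepFun_iff_Indep]
  exact indep_of_indep_of_le (h.indep_rankAlgebra hST) hX.comap_le hY.comap_le

omit [IsProbabilityMeasure P] in
lemma measurable_lam {l j : ℕ} (hi : (ParamIdx.lam l j).InRange din dout p) :
    Measurable (θ.lam l j) :=
  (measurable_lam_rankAlgebra (S := Set.univ) hi (Set.mem_univ _)).mono (h.rankAlgebra_le _) le_rfl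

lemma map_lam {l : ℕ} (hl : l < L) :
    P.map (fun ω (j : Fin (p ⟨l, hl⟩)) => θ.lam (l + 1) j ω)
      = Measure.pi fun _ => (μ ⟨l, hl⟩ (p ⟨l, hl⟩) : Measure ℝ≥0) := by
  have hr : ∀ j : Fin (p ⟨l, hl⟩), (ParamIdx.lam (l + 1) j).InRange din dout p := fun j =>
    ⟨by omega, hl, by simp only [width, dif_pos hl]; exact j.2⟩
  have hind : iIndepFun (fun (j : Fin (p ⟨l, hl⟩)) => θ.lam (l + 1) j) P := by
    have h1 := h.indep.precomp (g := fun j : Fin (p ⟨l, hl⟩) =>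
      (⟨.lam (l + 1) j, hr j⟩ : {i : ParamIdx // i.InRange din dout p})) (by
        intro a b hab
        simpa [Fin.ext_iff] using hab)
    have h2 := h1.comp (fun _ => Real.toNNReal) (fun _ => measurable_real_toNNReal)
    convert h2 using 2 with j
    ext ω
    simp [Params.value]
  rw [(iIndepFun_iff_map_fun_eq_pi_map fun j => (h.measurable_lam (hr j)).aemeasurable).1 hind]
  congr 1
  ext1 j
  exact h.law_lam ⟨l, hl⟩ j j.2

lemma map_edge {l : ℕ} (hl : 1 ≤ l) (hl' : l ≤ L + 1) {κ κ' : Type*} [Fintype κ] [Fintype κ']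
    {e : κ → ℕ} {ι : κ' → ℕ} (he : ∀ j, e j < width din dout p (l - 1))
    (hι : ∀ i, ι i < width din dout p l) (he' : Function.Injective e)
    (hι' : Function.Injective ι) :
    P.map (θ.edge l e ι)
      = Measure.pi fun q : Option κ × κ' => gaussianReal 0 (edgeVar σb σv q.1) := by
  let g : Option κ × κ' → {i : ParamIdx // i.InRange din dout p} := fun q =>
    match q with
    | (none, i) => ⟨.B l (ι i), ⟨hl, hl', hι i⟩⟩
    | (some j, i) => ⟨.V l (e j) (ι i), ⟨hl, hl', he j, hι i⟩⟩
  have hg : Function.Injective g := by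
    rintro ⟨_ | a, b⟩ ⟨_ | c, d⟩ hab
    · have h1 : ParamIdx.B l (ι b) = .B l (ι d) := congrArg Subtype.val hab
      rw [ParamIdx.B.injEq] at h1
      rw [hι' h1.2]
    · have h1 : ParamIdx.B l (ι b) = .V l (e c) (ι d) := congrArg Subtype.val hab
      cases h1
    · have h1 : ParamIdx.V l (e a) (ι b) = .B l (ι d) := congrArg Subtype.val hab
      cases h1
    · have h1 : ParamIdx.V l (e a) (ι b) = .V l (e c) (ι d) := congrArg Subtype.val hab
      rw [ParamIdx.V.injEq] at h1
      rw [he' h1.2.1, hι' h1.2.2]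
  have hval : ∀ q, θ.value (g q) = fun ω => θ.edge l e ι ω q := by
    rintro ⟨_ | a, b⟩ <;> rfl
  have hind := h.indep.precomp hg
  have hm : ∀ q, Measurable (θ.value (g q)) := fun q => h.measurable_value _ (g q).2
  have := (iIndepFun_iff_map_fun_eq_pi_map fun q => (hm q).aemeasurable).1 hind
  simp only [hval] at this
  refine this.trans ?_
  congr 1
  ext1 q
  rw [← hval]
  rcases q with ⟨_ | a, b⟩
  · exact h.law_B l (ι b) ⟨hl, hl', hι b⟩
  · exact h.law_V l (e a) (ι b) ⟨hl, hl', he a, hι b⟩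

end IsMoGP

/-! ### Second moments of a network -/

lemma width_succ {L : ℕ} (din dout : ℕ+) (p : Fin L → ℕ+) {l : ℕ} (hl : l < L) :
    width din dout p (l + 1) = p ⟨l, hl⟩ := by
  simp only [width, dif_pos hl]

lemma width_pos {L : ℕ} (din dout : ℕ+) (p : Fin L → ℕ+) (l : ℕ) : 0 < width din dout p l := by
  cases l with
  | zero => exact din.pos
  | succ l =>
    simp only [width]
    split_ifs
    · exact PNat.pos _
    · exact dout.pos

namespace IsMoGP

variable {L : ℕ} {din dout : ℕ+} {σb σv : ℝ≥0} {μ : Fin L → ℕ+ → ProbabilityMeasure ℝ≥0}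
  {p : Fin L → ℕ+} {Ω : Type*} [MeasurableSpace Ω] {P : Measure Ω} [IsProbabilityMeasure P]
  {θ : Params Ω} (h : IsMoGP din dout σb σv μ p P θ)
  {φ : ℝ → ℝ} (hφ : Measurable φ) (x : Fin din → ℝ)
include h

omit [IsProbabilityMeasure P] in
include hφ in
lemma measurable_net {w : ℝ≥0 → ℝ} (hw : Measurable w) {l : ℕ} (hl : l ≤ L + 1) {k : ℕ}
    (hk : k < width din dout p l) : Measurable (net din dout p θ φ x w l k) :=
  MoGP.measurable_net hφ hw hl (fun i hi _ => h.measurable_value i hi) hk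

/-- The coefficient `b` is `1` for one network and `0` for the difference of two networks, whose
biases cancel. -/
lemma lintegral_sq_edge {l : ℕ} (hl : 1 ≤ l) (hl' : l ≤ L + 1) {k : ℕ}
    (hk : k < width din dout p l) {n : ℕ} (hn : n = width din dout p (l - 1))
    {c : Fin n → Ω → ℝ} (hc : ∀ j, Measurable[rankAlgebra din dout p θ (Set.Iio (2 * l))] (c j))
    (b : ℝ) :
    ∫⁻ ω, ENNReal.ofReal ((∑ j, c j ω * θ.V l j k ω + b * θ.B l k ω) ^ 2) ∂P
      = ∑ j, (∫⁻ ω, ENNReal.ofReal (c j ω ^ 2) ∂P) * (σv ^ 2 : ℝ≥0)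
        + ENNReal.ofReal (b ^ 2) * (σb ^ 2 : ℝ≥0) := by
  set D : Ω → Option (Fin n) × Unit → ℝ := fun ω q => q.1.elim b fun j => c j ω with hD
  have he : ∀ j : Fin n, (j : ℕ) < width din dout p (l - 1) := fun j => by rw [← hn]; exact j.2
  have hι : ∀ _ : Unit, k < width din dout p l := fun _ => hk
  have hDm : Measurable[rankAlgebra din dout p θ (Set.Iio (2 * l))] D := by
    refine @measurable_pi_lambda _ _ _ (rankAlgebra din dout p θ _) _ _ fun q => ?_
    rcases q with ⟨_ | j, i⟩
    · exact @measurable_const _ _ _ (rankAlgebra din dout p θ _) _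
    · exact hc j
  have hW := measurable_edge_rankAlgebra (θ := θ) hl hl' (Set.mem_singleton (2 * l)) he hι
  have hdis : Disjoint (Set.Iio (2 * l)) {2 * l} := by simp
  have := lintegral_sq_sum_of_indepFun (hDm.mono (h.rankAlgebra_le _) le_rfl)
    (hW.mono (h.rankAlgebra_le _) le_rfl) (h.indepFun_of_rank hdis hDm hW)
    (h.map_edge hl hl' he hι Fin.val_injective (fun _ _ _ => rfl))
  simp only [Fintype.sum_prod_type, Fintype.sum_option, Finset.univ_unique, Finset.sum_singleton,
    hD, Option.elim_none, Option.elim_some, Params.edge, edgeVar, lintegral_const, measure_univ,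
    mul_one] at this
  rw [add_comm (∑ j, _ * _), ← this]
  refine lintegral_congr fun ω => ?_
  rw [add_comm (∑ j, _)]

lemma lintegral_sq_net_one (φ : ℝ → ℝ) (w : ℝ≥0 → ℝ) {k : ℕ} (hk : k < width din dout p 1) :
    ∫⁻ ω, ENNReal.ofReal (net din dout p θ φ x w 1 k ω ^ 2) ∂P
      = ∑ j, ENNReal.ofReal ((Real.sqrt (1 / (din : ℕ)) * x j) ^ 2) * (σv ^ 2 : ℝ≥0)
        + (σb ^ 2 : ℝ≥0) := by
  have := h.lintegral_sq_edge le_rfl (by omega) hk (n := din) rfl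
    (c := fun j _ => Real.sqrt (1 / (din : ℕ)) * x j)
    (fun j => @measurable_const _ _ _ (rankAlgebra din dout p θ _) _) 1
  simp only [lintegral_const, measure_univ, mul_one, one_pow, ENNReal.ofReal_one, one_mul] at this
  rw [← this]
  refine lintegral_congr fun ω => ?_
  rw [net, firstPreact]
  simp only [mul_right_comm]

omit [MeasurableSpace Ω] [IsProbabilityMeasure P] h in
lemma net_add_two (φ : ℝ → ℝ) (w : ℝ≥0 → ℝ) {l : ℕ} (hl : l < L) (k : ℕ) (ω : Ω) :
    net din dout p θ φ x w (l + 2) k ω = ∑ j : Fin (p ⟨l, hl⟩),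
      (w (θ.lam (l + 1) j ω) * φ (net din dout p θ φ x w (l + 1) j ω)) * θ.V (l + 2) j k ω
      + θ.B (l + 2) k ω := by
  rw [net, width_succ _ _ _ hl, Finset.sum_range]
  simp only [mul_right_comm]

omit [MeasurableSpace Ω] [IsProbabilityMeasure P] h in
include hφ in
lemma measurable_coeff_rankAlgebra {w : ℝ≥0 → ℝ} (hw : Measurable w) {l : ℕ} (hl : l < L)
    (j : Fin (p ⟨l, hl⟩)) : Measurable[rankAlgebra din dout p θ (Set.Iio (2 * (l + 2)))]
      (fun ω => w (θ.lam (l + 1) j ω) * φ (net din dout p θ φ x w (l + 1) j ω)) := by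
  have hj : (j : ℕ) < width din dout p (l + 1) := by rw [width_succ _ _ _ hl]; exact j.2
  refine @Measurable.fun_mul _ _ _ _ (rankAlgebra din dout p θ _) _ _ _ (hw.comp ?_) (hφ.comp ?_)
  · exact measurable_lam_rankAlgebra ⟨by omega, hl, hj⟩ (Set.mem_Iio.2 (by omega))
  · exact measurable_net_rankAlgebra hφ hw (by omega)
      (fun i hi => Set.mem_Iio.2 (by have := Set.mem_Iic.1 hi; omega)) hj

include hφ in
lemma lintegral_sq_net_add_two {w : ℝ≥0 → ℝ} (hw : Measurable w) {l : ℕ} (hl : l < L) {k : ℕ}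
    (hk : k < width din dout p (l + 2)) :
    ∫⁻ ω, ENNReal.ofReal (net din dout p θ φ x w (l + 2) k ω ^ 2) ∂P
      = ∑ j : Fin (p ⟨l, hl⟩), (∫⁻ ω, ENNReal.ofReal
          ((w (θ.lam (l + 1) j ω) * φ (net din dout p θ φ x w (l + 1) j ω)) ^ 2) ∂P)
          * (σv ^ 2 : ℝ≥0) + (σb ^ 2 : ℝ≥0) := by
  have := h.lintegral_sq_edge (l := l + 2) (by omega) (by omega) hk
    (n := p ⟨l, hl⟩) (width_succ _ _ _ hl).symm
    (fun j => measurable_coeff_rankAlgebra hφ x hw hl j) 1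
  simp only [one_mul, one_pow, ENNReal.ofReal_one] at this
  rw [← this]
  exact lintegral_congr fun ω => by rw [net_add_two x φ w hl]

include hφ in
-- The explicit second moment does not mention the node. Thus `supSecondMoment`, defined with node
-- `0`, controls all nodes of the layer.
lemma lintegral_sq_net_eq {w : ℝ≥0 → ℝ} (hw : Measurable w) {l : ℕ} (hl : l ≤ L + 1) {k k' : ℕ}
    (hk : k < width din dout p l) (hk' : k' < width din dout p l) :
    ∫⁻ ω, ENNReal.ofReal (net din dout p θ φ x w l k ω ^ 2) ∂P
      = ∫⁻ ω, ENNReal.ofReal (net din dout p θ φ x w l k' ω ^ 2) ∂P := by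
  rcases l with _ | _ | l
  · rfl
  · rw [h.lintegral_sq_net_one x φ w hk, h.lintegral_sq_net_one x φ w hk']
  · rw [h.lintegral_sq_net_add_two hφ x hw (by omega) hk,
      h.lintegral_sq_net_add_two hφ x hw (by omega) hk']

include hφ in
lemma lintegral_sq_net_sub_net {w w' : ℝ≥0 → ℝ} (hw : Measurable w) (hw' : Measurable w')
    {l : ℕ} (hl : l < L) {k : ℕ} (hk : k < width din dout p (l + 2)) :
    ∫⁻ ω, ENNReal.ofReal ((net din dout p θ φ x w (l + 2) k ω
        - net din dout p θ φ x w' (l + 2) k ω) ^ 2) ∂P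
      = ∑ j : Fin (p ⟨l, hl⟩), (∫⁻ ω, ENNReal.ofReal
          ((w (θ.lam (l + 1) j ω) * φ (net din dout p θ φ x w (l + 1) j ω)
            - w' (θ.lam (l + 1) j ω) * φ (net din dout p θ φ x w' (l + 1) j ω)) ^ 2) ∂P)
          * (σv ^ 2 : ℝ≥0) := by
  have := h.lintegral_sq_edge (l := l + 2) (by omega) (by omega) hk
    (n := p ⟨l, hl⟩) (width_succ _ _ _ hl).symm
    (c := fun j ω => w (θ.lam (l + 1) j ω) * φ (net din dout p θ φ x w (l + 1) j ω)
            - w' (θ.lam (l + 1) j ω) * φ (net din dout p θ φ x w' (l + 1) j ω))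
    (fun j => @Measurable.fun_sub _ _ _ _ (rankAlgebra din dout p θ _) _ _ _
      (measurable_coeff_rankAlgebra hφ x hw hl j) (measurable_coeff_rankAlgebra hφ x hw' hl j)) 0
  simp only [zero_mul, add_zero, ne_eq, OfNat.ofNat_ne_zero, not_false_eq_true, zero_pow,
    ENNReal.ofReal_zero] at this
  rw [← this]
  refine lintegral_congr fun ω => ?_
  rw [net_add_two x φ w hl, net_add_two x φ w' hl, add_sub_add_right_eq_sub,
    ← Finset.sum_sub_distrib]
  simp only [sub_mul]

omit [IsProbabilityMeasure P] in
lemma lintegral_lam_mul {l : ℕ} (hl : l < L) {j : ℕ} (hj : j < p ⟨l, hl⟩) {f : ℝ≥0 → ℝ≥0∞}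
    (hf : Measurable f) {G : Ω → ℝ≥0∞}
    (hG : Measurable[rankAlgebra din dout p θ (Set.Iic (2 * (l + 1)))] G) :
    ∫⁻ ω, f (θ.lam (l + 1) j ω) * G ω ∂P
      = (∫⁻ a, f a ∂(μ ⟨l, hl⟩ (p ⟨l, hl⟩) : Measure ℝ≥0)) * ∫⁻ ω, G ω ∂P := by
  have hr : (ParamIdx.lam (l + 1) j).InRange din dout p :=
    ⟨by omega, hl, by rw [width_succ _ _ _ hl]; exact hj⟩
  have hlam := measurable_lam_rankAlgebra (θ := θ) (S := {2 * (l + 1) + 1}) hr rfl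
  have hdis : Disjoint {2 * (l + 1) + 1} (Set.Iic (2 * (l + 1))) := by simp
  have hind := h.indepFun_of_rank hdis (hf.comp hlam) hG
  have h1 := lintegral_mul_eq_lintegral_mul_lintegral_of_indepFun
    (hf.comp (h.measurable_lam hr)) (hG.mono (h.rankAlgebra_le _) le_rfl) hind
  simp only [Pi.mul_apply, Function.comp] at h1
  rw [h1]
  congr 1
  have h2 := h.law_lam ⟨l, hl⟩ j hj
  rw [← h2, lintegral_map hf (h.measurable_lam hr)]

include hφ in
-- One step of the error recursion, with the error made in the weights (`f`) separated from the
-- error inherited from the layer below (`g`). It serves both for pruning and for discretisation,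
-- which differ only in `f` and `g`.
lemma lintegral_sq_net_sub_net_le {w w' : ℝ≥0 → ℝ} (hw : Measurable w) (hw' : Measurable w')
    {f g : ℝ≥0 → ℝ≥0∞} (hf : Measurable f) (hg : Measurable g)
    (hfg : ∀ a z z', ENNReal.ofReal ((w a * φ z - w' a * φ z') ^ 2)
      ≤ f a * ENNReal.ofReal (z ^ 2) + g a * ENNReal.ofReal ((z - z') ^ 2))
    {l : ℕ} (hl : l < L) {m e : ℝ≥0∞}
    (hm : ∀ j < width din dout p (l + 1),
      ∫⁻ ω, ENNReal.ofReal (net din dout p θ φ x w (l + 1) j ω ^ 2) ∂P ≤ m)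
    (he : ∀ j < width din dout p (l + 1),
      ∫⁻ ω, ENNReal.ofReal ((net din dout p θ φ x w (l + 1) j ω
        - net din dout p θ φ x w' (l + 1) j ω) ^ 2) ∂P ≤ e)
    {k : ℕ} (hk : k < width din dout p (l + 2)) :
    ∫⁻ ω, ENNReal.ofReal ((net din dout p θ φ x w (l + 2) k ω
        - net din dout p θ φ x w' (l + 2) k ω) ^ 2) ∂P
      ≤ (σv ^ 2 : ℝ≥0) * ((p ⟨l, hl⟩ * ∫⁻ a, f a ∂(μ ⟨l, hl⟩ (p ⟨l, hl⟩) : Measure ℝ≥0)) * m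
        + (p ⟨l, hl⟩ * ∫⁻ a, g a ∂(μ ⟨l, hl⟩ (p ⟨l, hl⟩) : Measure ℝ≥0)) * e) := by
  rw [h.lintegral_sq_net_sub_net hφ x hw hw' hl hk]
  set If := ∫⁻ a, f a ∂(μ ⟨l, hl⟩ (p ⟨l, hl⟩) : Measure ℝ≥0)
  set Ig := ∫⁻ a, g a ∂(μ ⟨l, hl⟩ (p ⟨l, hl⟩) : Measure ℝ≥0)
  have hterm : ∀ j : Fin (p ⟨l, hl⟩), ∫⁻ ω, ENNReal.ofReal
      ((w (θ.lam (l + 1) j ω) * φ (net din dout p θ φ x w (l + 1) j ω)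
        - w' (θ.lam (l + 1) j ω) * φ (net din dout p θ φ x w' (l + 1) j ω)) ^ 2) ∂P
      ≤ If * m + Ig * e := by
    intro j
    have hj : (j : ℕ) < width din dout p (l + 1) := by rw [width_succ _ _ _ hl]; exact j.2
    have hr : (ParamIdx.lam (l + 1) j).InRange din dout p := ⟨by omega, hl, hj⟩
    have hZ := measurable_net_rankAlgebra (θ := θ) (x := x) hφ hw (S := Set.Iic (2 * (l + 1)))
      (by omega) subset_rfl hj
    have hZ' := measurable_net_rankAlgebra (θ := θ) (x := x) hφ hw' (S := Set.Iic (2 * (l + 1)))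
      (by omega) subset_rfl hj
    have hG : Measurable[rankAlgebra din dout p θ (Set.Iic (2 * (l + 1)))]
        (fun ω => ENNReal.ofReal (net din dout p θ φ x w (l + 1) j ω ^ 2)) :=
      (by fun_prop : Measurable fun z : ℝ => ENNReal.ofReal (z ^ 2)).comp hZ
    have hG' : Measurable[rankAlgebra din dout p θ (Set.Iic (2 * (l + 1)))]
        (fun ω => ENNReal.ofReal ((net din dout p θ φ x w (l + 1) j ω
          - net din dout p θ φ x w' (l + 1) j ω) ^ 2)) :=
      (by fun_prop : Measurable fun z : ℝ => ENNReal.ofReal (z ^ 2)).comp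
        (@Measurable.fun_sub _ _ _ _ (rankAlgebra din dout p θ _) _ _ _ hZ hZ')
    calc _ ≤ ∫⁻ ω, (f (θ.lam (l + 1) j ω)
            * ENNReal.ofReal (net din dout p θ φ x w (l + 1) j ω ^ 2)
          + g (θ.lam (l + 1) j ω) * ENNReal.ofReal ((net din dout p θ φ x w (l + 1) j ω
            - net din dout p θ φ x w' (l + 1) j ω) ^ 2)) ∂P := lintegral_mono fun ω => hfg _ _ _
      _ = If * (∫⁻ ω, ENNReal.ofReal (net din dout p θ φ x w (l + 1) j ω ^ 2) ∂P)
          + Ig * ∫⁻ ω, ENNReal.ofReal ((net din dout p θ φ x w (l + 1) j ω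
            - net din dout p θ φ x w' (l + 1) j ω) ^ 2) ∂P := by
          have hfl : Measurable fun ω => f (θ.lam (l + 1) j ω) := hf.comp (h.measurable_lam hr)
          rw [lintegral_add_left (hfl.fun_mul (hG.mono (h.rankAlgebra_le _) le_rfl)),
            h.lintegral_lam_mul hl j.2 hf hG, h.lintegral_lam_mul hl j.2 hg hG']
      _ ≤ If * m + Ig * e := by
          gcongr
          · exact hm j hj
          · exact he j hj
  calc _ ≤ ∑ j : Fin (p ⟨l, hl⟩), (If * m + Ig * e) * (σv ^ 2 : ℝ≥0) := by
        gcongr with j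
        exact hterm j
    _ = _ := by
        rw [Finset.sum_const, Finset.card_univ, Fintype.card_fin, nsmul_eq_mul]
        ring

/-- Only `w² ≤ λ` is asked of the weight, so that the full, the pruned and the discretised networks
are all covered. -/
lemma lintegral_sq_net_add_two_le (hφ : PosHomogeneous φ) {w : ℝ≥0 → ℝ} (hw : Measurable w)
    (hw' : ∀ a : ℝ≥0, w a ^ 2 ≤ a) {l : ℕ} (hl : l < L) {m : ℝ≥0∞}
    (hm : ∀ j < width din dout p (l + 1),
      ∫⁻ ω, ENNReal.ofReal (net din dout p θ φ x w (l + 1) j ω ^ 2) ∂P ≤ m)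
    {k : ℕ} (hk : k < width din dout p (l + 2)) :
    ∫⁻ ω, ENNReal.ofReal (net din dout p θ φ x w (l + 2) k ω ^ 2) ∂P
      ≤ (σv ^ 2 : ℝ≥0) * (ENNReal.ofReal (cLip φ ^ 2)
        * meanSum (μ ⟨l, hl⟩) (p ⟨l, hl⟩) * m) + (σb ^ 2 : ℝ≥0) := by
  rw [h.lintegral_sq_net_add_two hφ.measurable x hw hl hk, meanSum_eq]
  set I := ∫⁻ a : ℝ≥0, (a : ℝ≥0∞) ∂(μ ⟨l, hl⟩ (p ⟨l, hl⟩) : Measure ℝ≥0)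
  have hterm : ∀ j : Fin (p ⟨l, hl⟩), ∫⁻ ω, ENNReal.ofReal
      ((w (θ.lam (l + 1) j ω) * φ (net din dout p θ φ x w (l + 1) j ω)) ^ 2) ∂P
      ≤ I * (ENNReal.ofReal (cLip φ ^ 2) * m) := by
    intro j
    have hj : (j : ℕ) < width din dout p (l + 1) := by rw [width_succ _ _ _ hl]; exact j.2
    have hZ := measurable_net_rankAlgebra (θ := θ) (x := x) hφ.measurable hw
      (S := Set.Iic (2 * (l + 1))) (by omega) subset_rfl hj
    have hG : Measurable[rankAlgebra din dout p θ (Set.Iic (2 * (l + 1)))]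
        (fun ω => ENNReal.ofReal (cLip φ ^ 2)
          * ENNReal.ofReal (net din dout p θ φ x w (l + 1) j ω ^ 2)) :=
      (by fun_prop : Measurable fun z : ℝ => ENNReal.ofReal (cLip φ ^ 2)
        * ENNReal.ofReal (z ^ 2)).comp hZ
    calc _ ≤ ∫⁻ ω, (θ.lam (l + 1) j ω : ℝ≥0∞) * (ENNReal.ofReal (cLip φ ^ 2)
            * ENNReal.ofReal (net din dout p θ φ x w (l + 1) j ω ^ 2)) ∂P := by
          refine lintegral_mono fun ω => ?_
          simp only
          rw [← ENNReal.ofReal_coe_nnreal, ← ENNReal.ofReal_mul (sq_nonneg _),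
            ← ENNReal.ofReal_mul (NNReal.coe_nonneg _), mul_pow]
          exact ENNReal.ofReal_le_ofReal (mul_le_mul (hw' _) (hφ.sq_le _) (sq_nonneg _)
            (NNReal.coe_nonneg _))
      _ = I * ∫⁻ ω, ENNReal.ofReal (cLip φ ^ 2)
            * ENNReal.ofReal (net din dout p θ φ x w (l + 1) j ω ^ 2) ∂P :=
          h.lintegral_lam_mul hl j.2 (f := fun a => (a : ℝ≥0∞)) (by fun_prop) hG
      _ ≤ _ := by
          rw [lintegral_const_mul' _ _ ENNReal.ofReal_ne_top]
          gcongr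
          exact hm j hj
  gcongr
  calc _ ≤ ∑ j : Fin (p ⟨l, hl⟩), I * (ENNReal.ofReal (cLip φ ^ 2) * m) * (σv ^ 2 : ℝ≥0) := by
        gcongr with j
        exact hterm j
    _ = _ := by
        rw [Finset.sum_const, Finset.card_univ, Fintype.card_fin, nsmul_eq_mul]
        ring

end IsMoGP

/-! ### The bound on the pruning error -/

/-- The second moments are maximised over all widths, so a bound valid for large `n` is not enough.
The finitely many remaining means are finite by assumption, and their sum is added. -/
lemma UI.exists_meanSum_le {μ : ℕ+ → ProbabilityMeasure ℝ≥0} {a : ℝ≥0} {ρ : Measure ℝ}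
    (h : UI μ a ρ) : ∃ C : ℝ≥0, ∀ n, meanSum μ n ≤ C := by
  have hfin : (a : ℝ≥0∞) + firstMoment ρ < ⊤ :=
    ENNReal.add_lt_top.2 ⟨ENNReal.coe_lt_top, h.firstMoment_lt_top⟩
  obtain ⟨N, hN⟩ := eventually_atTop.1 (h.tendsto_meanSum.eventually_lt_const
    (ENNReal.lt_add_right hfin.ne one_ne_zero))
  have hS : ((a : ℝ≥0∞) + firstMoment ρ + 1) + ∑ n ∈ Finset.Icc 1 N, meanSum μ n ≠ ⊤ := by
    refine ENNReal.add_ne_top.2 ⟨ENNReal.add_ne_top.2 ⟨hfin.ne, ENNReal.one_ne_top⟩, ?_⟩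
    exact ENNReal.sum_ne_top.2 fun n _ => (h.meanSum_lt_top n).ne
  refine ⟨ENNReal.toNNReal (((a : ℝ≥0∞) + firstMoment ρ + 1)
    + ∑ n ∈ Finset.Icc 1 N, meanSum μ n), fun n => ?_⟩
  rw [ENNReal.coe_toNNReal hS]
  rcases le_total N n with hn | hn
  · exact (hN n hn).le.trans le_self_add
  · refine le_trans ?_ le_add_self
    exact Finset.single_le_sum (f := fun n => meanSum μ n) (fun _ _ => zero_le)
      (Finset.mem_Icc.2 ⟨one_le, hn⟩)

lemma exists_forall_meanSum_le {L : ℕ} {μ : Fin L → ℕ+ → ProbabilityMeasure ℝ≥0} {a : ℝ≥0}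
    {ρ : Measure ℝ} (h : ∀ i, UI (μ i) a ρ) : ∃ C : ℝ≥0, ∀ i n, meanSum (μ i) n ≤ C := by
  choose C hC using fun i => (h i).exists_meanSum_le
  refine ⟨∑ i, C i, fun i n => (hC i n).trans ?_⟩
  exact_mod_cast Finset.single_le_sum (f := C) (fun _ _ => zero_le) (Finset.mem_univ i)

lemma tendsto_apply_atTop {L : ℕ} (i : Fin L) :
    Tendsto (fun p : Fin L → ℕ+ => p i) atTop atTop :=
  tendsto_atTop.2 fun b => (eventually_ge_atTop fun _ => b).mono fun _ hp => hp i

lemma eventually_lt_width {L : ℕ} (din dout : ℕ+) {l k : ℕ} (hl : l ≤ L)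
    (hk : l = L → k < dout) : ∀ᶠ p : Fin L → ℕ+ in atTop, k < width din dout p (l + 1) := by
  rcases hl.lt_or_eq with h | h
  · filter_upwards [(tendsto_apply_atTop (⟨l, h⟩ : Fin L)).eventually_ge_atTop k.succPNat] with p hp
    rw [width_succ _ _ _ h]
    have : (k.succPNat : ℕ) ≤ (p ⟨l, h⟩ : ℕ) := hp
    rw [Nat.succPNat_coe] at this
    omega
  · refine Eventually.of_forall fun p => ?_
    simp only [width, h, lt_irrefl, dite_false]
    exact hk h

/-- The bound on the error of layer `l + 1`, when each layer contributes at most `κ` to the error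
and `N_n ≤ M`. -/
noncomputable def errBound (c κ M : ℝ) (U : ℕ → ℝ) (l : ℕ) : ℝ :=
  c * κ * ∑ i ∈ Finset.range l, (c * M) ^ i * U (l - i)

/-- The term `i = 0` is the error created at the newest layer; all others carry one factor `c * M`
more than before. -/
lemma errBound_succ (c κ M : ℝ) (U : ℕ → ℝ) (l : ℕ) :
    errBound c κ M U (l + 1) = c * (κ * U (l + 1) + M * errBound c κ M U l) := by
  rw [errBound, errBound, Finset.sum_range_succ']
  have : ∀ i ∈ Finset.range l, (c * M) ^ (i + 1) * U (l + 1 - (i + 1))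
      = (c * M) * ((c * M) ^ i * U (l - i)) := fun i _ => by
    rw [Nat.add_sub_add_right]; ring
  rw [Finset.sum_congr rfl this, ← Finset.mul_sum]
  simp only [pow_zero, one_mul, Nat.sub_zero]
  ring

lemma errBound_nonneg {c κ M : ℝ} (hc : 0 ≤ c) (hκ : 0 ≤ κ) (hM : 0 ≤ M) {U : ℕ → ℝ}
    (hU : ∀ l, 0 ≤ U l) (l : ℕ) : 0 ≤ errBound c κ M U l :=
  mul_nonneg (mul_nonneg hc hκ) (Finset.sum_nonneg fun _ _ =>
    mul_nonneg (pow_nonneg (mul_nonneg hc hM) _) (hU _))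

lemma continuous_errBound (c κ M : ℝ) (U : ℕ → ℝ) (l : ℕ) :
    Continuous fun t : ℝ => errBound c (κ + t) (M + t) U l := by
  unfold errBound
  fun_prop

lemma pruningConst_mul_rpow (σv C M α δ : ℝ) (U : ℕ → ℝ) (l : ℕ) (r : ℝ) :
    pruningConst σv C M α δ U l * r = errBound (σv ^ 2 * C ^ 2) (r / (1 - (α + δ))) M U l := by
  rw [pruningConst, errBound]
  ring

/-- Since `ε` may be an atom, the limit is taken at a slightly larger level `ε' < ε₀` that is not
one; the bound is continuous in the level, and `κ` leaves room for the change. -/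
lemma eventually_setMean_le {ρ : Measure ℝ} (hρ : IsLevyMeasure ρ) (hM : firstMoment ρ < ⊤)
    {μ : ℕ+ → ProbabilityMeasure ℝ≥0} (hμ : SumTendstoID μ 0 ρ) {η ε₀ : ℝ} (hη : η < 1)
    (h : ∀ u, 0 < u → u < ε₀ → tail ρ u ≤ u ^ (-η)) {ε : ℝ} (hε : 0 < ε) (hεε : ε < ε₀)
    {κ : ℝ} (hκ : ε ^ (1 - η) / (1 - η) < κ) :
    ∀ᶠ n in atTop, setMean μ (Set.Iic ε) n ≤ ENNReal.ofReal κ := by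
  have hcont : Tendsto (fun t : ℝ => t ^ (1 - η) / (1 - η)) (𝓝[>] ε)
      (𝓝 (ε ^ (1 - η) / (1 - η))) :=
    ((Real.continuousAt_rpow_const _ _ (Or.inl hε.ne')).tendsto.div_const _).mono_left
      nhdsWithin_le_nhds
  have hev := (hcont.eventually_lt_const hκ).and (Ioo_mem_nhdsGT hεε)
  obtain ⟨v, hv, hv'⟩ := mem_nhdsGT_iff_exists_Ioc_subset.1 hev
  obtain ⟨ε', h1, h2, h3⟩ := exists_null_singleton hρ (Set.mem_Ioi.1 hv)
  obtain ⟨h4, h5⟩ := hv' ⟨h1, h2.le⟩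
  have hpos : 0 < κ := lt_of_le_of_lt (div_nonneg (Real.rpow_nonneg hε.le _) (by linarith)) hκ
  have hlt : ∫⁻ x in Set.Iic ε', ENNReal.ofReal x ∂ρ < ENNReal.ofReal κ :=
    (setLIntegral_Iic_le_rpow hρ hη h (hε.trans h1) h5.2.le).trans_lt
      ((ENNReal.ofReal_lt_ofReal_iff hpos).2 h4)
  filter_upwards [(tendsto_setMean_Iic hρ hM hμ h3).eventually_lt_const hlt] with n hn
  exact (setMean_mono μ (Set.Iic_subset_Iic.2 h1.le) n).trans hn.le

lemma measurable_sqrt_coe : Measurable fun a : ℝ≥0 => Real.sqrt (a : ℝ) := by fun_prop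

open Classical in
lemma measurable_sqrt_mul_ite (ε : ℝ) :
    Measurable fun a : ℝ≥0 => Real.sqrt (a : ℝ) * if ε < (a : ℝ) then 1 else 0 :=
  measurable_sqrt_coe.mul (Measurable.ite (measurableSet_lt measurable_const (by fun_prop))
    measurable_const measurable_const)

section Family

variable {L : ℕ} {din dout : ℕ+} {σb σv : ℝ≥0} {φ : ℝ → ℝ} (hφ : PosHomogeneous φ)
  {μ : Fin L → ℕ+ → ProbabilityMeasure ℝ≥0}
  {Ω : (Fin L → ℕ+) → Type*} [∀ p, MeasurableSpace (Ω p)]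
  {P : ∀ p, Measure (Ω p)} [∀ p, IsProbabilityMeasure (P p)] {θ : ∀ p, Params (Ω p)}
  (hθ : ∀ p, IsMoGP din dout σb σv μ p (P p) (θ p)) (x : Fin din → ℝ)

include hφ hθ in
lemma exists_lintegral_sq_net_le {C : ℝ≥0} (hC : ∀ i n, meanSum (μ i) n ≤ C) (l : ℕ) (hl : l ≤ L) :
    ∃ M : ℝ≥0, ∀ p, ∀ k < width din dout p (l + 1), ∀ w : ℝ≥0 → ℝ, Measurable w →
      (∀ a : ℝ≥0, w a ^ 2 ≤ a) →
      ∫⁻ ω, ENNReal.ofReal (net din dout p (θ p) φ x w (l + 1) k ω ^ 2) ∂(P p) ≤ M := by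
  induction l with
  | zero =>
    have hfin : ∑ j, ENNReal.ofReal ((Real.sqrt (1 / (din : ℕ)) * x j) ^ 2) * (σv ^ 2 : ℝ≥0)
        + ((σb ^ 2 : ℝ≥0) : ℝ≥0∞) ≠ ⊤ := by
      refine ENNReal.add_ne_top.2 ⟨ENNReal.sum_ne_top.2 fun j _ => ?_, ENNReal.coe_ne_top⟩
      exact ENNReal.mul_ne_top ENNReal.ofReal_ne_top ENNReal.coe_ne_top
    refine ⟨ENNReal.toNNReal (∑ j, ENNReal.ofReal ((Real.sqrt (1 / (din : ℕ)) * x j) ^ 2)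
      * (σv ^ 2 : ℝ≥0) + ((σb ^ 2 : ℝ≥0) : ℝ≥0∞)), fun p k hk w _ _ => ?_⟩
    rw [(hθ p).lintegral_sq_net_one x φ w hk]
    exact (ENNReal.coe_toNNReal hfin).ge
  | succ l ih =>
    obtain ⟨M, hM⟩ := ih (by omega)
    refine ⟨σv ^ 2 * ((cLip φ ^ 2).toNNReal * C * M) + σb ^ 2, fun p k hk w hw hw' => ?_⟩
    refine ((hθ p).lintegral_sq_net_add_two_le x hφ hw hw' hl
      (fun j hj => hM p j hj w hw hw') hk).trans ?_
    push_cast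
    gcongr
    · exact le_rfl
    · exact hC _ _

include hφ hθ in
lemma supSecondMoment_lt_top {C : ℝ≥0} (hC : ∀ i n, meanSum (μ i) n ≤ C) {l : ℕ} (hl : l ≤ L) :
    supSecondMoment din dout P θ φ x (l + 1) < ⊤ := by
  obtain ⟨M, hM⟩ := exists_lintegral_sq_net_le hφ hθ x hC l hl
  refine lt_of_le_of_lt (iSup_le fun p => ?_) (ENNReal.coe_lt_top (r := M))
  rw [preact_eq_net]
  exact hM p 0 (width_pos _ _ _ _) _ measurable_sqrt_coe
    fun a => (Real.sq_sqrt a.coe_nonneg).le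

include hφ hθ in
lemma lintegral_sq_preact_le_supSecondMoment {l : ℕ} (hl : l ≤ L + 1) (p : Fin L → ℕ+) {k : ℕ}
    (hk : k < width din dout p l) :
    ∫⁻ ω, ENNReal.ofReal (net din dout p (θ p) φ x (fun a => Real.sqrt a) l k ω ^ 2) ∂(P p)
      ≤ supSecondMoment din dout P θ φ x l := by
  rw [(hθ p).lintegral_sq_net_eq hφ.measurable x measurable_sqrt_coe hl hk (width_pos _ _ _ _),
    ← preact_eq_net]
  exact le_iSup (fun p => ∫⁻ ω, ENNReal.ofReal ((preact din dout p (θ p) φ x l 0 ω) ^ 2) ∂(P p)) p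

omit [∀ p, IsProbabilityMeasure (P p)] in
open Classical in
lemma pruningError_eq (p : Fin L → ℕ+) (ε : ℝ) (l k : ℕ) :
    pruningError din dout p (θ p) φ x (P p) ε l k = ∫⁻ ω, ENNReal.ofReal
      ((net din dout p (θ p) φ x (fun a => Real.sqrt a) l k ω - net din dout p (θ p) φ x
        (fun a => Real.sqrt a * if ε < (a : ℝ) then 1 else 0) l k ω) ^ 2) ∂(P p) := by
  simp only [pruningError, sq_abs, preact_eq_net, prunedPreact_eq_net]

include hφ hθ in
-- A node is either pruned, with error `λ φ(Z)²`, or kept, with error `λ (φ(Z) - φ(Z*))²`. As the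
-- cases exclude each other, no factor `2` from `(a + b)² ≤ 2 a² + 2 b²` appears, and the constant
-- is the one announced.
lemma pruningError_le_errBound {C : ℝ≥0} (hC : ∀ i n, meanSum (μ i) n ≤ C) {ε κ M : ℝ}
    (hκ : 0 ≤ κ) (hM : 0 ≤ M) {p : Fin L → ℕ+}
    (h1 : ∀ i, setMean (μ i) (Set.Iic ε) (p i) ≤ ENNReal.ofReal κ)
    (h2 : ∀ i, meanSum (μ i) (p i) ≤ ENNReal.ofReal M) {l : ℕ} (hl : l ≤ L) {k : ℕ}
    (hk : k < width din dout p (l + 1)) :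
    pruningError din dout p (θ p) φ x (P p) ε (l + 1) k
      ≤ ENNReal.ofReal (errBound (σv ^ 2 * cLip φ ^ 2) κ M
        (fun l' => (supSecondMoment din dout P θ φ x l').toReal) l) := by
  classical
  set U : ℕ → ℝ := fun l' => (supSecondMoment din dout P θ φ x l').toReal with hU
  have hU0 : ∀ l, 0 ≤ U l := fun l => ENNReal.toReal_nonneg
  induction l generalizing k with
  | zero =>
    rw [pruningError_eq]
    simp [net]
  | succ l ih =>
    have hl' : l < L := hl
    set c := cLip φ ^ 2 with hc
    have hc0 : 0 ≤ c := sq_nonneg _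
    have hms : MeasurableSet (((↑) : ℝ≥0 → ℝ) ⁻¹' Set.Iic ε) :=
      measurableSet_Iic.preimage (by fun_prop)
    have hcm : Measurable fun a : ℝ≥0 => (a : ℝ≥0∞) := by fun_prop
    rw [pruningError_eq]
    have := (hθ p).lintegral_sq_net_sub_net_le hφ.measurable x measurable_sqrt_coe
      (measurable_sqrt_mul_ite ε)
      (f := fun a => ENNReal.ofReal c * (((↑) : ℝ≥0 → ℝ) ⁻¹' Set.Iic ε).indicator
        (fun a : ℝ≥0 => (a : ℝ≥0∞)) a)
      (g := fun a => ENNReal.ofReal c * a)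
      (measurable_const.mul (hcm.indicator hms)) (measurable_const.mul hcm)
      (fun a z z' => by
        have ha := a.coe_nonneg
        by_cases h : ε < (a : ℝ)
        · rw [if_pos h, Set.indicator_of_notMem (show a ∉ ((↑) : ℝ≥0 → ℝ) ⁻¹' Set.Iic ε from
            not_le.2 h), mul_zero, zero_mul,
            zero_add, mul_one, ← mul_sub, mul_pow, Real.sq_sqrt ha, ← ENNReal.ofReal_coe_nnreal,
            ← ENNReal.ofReal_mul hc0, ← ENNReal.ofReal_mul (mul_nonneg hc0 ha)]
          refine ENNReal.ofReal_le_ofReal ?_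
          have := mul_le_mul_of_nonneg_left (hφ.sq_sub_le z z') ha
          linarith
        · rw [if_neg h, Set.indicator_of_mem (show a ∈ ((↑) : ℝ≥0 → ℝ) ⁻¹' Set.Iic ε from
            not_lt.1 h), mul_zero, zero_mul, sub_zero, mul_pow, Real.sq_sqrt ha]
          refine le_trans ?_ le_self_add
          rw [← ENNReal.ofReal_coe_nnreal, ← ENNReal.ofReal_mul hc0,
            ← ENNReal.ofReal_mul (mul_nonneg hc0 ha)]
          refine ENNReal.ofReal_le_ofReal ?_
          have := mul_le_mul_of_nonneg_left (hφ.sq_le z) ha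
          linarith)
      hl' (fun j hj => lintegral_sq_preact_le_supSecondMoment hφ hθ x (by omega) p hj)
      (fun j hj => by rw [← pruningError_eq]; exact ih (by omega) hj) hk
    refine this.trans ?_
    rw [lintegral_const_mul _ (hcm.indicator hms), lintegral_const_mul _ hcm,
      lintegral_indicator hms, mul_left_comm, mul_left_comm _ (ENNReal.ofReal c), ← meanSum_eq]
    change _ * (ENNReal.ofReal c * setMean (μ ⟨l, hl'⟩) (Set.Iic ε) (p ⟨l, hl'⟩) * _ + _) ≤ _
    have hsup : supSecondMoment din dout P θ φ x (l + 1) = ENNReal.ofReal (U (l + 1)) :=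
      (ENNReal.ofReal_toReal (supSecondMoment_lt_top hφ hθ x hC (by omega)).ne).symm
    have hE : 0 ≤ errBound (σv ^ 2 * c) κ M U l :=
      errBound_nonneg (mul_nonneg (sq_nonneg _) hc0) hκ hM hU0 l
    rw [hsup]
    calc _ ≤ ((σv ^ 2 : ℝ≥0) : ℝ≥0∞) * (ENNReal.ofReal c * ENNReal.ofReal κ
            * ENNReal.ofReal (U (l + 1)) + ENNReal.ofReal c * ENNReal.ofReal M
            * ENNReal.ofReal (errBound (σv ^ 2 * c) κ M U l)) := by
          gcongr
          · exact h1 _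
          · exact h2 _
      _ = _ := by
          rw [errBound_succ, ← ENNReal.ofReal_coe_nnreal, ← ENNReal.ofReal_mul hc0,
            ← ENNReal.ofReal_mul hc0, ← ENNReal.ofReal_mul (mul_nonneg hc0 hκ),
            ← ENNReal.ofReal_mul (mul_nonneg hc0 hM), ← ENNReal.ofReal_add
            (mul_nonneg (mul_nonneg hc0 hκ) (hU0 _)) (mul_nonneg (mul_nonneg hc0 hM) hE),
            ← ENNReal.ofReal_mul (NNReal.coe_nonneg _)]
          congr 1
          push_cast
          ring

include hφ hθ in
lemma limsup_pruningError_le {ρ : Measure ℝ} (hρ : IsLevyMeasure ρ)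
    (hμ : ∀ i, SumTendstoID (μ i) 0 ρ) (hUI : ∀ i, UI (μ i) 0 ρ) {α δ ε₀ : ℝ} (hη : α + δ < 1)
    (h : ∀ u, 0 < u → u < ε₀ → tail ρ u ≤ u ^ (-(α + δ))) {ε : ℝ} (hε : 0 < ε) (hεε : ε < ε₀)
    {l : ℕ} (hl : l ≤ L) {k : ℕ} (hk : l = L → k < dout) :
    limsup (fun p => pruningError din dout p (θ p) φ x (P p) ε (l + 1) k) atTop
      ≤ ENNReal.ofReal (pruningConst σv (cLip φ) (firstMoment ρ).toReal α δ
        (fun l' => (supSecondMoment din dout P θ φ x l').toReal) l * ε ^ (1 - (α + δ))) := by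
  obtain ⟨C, hC⟩ := exists_forall_meanSum_le hUI
  rw [pruningConst_mul_rpow]
  set κ := ε ^ (1 - (α + δ)) / (1 - (α + δ)) with hκ
  have hκ0 : 0 ≤ κ := div_nonneg (Real.rpow_nonneg hε.le _) (by linarith)
  set M := (firstMoment ρ).toReal with hM
  have hM0 : 0 ≤ M := ENNReal.toReal_nonneg
  have hlim := ENNReal.tendsto_ofReal (((continuous_errBound (σv ^ 2 * cLip φ ^ 2) κ M
    (fun l' => (supSecondMoment din dout P θ φ x l').toReal) l).tendsto 0).mono_left
      (nhdsWithin_le_nhds (s := Set.Ioi (0 : ℝ))))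
  rw [add_zero, add_zero] at hlim
  -- The slack `t > 0` makes the limits of the two coefficients strict, hence eventually valid at
  -- finite width; it is sent to `0` after the `limsup`.
  refine ge_of_tendsto hlim ?_
  filter_upwards [self_mem_nhdsWithin] with t ht
  rw [Set.mem_Ioi] at ht
  have e1 : ∀ᶠ p : Fin L → ℕ+ in atTop, ∀ i,
      setMean (μ i) (Set.Iic ε) (p i) ≤ ENNReal.ofReal (κ + t) :=
    eventually_all.2 fun i => (tendsto_apply_atTop i).eventually
      (eventually_setMean_le hρ (hUI i).firstMoment_lt_top (hμ i) hη h hε hεε (by linarith))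
  have e2 : ∀ᶠ p : Fin L → ℕ+ in atTop, ∀ i, meanSum (μ i) (p i) ≤ ENNReal.ofReal (M + t) := by
    refine eventually_all.2 fun i => (tendsto_apply_atTop i).eventually
      (p := fun n => meanSum (μ i) n ≤ ENNReal.ofReal (M + t)) ?_
    have h1 := (hUI i).tendsto_meanSum
    rw [ENNReal.coe_zero, zero_add] at h1
    have h2 : firstMoment ρ < ENNReal.ofReal (M + t) := by
      rw [← ENNReal.ofReal_toReal (hUI i).firstMoment_lt_top.ne]
      exact (ENNReal.ofReal_lt_ofReal_iff (by linarith)).2 (by linarith)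
    exact (h1.eventually_lt_const h2).mono fun n hn => hn.le
  refine limsup_le_of_le (by isBoundedDefault) ?_
  filter_upwards [e1, e2, eventually_lt_width din dout hl hk] with p h1 h2 h3
  exact pruningError_le_errBound hφ hθ x hC (by linarith) (by linarith) h1 h2 hl h3

end Family

/-! ### Networks whose weights take finitely many values -/

/-- A sum over words in `Option T` that only depends on the subword of letters in `T`. -/
lemma sum_option_words {T : Type*} [Fintype T] {n : ℕ} (f : (Fin n → Option T) → ℝ≥0∞)
    (a : ∀ k, (Fin k → T) → ℝ≥0∞)
    (h : ∀ k (e : Fin k → Fin n) (τ : Fin k → T), Function.Injective e →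
      f (Function.extend e (some ∘ τ) fun _ => none) = a k τ) :
    ∑ σ, f σ = ∑ k ∈ Finset.range (n + 1), n.choose k * ∑ τ, a k τ := by
  classical
  let supp : (Fin n → Option T) → Finset (Fin n) := fun σ => Finset.univ.filter fun j => σ j ≠ none
  -- Words are grouped by the positions of their letters. Each support of size `k` gives the same
  -- sum over `τ`, and there are `n.choose k` of them.
  rw [← Finset.sum_fiberwise (s := Finset.univ) (g := supp)]
  have hJ : ∀ J : Finset (Fin n), ∑ σ with supp σ = J, f σ = ∑ τ, a J.card τ := by
    intro J
    have he := (J.orderEmbOfFin rfl).injective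
    have hr : ∀ i, i ∈ Set.range (J.orderEmbOfFin rfl) ↔ i ∈ J := fun i => by
      rw [Finset.range_orderEmbOfFin]; rfl
    symm
    refine Finset.sum_nbij (fun τ => Function.extend (J.orderEmbOfFin rfl) (some ∘ τ) fun _ => none)
      ?_ ?_ ?_ (fun τ _ => (h _ _ τ he).symm)
    · intro τ _
      rw [Finset.mem_filter]
      refine ⟨Finset.mem_univ _, ?_⟩
      ext i
      simp only [supp, Finset.mem_filter, Finset.mem_univ, true_and]
      by_cases hi : i ∈ J
      · obtain ⟨j, rfl⟩ := (hr i).2 hi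
        simp [he.extend_apply, hi]
      · rw [Function.extend_apply' _ _ _ (fun hx => hi ((hr i).1 hx))]
        simp [hi]
    · intro τ _ τ' _ hτ
      ext1 j
      have := congrFun hτ (J.orderEmbOfFin rfl j)
      simpa [he.extend_apply] using this
    · intro σ hσ
      have hσ' : supp σ = J := (Finset.mem_filter.1 hσ).2
      have hne : ∀ i, σ i ≠ none ↔ i ∈ J := fun i => by rw [← hσ']; simp [supp]
      have hs : ∀ j, ∃ t, σ (J.orderEmbOfFin rfl j) = some t := fun j =>
        Option.ne_none_iff_exists'.1 ((hne _).2 (J.orderEmbOfFin_mem rfl j))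
      choose τ hτ using hs
      refine ⟨τ, Finset.mem_coe.2 (Finset.mem_univ _), ?_⟩
      ext1 i
      by_cases hi : i ∈ J
      · obtain ⟨j, rfl⟩ := (hr i).2 hi
        simp [he.extend_apply, hτ]
      · simp only
        rw [Function.extend_apply' _ _ _ (fun hx => hi ((hr i).1 hx))]
        by_contra hcon
        exact hi ((hne i).1 (Ne.symm hcon))
  simp_rw [hJ]
  have := Finset.sum_powerset_apply_card (fun k => ∑ τ, a k τ) (x := (Finset.univ : Finset (Fin n)))
  rw [Finset.powerset_univ, Finset.card_univ, Fintype.card_fin] at this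
  rw [this]
  simp [nsmul_eq_mul]

lemma prod_extend {T : Type*} {n k : ℕ} (q : Option T → ℝ≥0∞) {e : Fin k → Fin n}
    (he : Function.Injective e) (τ : Fin k → T) :
    ∏ i, q (Function.extend e (some ∘ τ) (fun _ => none) i)
      = q none ^ (n - k) * ∏ j, q (some (τ j)) := by
  classical
  rw [← Finset.prod_compl_mul_prod (Finset.univ.map ⟨e, he⟩)]
  congr 1
  · rw [Finset.prod_eq_pow_card (b := q none), Finset.card_compl, Finset.card_map]
    · simp
    · intro i hi
      rw [Function.extend_apply']
      rintro ⟨j, rfl⟩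
      simp at hi
  · rw [Finset.prod_map]
    refine Finset.prod_congr rfl fun j _ => ?_
    simp [he.extend_apply]

lemma measurable_typeWeight {T : Type*} [Finite T] {typ : ℝ≥0 → Option T}
    (htyp : ∀ o, MeasurableSet (typ ⁻¹' {o})) (wt : T → ℝ) : Measurable (typeWeight typ wt) := by
  intro s _
  have : typeWeight typ wt ⁻¹' s = ⋃ o ∈ {o : Option T | o.elim 0 wt ∈ s}, typ ⁻¹' {o} := by
    ext a
    simp [typeWeight]
  rw [this]
  exact MeasurableSet.biUnion (Set.to_countable _) fun o _ => htyp o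

/-- The pre-activations of two networks at the nodes `ι` of layer `l`. -/
noncomputable def netPair {L : ℕ} (din dout : ℕ+) (p : Fin L → ℕ+) {Ω : Type*} (θ : Params Ω)
    (φ : ℝ → ℝ) (x : Fin din → ℝ) (w w' : ℝ≥0 → ℝ) (l : ℕ) {κ : Type*} (ι : κ → ℕ) (ω : Ω) :
    κ → ℝ × ℝ :=
  fun i => (net din dout p θ φ x w l (ι i) ω, net din dout p θ φ x w' l (ι i) ω)

/-- The pre-activations of a layer as functions of those of the layer before, when the weights of
the nodes are `a` and `a'`. -/
def propagate {κ κ' : Type*} [Fintype κ] (φ : ℝ → ℝ) (a a' : κ → ℝ) (z : κ → ℝ × ℝ)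
    (W : Option κ × κ' → ℝ) : κ' → ℝ × ℝ :=
  fun i => (∑ j, a j * φ (z j).1 * W (some j, i) + W (none, i),
    ∑ j, a' j * φ (z j).2 * W (some j, i) + W (none, i))

/-- The mean of `F` over the Gaussian variables of one layer. -/
noncomputable def gaussMean {κ κ' : Type*} [Fintype κ] [Fintype κ'] (σb σv : ℝ≥0) (φ : ℝ → ℝ)
    (a a' : κ → ℝ) (F : (κ' → ℝ × ℝ) → ℝ≥0∞) (z : κ → ℝ × ℝ) : ℝ≥0∞ :=
  ∫⁻ W : Option κ × κ' → ℝ, F (propagate φ a a' z W)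
    ∂(Measure.pi fun q => gaussianReal 0 (edgeVar σb σv q.1))

lemma measurable_propagate {κ κ' : Type*} [Fintype κ] {φ : ℝ → ℝ} (hφ : Measurable φ)
    (a a' : κ → ℝ) : Measurable fun zW : (κ → ℝ × ℝ) × (Option κ × κ' → ℝ) =>
      propagate φ a a' zW.1 zW.2 := by
  unfold propagate
  fun_prop

lemma measurable_gaussMean {κ κ' : Type*} [Fintype κ] [Fintype κ'] (σb σv : ℝ≥0) {φ : ℝ → ℝ}
    (hφ : Measurable φ) (a a' : κ → ℝ) {F : (κ' → ℝ × ℝ) → ℝ≥0∞} (hF : Measurable F) :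
    Measurable (gaussMean σb σv φ a a' F) :=
  Measurable.lintegral_prod_right' (hF.comp (measurable_propagate hφ a a'))

/-- The squared Euclidean norm. -/
noncomputable def sqNorm {κ : Type*} [Fintype κ] (z : κ → ℝ × ℝ) : ℝ≥0∞ :=
  ∑ i, (ENNReal.ofReal ((z i).1 ^ 2) + ENNReal.ofReal ((z i).2 ^ 2))

lemma lintegral_sq_gaussian_row {κ κ' : Type*} [Fintype κ] [Fintype κ'] (σb σv : ℝ≥0)
    (c : κ → ℝ) (i : κ') :
    ∫⁻ W : Option κ × κ' → ℝ, ENNReal.ofReal ((∑ j, c j * W (some j, i) + W (none, i)) ^ 2)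
      ∂(Measure.pi fun q => gaussianReal 0 (edgeVar σb σv q.1))
    = ∑ j, ENNReal.ofReal (c j ^ 2) * (σv ^ 2 : ℝ≥0) + (σb ^ 2 : ℝ≥0) := by
  classical
  have := lintegral_sq_pi_gaussianReal (fun q : Option κ × κ' => edgeVar σb σv q.1)
    (fun q => if q.2 = i then q.1.elim 1 c else 0)
  simp only [Fintype.sum_prod_type, Fintype.sum_option, ite_mul, zero_mul, Finset.sum_ite_eq',
    Finset.mem_univ, if_true, Option.elim_none, Option.elim_some, one_mul, ite_pow, ne_eq,
    OfNat.ofNat_ne_zero, not_false_eq_true, zero_pow, apply_ite ENNReal.ofReal, one_pow,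
    ENNReal.ofReal_one, ENNReal.ofReal_zero, edgeVar] at this
  rw [add_comm (∑ j, _ * _), ← this]
  refine lintegral_congr fun W => ?_
  rw [add_comm (∑ j, _)]

/-- Averaging over one layer preserves quadratic growth. The new constant does not depend on the
number of nodes in `κ`, which is what later allows a sum over all numbers of retained nodes. -/
lemma gaussMean_le {κ κ' : Type*} [Fintype κ] [Fintype κ'] (σb σv : ℝ≥0) {φ : ℝ → ℝ}
    (hφ : PosHomogeneous φ) {A : ℝ} {a a' : κ → ℝ} (ha : ∀ j, a j ^ 2 ≤ A) (ha' : ∀ j, a' j ^ 2 ≤ A)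
    {F : (κ' → ℝ × ℝ) → ℝ≥0∞} {K : ℝ≥0} (hF : ∀ z, F z ≤ K * (1 + sqNorm z)) (z : κ → ℝ × ℝ) :
    gaussMean σb σv φ a a' F z ≤ (K * (1 + Fintype.card κ' * (2 * σb ^ 2
      + (A * cLip φ ^ 2).toNNReal * σv ^ 2)) : ℝ≥0) * (1 + sqNorm z) := by
  have hrow : ∀ (b : κ → ℝ) (y : κ → ℝ), (∀ j, b j ^ 2 ≤ A) → ∀ i : κ',
      ∫⁻ W : Option κ × κ' → ℝ,
        ENNReal.ofReal ((∑ j, b j * φ (y j) * W (some j, i) + W (none, i)) ^ 2)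
        ∂(Measure.pi fun q => gaussianReal 0 (edgeVar σb σv q.1))
      ≤ ((A * cLip φ ^ 2).toNNReal * σv ^ 2 : ℝ≥0) * ∑ j, ENNReal.ofReal (y j ^ 2)
        + (σb ^ 2 : ℝ≥0) := by
    intro b y hb i
    rw [lintegral_sq_gaussian_row, Finset.mul_sum]
    refine add_le_add_left (Finset.sum_le_sum fun j _ => ?_) _
    have hA : 0 ≤ A := (sq_nonneg _).trans (hb j)
    have hj : ENNReal.ofReal ((b j * φ (y j)) ^ 2)
        ≤ ENNReal.ofReal (A * cLip φ ^ 2) * ENNReal.ofReal (y j ^ 2) := by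
      rw [← ENNReal.ofReal_mul (mul_nonneg hA (sq_nonneg _)), mul_pow, mul_assoc]
      exact ENNReal.ofReal_le_ofReal
        (mul_le_mul (hb j) (hφ.sq_le _) (sq_nonneg _) hA)
    rw [ENNReal.coe_mul, mul_right_comm]
    exact mul_le_mul_left hj _
  have hm : Measurable fun W : Option κ × κ' → ℝ => propagate φ a a' z W :=
    (measurable_propagate hφ.measurable a a').comp measurable_prodMk_left
  set B : ℝ≥0∞ := (((A * cLip φ ^ 2).toNNReal * σv ^ 2 : ℝ≥0) : ℝ≥0∞) with hB
  calc gaussMean σb σv φ a a' F z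
      ≤ ∫⁻ W : Option κ × κ' → ℝ, K * (1 + sqNorm (propagate φ a a' z W))
        ∂(Measure.pi fun q => gaussianReal 0 (edgeVar σb σv q.1)) := lintegral_mono fun W => hF _
    _ = K * (1 + ∑ i, ((∫⁻ W : Option κ × κ' → ℝ, ENNReal.ofReal ((propagate φ a a' z W i).1 ^ 2)
        ∂(Measure.pi fun q => gaussianReal 0 (edgeVar σb σv q.1)))
        + ∫⁻ W : Option κ × κ' → ℝ, ENNReal.ofReal ((propagate φ a a' z W i).2 ^ 2)
        ∂(Measure.pi fun q => gaussianReal 0 (edgeVar σb σv q.1)))) := by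
        rw [lintegral_const_mul' _ _ ENNReal.coe_ne_top, lintegral_add_left measurable_const,
          lintegral_const, measure_univ, mul_one]
        unfold sqNorm
        rw [lintegral_finsetSum _ fun i _ => by fun_prop]
        congr 2
        refine Finset.sum_congr rfl fun i _ => ?_
        rw [lintegral_add_left (by fun_prop)]
    _ ≤ K * (1 + ∑ _i : κ', ((B * ∑ j, ENNReal.ofReal ((z j).1 ^ 2) + (σb ^ 2 : ℝ≥0))
        + (B * ∑ j, ENNReal.ofReal ((z j).2 ^ 2) + (σb ^ 2 : ℝ≥0)))) := by
        gcongr with i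
        · exact hrow a (fun j => (z j).1) ha i
        · exact hrow a' (fun j => (z j).2) ha' i
    _ = K * (1 + Fintype.card κ' * (2 * (σb ^ 2 : ℝ≥0) + B * sqNorm z)) := by
        rw [Finset.sum_const, Finset.card_univ, nsmul_eq_mul, sqNorm, Finset.sum_add_distrib]
        ring
    _ ≤ K * ((1 + Fintype.card κ' * (2 * (σb ^ 2 : ℝ≥0) + B)) * (1 + sqNorm z)) := by
        gcongr
        rw [show (1 + Fintype.card κ' * (2 * ((σb ^ 2 : ℝ≥0) : ℝ≥0∞) + B)) * (1 + sqNorm z)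
          = (1 + Fintype.card κ' * (2 * (σb ^ 2 : ℝ≥0) + B * sqNorm z))
            + (sqNorm z + Fintype.card κ' * (B + 2 * (σb ^ 2 : ℝ≥0) * sqNorm z)) by ring]
        exact le_self_add
    _ = _ := by
        rw [hB, ← mul_assoc]
        push_cast
        rfl

/-- Conditioning on the types of independent, identically distributed weights. -/
lemma lintegral_eq_sum_types {Ω : Type*} [MeasurableSpace Ω] {P : Measure Ω} {J T : Type*}
    [Fintype J] [DecidableEq J] [Fintype T] {typ : ℝ≥0 → Option T}
    (htyp : ∀ o, MeasurableSet (typ ⁻¹' {o})) {Λ : Ω → J → ℝ≥0} (hΛ : Measurable Λ)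
    {ν : Measure ℝ≥0} [SigmaFinite ν] (hν : P.map Λ = Measure.pi fun _ => ν)
    {G : (J → Option T) → Ω → ℝ≥0∞} (hG : ∀ σ, Measurable (G σ))
    (hind : ∀ σ, IndepFun Λ (G σ) P) :
    ∫⁻ ω, G (fun j => typ (Λ ω j)) ω ∂P
      = ∑ σ : J → Option T, (∏ j, ν (typ ⁻¹' {σ j})) * ∫⁻ ω, G σ ω ∂P := by
  classical
  set S : (J → Option T) → Set (J → ℝ≥0) := fun σ => Set.pi Set.univ fun j => typ ⁻¹' {σ j}
    with hS
  have hSm : ∀ σ, MeasurableSet (S σ) := fun σ => MeasurableSet.univ_pi fun j => htyp _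
  have hmem : ∀ σ v, v ∈ S σ ↔ (fun j => typ (v j)) = σ := fun σ v => by
    simp [S, funext_iff]
  have hpt : ∀ ω, G (fun j => typ (Λ ω j)) ω
      = ∑ σ, (S σ).indicator (1 : (J → ℝ≥0) → ℝ≥0∞) (Λ ω) * G σ ω := by
    intro ω
    rw [Finset.sum_eq_single (fun j => typ (Λ ω j))]
    · rw [Set.indicator_of_mem ((hmem _ _).2 rfl), Pi.one_apply, one_mul]
    · intro σ _ hσ
      rw [Set.indicator_of_notMem (fun hx => hσ ((hmem _ _).1 hx).symm), zero_mul]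
    · intro hx; exact absurd (Finset.mem_univ _) hx
  have hI : ∀ σ, Measurable ((S σ).indicator (1 : (J → ℝ≥0) → ℝ≥0∞)) := fun σ =>
    measurable_one.indicator (hSm σ)
  have hIΛ : ∀ σ, Measurable fun ω => (S σ).indicator (1 : (J → ℝ≥0) → ℝ≥0∞) (Λ ω) := fun σ =>
    (hI σ).comp hΛ
  rw [lintegral_congr hpt, lintegral_finsetSum _ fun σ _ => (hIΛ σ).fun_mul (hG σ)]
  refine Finset.sum_congr rfl fun σ _ => ?_
  have h1 := lintegral_mul_eq_lintegral_mul_lintegral_of_indepFun (hIΛ σ) (hG σ)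
    ((hind σ).comp (hI σ) measurable_id)
  refine h1.trans ?_
  congr 1
  rw [← lintegral_map (hI σ) hΛ, lintegral_indicator_one (hSm σ), hν, Measure.pi_pi]

namespace IsMoGP

variable {L : ℕ} {din dout : ℕ+} {σb σv : ℝ≥0} {μ : Fin L → ℕ+ → ProbabilityMeasure ℝ≥0}
  {p : Fin L → ℕ+} {Ω : Type*} [MeasurableSpace Ω] {P : Measure Ω} [IsProbabilityMeasure P]
  {θ : Params Ω} (h : IsMoGP din dout σb σv μ p P θ)
  {φ : ℝ → ℝ} (hφ : Measurable φ) (x : Fin din → ℝ)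

omit [MeasurableSpace Ω] in
include hφ in
lemma measurable_netPair_rankAlgebra {w w' : ℝ≥0 → ℝ} (hw : Measurable w) (hw' : Measurable w')
    {S : Set ℕ} {l : ℕ} (hl : l ≤ L + 1) (hS : Set.Iic (2 * l) ⊆ S) {κ : Type*} {ι : κ → ℕ}
    (hι : ∀ i, ι i < width din dout p l) :
    Measurable[rankAlgebra din dout p θ S] (netPair din dout p θ φ x w w' l ι) := by
  refine @measurable_pi_lambda _ _ _ (rankAlgebra din dout p θ _) _ _ fun i => ?_
  exact Measurable.prodMk (measurable_net_rankAlgebra hφ hw hl hS (hι i))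
    (measurable_net_rankAlgebra hφ hw' hl hS (hι i))

include h hφ

lemma lintegral_propagate {w w' : ℝ≥0 → ℝ} (hw : Measurable w) (hw' : Measurable w')
    {l : ℕ} (hl : l ≤ L) {κ κ' : Type*} [Fintype κ] [Fintype κ'] {e : κ → ℕ} {ι : κ' → ℕ}
    (he : ∀ j, e j < width din dout p l) (hι : ∀ i, ι i < width din dout p (l + 1))
    (he' : Function.Injective e) (hι' : Function.Injective ι) (a a' : κ → ℝ)
    {F : (κ' → ℝ × ℝ) → ℝ≥0∞} (hF : Measurable F) :
    ∫⁻ ω, F (propagate φ a a' (netPair din dout p θ φ x w w' l e ω) (θ.edge (l + 1) e ι ω)) ∂P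
      = ∫⁻ ω, gaussMean σb σv φ a a' F (netPair din dout p θ φ x w w' l e ω) ∂P := by
  have hX := measurable_netPair_rankAlgebra (θ := θ) hφ x hw hw' (by omega : l ≤ L + 1)
    subset_rfl he
  have hW := measurable_edge_rankAlgebra (θ := θ) (by omega : 1 ≤ l + 1) (by omega)
    (Set.mem_singleton (2 * (l + 1))) he hι
  have hdis : Disjoint (Set.Iic (2 * l)) {2 * (l + 1)} := by simp
  rw [lintegral_of_indepFun (hX.mono (h.rankAlgebra_le _) le_rfl)
    (hW.mono (h.rankAlgebra_le _) le_rfl) (h.indepFun_of_rank hdis hX hW)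
    (F := fun zW => F (propagate φ a a' zW.1 zW.2)) (hF.comp (measurable_propagate hφ a a')),
    h.map_edge (by omega) (by omega) he hι he' hι']
  rfl

/-- Conditioning on the types of the nodes. -/
lemma lintegral_netPair_eq_sum {T : Type*} [Fintype T] {typ : ℝ≥0 → Option T}
    (htyp : ∀ o, MeasurableSet (typ ⁻¹' {o})) (wt wt' : T → ℝ) {l : ℕ} (hl : l < L)
    {κ' : Type*} [Fintype κ'] {ι : κ' → ℕ} (hι : ∀ i, ι i < width din dout p (l + 2))
    {F : (κ' → ℝ × ℝ) → ℝ≥0∞} (hF : Measurable F) :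
    ∫⁻ ω, F (netPair din dout p θ φ x (typeWeight typ wt) (typeWeight typ wt') (l + 2) ι ω) ∂P
      = ∑ σ : Fin (p ⟨l, hl⟩) → Option T,
        (∏ j, (μ ⟨l, hl⟩ (p ⟨l, hl⟩) : Measure ℝ≥0) (typ ⁻¹' {σ j}))
        * ∫⁻ ω, F (propagate φ (fun j => (σ j).elim 0 wt) (fun j => (σ j).elim 0 wt')
          (netPair din dout p θ φ x (typeWeight typ wt) (typeWeight typ wt') (l + 1)
            (fun j : Fin (p ⟨l, hl⟩) => (j : ℕ)) ω)
          (θ.edge (l + 2) (fun j : Fin (p ⟨l, hl⟩) => (j : ℕ)) ι ω)) ∂P := by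
  classical
  have hw := measurable_typeWeight htyp wt
  have hw' := measurable_typeWeight htyp wt'
  have he : ∀ j : Fin (p ⟨l, hl⟩), (j : ℕ) < width din dout p (l + 1) := fun j => by
    rw [width_succ _ _ _ hl]; exact j.2
  have hlam : Measurable[rankAlgebra din dout p θ {2 * (l + 1) + 1}]
      (fun ω (j : Fin (p ⟨l, hl⟩)) => θ.lam (l + 1) j ω) :=
    @measurable_pi_lambda _ _ _ (rankAlgebra din dout p θ _) _ _ fun j =>
      measurable_lam_rankAlgebra ⟨by omega, hl, he j⟩ (Set.mem_singleton _)
  have hX : Measurable[rankAlgebra din dout p θ {2 * (l + 1) + 1}ᶜ]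
      (netPair din dout p θ φ x (typeWeight typ wt) (typeWeight typ wt') (l + 1)
        (fun j : Fin (p ⟨l, hl⟩) => (j : ℕ))) := by
    refine measurable_netPair_rankAlgebra hφ x hw hw' (by omega) (fun i hi => ?_) he
    rw [Set.mem_compl_iff, Set.mem_singleton_iff]
    have := Set.mem_Iic.1 hi
    omega
  have hW : Measurable[rankAlgebra din dout p θ {2 * (l + 1) + 1}ᶜ]
      (θ.edge (l + 2) (fun j : Fin (p ⟨l, hl⟩) => (j : ℕ)) ι) := by
    refine measurable_edge_rankAlgebra (by omega) (by omega) ?_ he hι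
    rw [Set.mem_compl_iff, Set.mem_singleton_iff]
    omega
  have hG := fun σ : Fin (p ⟨l, hl⟩) → Option T =>
    (hF.comp (measurable_propagate hφ (fun j => (σ j).elim 0 wt)
      (fun j => (σ j).elim 0 wt'))).comp (hX.prodMk hW)
  have key := lintegral_eq_sum_types htyp (hlam.mono (h.rankAlgebra_le _) le_rfl) (h.map_lam hl)
    (fun σ => (hG σ).mono (h.rankAlgebra_le _) le_rfl)
    (fun σ => h.indepFun_of_rank disjoint_compl_right hlam (hG σ))
  refine Eq.trans (lintegral_congr fun ω => ?_) key
  refine congrArg F (funext fun i => ?_)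
  rw [netPair, net_add_two x φ _ hl, net_add_two x φ _ hl]
  rfl

omit hφ in
-- The first layer is read as a propagation with identity activation from constant values `1`, the
-- inputs being the coefficients. The result no longer involves the widths, which starts the
-- induction on the layers.
lemma lintegral_netPair_one (w w' : ℝ≥0 → ℝ) {κ' : Type*} [Fintype κ']
    {ι : κ' → ℕ} (hι : ∀ i, ι i < width din dout p 1) (hι' : Function.Injective ι)
    {F : (κ' → ℝ × ℝ) → ℝ≥0∞} (hF : Measurable F) :
    ∫⁻ ω, F (netPair din dout p θ φ x w w' 1 ι ω) ∂P
      = gaussMean σb σv (fun y => y) (fun j => Real.sqrt (1 / (din : ℕ)) * x j)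
        (fun j => Real.sqrt (1 / (din : ℕ)) * x j) F (fun _ => (1, 1)) := by
  have he : ∀ j : Fin din, (j : ℕ) < width din dout p (1 - 1) := fun j => j.2
  have hW := (measurable_edge_rankAlgebra (θ := θ) le_rfl (by omega)
    (Set.mem_univ (2 * 1)) he hι).mono (h.rankAlgebra_le _) le_rfl
  rw [gaussMean, ← h.map_edge le_rfl (by omega) he hι Fin.val_injective hι',
    lintegral_map (f := fun W => F (propagate (fun y => y)
      (fun j => Real.sqrt (1 / (din : ℕ)) * x j) (fun j => Real.sqrt (1 / (din : ℕ)) * x j)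
      (fun _ => (1, 1)) W)) (hF.comp ((measurable_propagate measurable_id' _ _).comp
      measurable_prodMk_left)) hW]
  refine lintegral_congr fun ω => ?_
  congr 1
  ext1 i
  simp only [netPair, net, firstPreact, propagate, Params.edge, Option.elim_none,
    Option.elim_some, mul_one, mul_right_comm]

/-- Exchangeability of the nodes of a layer: given the layer below, distinct nodes see independent,
identically distributed edges, so only the number of nodes matters. -/
lemma lintegral_netPair_eq_of_injective {T : Type*} [Fintype T] {typ : ℝ≥0 → Option T}
    (htyp : ∀ o, MeasurableSet (typ ⁻¹' {o})) (wt wt' : T → ℝ) {l : ℕ} (hl : l ≤ L)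
    {κ' : Type*} [Fintype κ'] {ι ι' : κ' → ℕ} (hι : ∀ i, ι i < width din dout p (l + 1))
    (hι' : ∀ i, ι' i < width din dout p (l + 1)) (hi : Function.Injective ι)
    (hi' : Function.Injective ι') {F : (κ' → ℝ × ℝ) → ℝ≥0∞} (hF : Measurable F) :
    ∫⁻ ω, F (netPair din dout p θ φ x (typeWeight typ wt) (typeWeight typ wt') (l + 1) ι ω) ∂P
      = ∫⁻ ω, F (netPair din dout p θ φ x (typeWeight typ wt) (typeWeight typ wt')
        (l + 1) ι' ω) ∂P := by
  cases l with
  | zero => rw [h.lintegral_netPair_one x _ _ hι hi hF, h.lintegral_netPair_one x _ _ hι' hi' hF]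
  | succ l =>
    have hw := measurable_typeWeight htyp wt
    have hw' := measurable_typeWeight htyp wt'
    have he : ∀ j : Fin (p ⟨l, hl⟩), (j : ℕ) < width din dout p (l + 1) := fun j => by
      rw [width_succ _ _ _ hl]; exact j.2
    rw [h.lintegral_netPair_eq_sum hφ x htyp wt wt' hl hι hF,
      h.lintegral_netPair_eq_sum hφ x htyp wt wt' hl hι' hF]
    refine Finset.sum_congr rfl fun σ _ => ?_
    rw [h.lintegral_propagate hφ x hw hw' hl he hι Fin.val_injective hi _ _ hF,
      h.lintegral_propagate hφ x hw hw' hl he hι' Fin.val_injective hi' _ _ hF]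

/-- The recursion from layer to layer: the number of retained nodes is binomial. -/
lemma lintegral_netPair_eq_sum_choose {T : Type*} [Fintype T] {typ : ℝ≥0 → Option T}
    (htyp : ∀ o, MeasurableSet (typ ⁻¹' {o})) (wt wt' : T → ℝ) {l : ℕ} (hl : l < L)
    {κ' : Type*} [Fintype κ'] {ι : κ' → ℕ} (hι : ∀ i, ι i < width din dout p (l + 2))
    (hi : Function.Injective ι) {F : (κ' → ℝ × ℝ) → ℝ≥0∞} (hF : Measurable F) :
    ∫⁻ ω, F (netPair din dout p θ φ x (typeWeight typ wt) (typeWeight typ wt') (l + 2) ι ω) ∂P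
      = ∑ k ∈ Finset.range (p ⟨l, hl⟩ + 1), (p ⟨l, hl⟩ : ℕ).choose k * ∑ τ : Fin k → T,
        ((μ ⟨l, hl⟩ (p ⟨l, hl⟩) : Measure ℝ≥0) (typ ⁻¹' {none}) ^ ((p ⟨l, hl⟩ : ℕ) - k)
          * ∏ j, (μ ⟨l, hl⟩ (p ⟨l, hl⟩) : Measure ℝ≥0) (typ ⁻¹' {some (τ j)}))
        * ∫⁻ ω, gaussMean σb σv φ (fun j => wt (τ j)) (fun j => wt' (τ j)) F
          (netPair din dout p θ φ x (typeWeight typ wt) (typeWeight typ wt') (l + 1)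
            (fun j : Fin k => (j : ℕ)) ω) ∂P := by
  rw [h.lintegral_netPair_eq_sum hφ x htyp wt wt' hl hι hF]
  have hw := measurable_typeWeight htyp wt
  have hw' := measurable_typeWeight htyp wt'
  refine sum_option_words _ _ fun k e τ he => ?_
  have hk : k ≤ p ⟨l, hl⟩ := by simpa using Fintype.card_le_of_injective e he
  have hlt : ∀ j, ((e j : ℕ)) < width din dout p (l + 1) := fun j => by
    rw [width_succ _ _ _ hl]; exact (e j).2
  have hlt' : ∀ j : Fin k, (j : ℕ) < width din dout p (l + 1) := fun j => by
    rw [width_succ _ _ _ hl]; exact j.2.trans_le hk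
  rw [prod_extend (fun o => (μ ⟨l, hl⟩ (p ⟨l, hl⟩) : Measure ℝ≥0) (typ ⁻¹' {o})) he τ]
  congr 1
  -- Discarded nodes have weight `0` and drop out of the propagation; by exchangeability the
  -- retained ones may be taken to be the first `k`.
  rw [← h.lintegral_netPair_eq_of_injective hφ x htyp wt wt' hl.le hlt hlt'
      (Fin.val_injective.comp he) Fin.val_injective (measurable_gaussMean σb σv hφ _ _ hF),
    ← h.lintegral_propagate hφ x hw hw' hl hlt hι (Fin.val_injective.comp he) hi _ _ hF]
  refine lintegral_congr fun ω => ?_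
  congr 1
  ext1 i
  have key : ∀ (v : T → ℝ) (y : Fin (p ⟨l, hl⟩) → ℝ),
      ∑ j, ((Function.extend e (some ∘ τ) (fun _ => none) j).elim 0 v) * y j
        * θ.edge (l + 2) (fun j : Fin (p ⟨l, hl⟩) => (j : ℕ)) ι ω (some j, i)
      = ∑ j, v (τ j) * y (e j) * θ.edge (l + 2) (fun j => (e j : ℕ)) ι ω (some j, i) := by
    intro v y
    symm
    refine Fintype.sum_of_injective e he _ _ (fun j hj => ?_) (fun j => ?_)
    · rw [Function.extend_apply' _ _ _ hj, Option.elim_none, zero_mul, zero_mul]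
    · rw [he.extend_apply]
      rfl
  simp only [propagate]
  exact Prod.ext
    (congrArg₂ (· + ·) (key wt fun j => φ (net din dout p θ φ x (typeWeight typ wt) (l + 1) j ω)) rfl)
    (congrArg₂ (· + ·) (key wt' fun j => φ (net din dout p θ φ x (typeWeight typ wt') (l + 1) j ω)) rfl)

end IsMoGP

/-! ### Convergence for networks whose weights take finitely many values -/

lemma tendsto_natCast_pnat_atTop : Tendsto (fun n : ℕ+ => (n : ℕ)) atTop atTop :=
  tendsto_natCast_atTop_iff.1 pnat_coe_tendsto_atTop

/-- The exponent `n` gives `exp (-R)`; lowering it by the fixed `k` divides by `(1 - s n) ^ k`,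
which tends to `1`. -/
lemma tendsto_one_sub_pow_pnat {s : ℕ+ → ℝ} {R : ℝ}
    (hs : Tendsto (fun n : ℕ+ => (n : ℝ) * s n) atTop (𝓝 R)) (k : ℕ) :
    Tendsto (fun n : ℕ+ => (1 - s n) ^ ((n : ℕ) - k)) atTop (𝓝 (Real.exp (-R))) := by
  have ht : Tendsto Nat.toPNat' atTop atTop := tendsto_atTop.2 fun b => by
    filter_upwards [eventually_ge_atTop (b : ℕ)] with n hn
    rw [← PNat.coe_le_coe, Nat.toPNat'_coe, if_pos (b.pos.trans_le hn)]
    exact hn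
  have hs' : Tendsto (fun n : ℕ => (n : ℝ) * s n.toPNat') atTop (𝓝 R) := by
    refine (hs.comp ht).congr' ?_
    filter_upwards [eventually_gt_atTop 0] with n hn
    simp [PNat.toPNat'_coe hn]
  have h0 := tendsto_choose_mul_pow_of_tendsto_mul_atTop (k := 0) hs'
  simp only [Nat.choose_zero_right, Nat.cast_one, pow_zero, mul_one, one_mul, tsub_zero,
    Nat.factorial_zero, div_one] at h0
  have h1 := h0.comp tendsto_natCast_pnat_atTop
  simp only [Function.comp_def, PNat.coe_toPNat'] at h1
  have hz : Tendsto s atTop (𝓝 0) := by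
    have := hs.mul (tendsto_inv_atTop_zero.comp pnat_coe_tendsto_atTop)
    rw [mul_zero] at this
    refine this.congr fun n => ?_
    have : (n : ℝ) ≠ 0 := by positivity
    simp only [Function.comp]
    field_simp
  have h2 : Tendsto (fun n => ((1 - s n) ^ k)⁻¹) atTop (𝓝 1) := by
    have := ((tendsto_const_nhds.sub hz).pow k).inv₀ (a := (1 - 0 : ℝ) ^ k) (by simp)
    simpa using this
  have h3 := h1.mul h2
  rw [mul_one] at h3
  refine h3.congr' ?_
  filter_upwards [tendsto_natCast_pnat_atTop.eventually_ge_atTop k,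
    hz.eventually (Iio_mem_nhds one_pos)] with n hn hs1
  rw [pow_sub₀ _ (sub_pos.2 hs1).ne' hn]

/-- The Poisson limit with several types: `n.choose k / n ^ k → 1 / k!`, and the factor `n ^ k` is
distributed over the `k` probabilities. -/
lemma tendsto_choose_mul_prod {k : ℕ} {q : ℕ+ → Fin k → ℝ} {s : ℕ+ → ℝ} {r : Fin k → ℝ} {R : ℝ}
    (hq : ∀ j, Tendsto (fun n : ℕ+ => (n : ℝ) * q n j) atTop (𝓝 (r j)))
    (hs : Tendsto (fun n : ℕ+ => (n : ℝ) * s n) atTop (𝓝 R)) :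
    Tendsto (fun n : ℕ+ => ((n : ℕ).choose k : ℝ) * ((1 - s n) ^ ((n : ℕ) - k) * ∏ j, q n j))
      atTop (𝓝 (1 ^ k / k.factorial * (Real.exp (-R) * ∏ j, r j))) := by
  have h1 : Tendsto (fun n : ℕ => (n.choose k : ℝ) * (1 / (n : ℝ)) ^ k) atTop
      (𝓝 (1 ^ k / k.factorial)) := by
    refine tendsto_choose_mul_pow_atTop k (tendsto_const_nhds.congr' ?_)
    filter_upwards [eventually_gt_atTop 0] with n hn
    field_simp
  refine ((h1.comp tendsto_natCast_pnat_atTop).mul ((tendsto_one_sub_pow_pnat hs k).mul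
    (tendsto_finsetProd Finset.univ fun j _ => hq j))).congr fun n => ?_
  have hn : (n : ℝ) ≠ 0 := by positivity
  simp only [Function.comp, Finset.prod_mul_distrib, Finset.prod_const, Finset.card_univ,
    Fintype.card_fin]
  rw [div_pow, one_pow]
  field_simp

section Types

variable {T : Type*} [Fintype T] {typ : ℝ≥0 → Option T} (htyp : ∀ o, MeasurableSet (typ ⁻¹' {o}))
include htyp

lemma sum_measure_types (ν : Measure ℝ≥0) [IsProbabilityMeasure ν] :
    ν (typ ⁻¹' {none}) + ∑ t, ν (typ ⁻¹' {some t}) = 1 := by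
  classical
  have : ∑ o : Option T, ν (typ ⁻¹' {o}) = 1 := by
    rw [← measure_biUnion_finset (fun a _ b _ hab => ?_) fun o _ => htyp o]
    · rw [← measure_univ (μ := ν)]
      congr 1
      ext a
      simp
    · exact Disjoint.preimage _ (by simpa using hab)
  rwa [Fintype.sum_option] at this

/-- The limit law of the types of the retained nodes. -/
lemma exists_tendsto_choose_mul_types {μ : ℕ+ → ProbabilityMeasure ℝ≥0}
    (hr : ∀ t, ∃ r, Tendsto (fun n : ℕ+ => (n : ℝ) * (μ n : Measure ℝ≥0).real (typ ⁻¹' {some t}))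
      atTop (𝓝 r)) {k : ℕ} (τ : Fin k → T) :
    ∃ c : ℝ≥0, Tendsto (fun n : ℕ+ => ((n : ℕ).choose k : ℝ≥0∞)
      * ((μ n : Measure ℝ≥0) (typ ⁻¹' {none}) ^ ((n : ℕ) - k)
        * ∏ j, (μ n : Measure ℝ≥0) (typ ⁻¹' {some (τ j)}))) atTop (𝓝 c) := by
  choose r hr using hr
  have hs := tendsto_finsetSum Finset.univ fun t (_ : t ∈ Finset.univ) => hr t
  simp_rw [← Finset.mul_sum] at hs
  have h := ENNReal.tendsto_ofReal (tendsto_choose_mul_prod (fun j => hr (τ j)) hs)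
  refine ⟨_, h.congr fun n => ?_⟩
  have hnone : 1 - ∑ t, (μ n : Measure ℝ≥0).real (typ ⁻¹' {some t})
      = (μ n : Measure ℝ≥0).real (typ ⁻¹' {none}) := by
    have := congrArg ENNReal.toReal (sum_measure_types htyp (μ n : Measure ℝ≥0))
    rw [ENNReal.toReal_add (by finiteness) (ENNReal.sum_ne_top.2 fun t _ => by finiteness),
      ENNReal.toReal_sum fun t _ => by finiteness, ENNReal.toReal_one] at this
    simp only [Measure.real]
    linarith
  rw [hnone, ENNReal.ofReal_mul (by positivity), ENNReal.ofReal_mul (by positivity),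
    ENNReal.ofReal_natCast, ENNReal.ofReal_pow measureReal_nonneg,
    ENNReal.ofReal_prod_of_nonneg fun j _ => measureReal_nonneg]
  simp

omit htyp in
-- The sum over words of a product is a `k`-th power, and `n.choose k ≤ n ^ k / k!`. This is the
-- domination of the number of retained nodes by an exponential series.
lemma choose_mul_sum_types_le (ν : Measure ℝ≥0) [IsProbabilityMeasure ν] (n k : ℕ) :
    (n.choose k : ℝ≥0∞) * ∑ τ : Fin k → T, (ν (typ ⁻¹' {none}) ^ (n - k)
      * ∏ j, ν (typ ⁻¹' {some (τ j)}))
      ≤ (n * ∑ t, ν (typ ⁻¹' {some t})) ^ k / k.factorial := by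
  rw [← Finset.mul_sum, ← Fintype.sum_pow (fun t => ν (typ ⁻¹' {some t})) k]
  have h1 : ν (typ ⁻¹' {none}) ^ (n - k) ≤ 1 := pow_le_one₀ zero_le prob_le_one
  have h2 : (n.choose k : ℝ≥0∞) ≤ n ^ k / k.factorial := by
    rw [ENNReal.le_div_iff_mul_le (by simp [Nat.factorial_ne_zero]) (by simp)]
    have := Nat.descFactorial_le_pow n k
    rw [Nat.descFactorial_eq_factorial_mul_choose, mul_comm] at this
    exact_mod_cast this
  calc _ ≤ (n ^ k / k.factorial : ℝ≥0∞) * (1 * (∑ t, ν (typ ⁻¹' {some t})) ^ k) := by gcongr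
    _ = _ := by rw [one_mul, mul_pow, div_eq_mul_inv, div_eq_mul_inv, mul_right_comm]

omit htyp in
lemma exists_forall_eventually_mul_sum_le {μ : ℕ+ → ProbabilityMeasure ℝ≥0}
    (hr : ∀ t, ∃ r, Tendsto (fun n : ℕ+ => (n : ℝ) * (μ n : Measure ℝ≥0).real (typ ⁻¹' {some t}))
      atTop (𝓝 r)) :
    ∃ S : ℝ≥0, ∀ᶠ n : ℕ+ in atTop,
      ((n : ℕ) : ℝ≥0∞) * ∑ t, (μ n : Measure ℝ≥0) (typ ⁻¹' {some t}) ≤ S := by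
  choose r hr using hr
  have hs := tendsto_finsetSum Finset.univ fun t (_ : t ∈ Finset.univ) => hr t
  simp_rw [← Finset.mul_sum] at hs
  refine ⟨(∑ t, r t + 1).toNNReal, ?_⟩
  filter_upwards [hs.eventually (Iio_mem_nhds (lt_add_one _))] with n hn
  refine le_trans (le_of_eq ?_) (ENNReal.ofReal_le_ofReal hn.le)
  rw [ENNReal.ofReal_mul (by positivity), ENNReal.ofReal_natCast,
    ENNReal.ofReal_sum_of_nonneg fun j _ => measureReal_nonneg]
  simp

end Types

lemma tendsto_tsum_of_dominated {β : Type*} {l : Filter β} [l.IsCountablyGenerated]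
    {f : β → ℕ → ℝ≥0∞} {g bound : ℕ → ℝ≥0∞} (hbound : ∑' k, bound k ≠ ⊤)
    (hf : ∀ᶠ b in l, ∀ k, f b k ≤ bound k) (hlim : ∀ k, Tendsto (fun b => f b k) l (𝓝 (g k))) :
    Tendsto (fun b => ∑' k, f b k) l (𝓝 (∑' k, g k)) := by
  simp_rw [← lintegral_count]
  refine tendsto_lintegral_filter_of_dominated_convergence bound
    (Eventually.of_forall fun _ => .of_discrete)
    (hf.mono fun b hb => Eventually.of_forall hb) ?_ (Eventually.of_forall hlim)
  rwa [lintegral_count]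

/-- By `k ≤ 2 ^ k` and `1 ≤ 2 ^ k`, the series is at most a multiple of the exponential series at `2
S`. -/
lemma tsum_pow_div_factorial_mul_ne_top (K M S : ℝ≥0) :
    ∑' k : ℕ, (S : ℝ≥0∞) ^ k / k.factorial * (K * (1 + k * M)) ≠ ⊤ := by
  have h1 : Summable fun k : ℕ => ((2 * S) ^ k / k.factorial * (K * (1 + M)) : ℝ≥0) := by
    refine Summable.mul_right _ ?_
    rw [← NNReal.summable_coe]
    push_cast
    exact Real.summable_pow_div_factorial (2 * S : ℝ)
  refine ne_top_of_le_ne_top (ENNReal.tsum_coe_ne_top_iff_summable.2 h1)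
    (ENNReal.tsum_le_tsum fun k => ?_)
  rw [← ENNReal.coe_natCast k.factorial, ← ENNReal.coe_pow,
    ← ENNReal.coe_div (Nat.cast_ne_zero.2 k.factorial_ne_zero), ← ENNReal.coe_natCast k,
    ← ENNReal.coe_one]
  norm_cast
  have h2 : (k : ℝ≥0) ≤ 2 ^ k := by exact_mod_cast Nat.lt_two_pow_self.le
  have h3 : (1 : ℝ≥0) ≤ 2 ^ k := one_le_pow₀ one_le_two
  calc S ^ k / k.factorial * (K * (1 + k * M))
      ≤ S ^ k / k.factorial * (K * (2 ^ k + 2 ^ k * M)) := by gcongr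
    _ = _ := by rw [mul_pow]; ring

section Limit

variable {L : ℕ} {din dout : ℕ+} {σb σv : ℝ≥0} {φ : ℝ → ℝ} (hφ : PosHomogeneous φ)
  {μ : Fin L → ℕ+ → ProbabilityMeasure ℝ≥0}
  {Ω : (Fin L → ℕ+) → Type*} [∀ p, MeasurableSpace (Ω p)]
  {P : ∀ p, Measure (Ω p)} [∀ p, IsProbabilityMeasure (P p)] {θ : ∀ p, Params (Ω p)}
  (hθ : ∀ p, IsMoGP din dout σb σv μ p (P p) (θ p)) (x : Fin din → ℝ)

include hφ hθ in
lemma exists_lintegral_netPair_le {C : ℝ≥0} (hC : ∀ i n, meanSum (μ i) n ≤ C) {w w' : ℝ≥0 → ℝ}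
    (hw : Measurable w) (hw' : Measurable w') (hwa : ∀ a : ℝ≥0, w a ^ 2 ≤ a)
    (hwa' : ∀ a : ℝ≥0, w' a ^ 2 ≤ a) {l : ℕ} (hl : l ≤ L) :
    ∃ M : ℝ≥0, ∀ p (m : ℕ) (ι : Fin m → ℕ), (∀ i, ι i < width din dout p (l + 1)) →
      ∀ (K : ℝ≥0) (F : (Fin m → ℝ × ℝ) → ℝ≥0∞), (∀ z, F z ≤ K * (1 + sqNorm z)) →
      ∫⁻ ω, F (netPair din dout p (θ p) φ x w w' (l + 1) ι ω) ∂(P p) ≤ K * (1 + m * M) := by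
  obtain ⟨M, hM⟩ := exists_lintegral_sq_net_le hφ hθ x hC l hl
  refine ⟨M + M, fun p m ι hι K F hF => ?_⟩
  have hm : ∀ {v : ℝ≥0 → ℝ}, Measurable v → ∀ i, Measurable fun ω => ENNReal.ofReal
      (net din dout p (θ p) φ x v (l + 1) (ι i) ω ^ 2) := fun hv i =>
    (((hθ p).measurable_net hφ.measurable x hv (by omega) (hι i)).pow_const 2).ennreal_ofReal
  calc ∫⁻ ω, F (netPair din dout p (θ p) φ x w w' (l + 1) ι ω) ∂(P p)
      ≤ ∫⁻ ω, K * (1 + sqNorm (netPair din dout p (θ p) φ x w w' (l + 1) ι ω)) ∂(P p) :=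
        lintegral_mono fun ω => hF _
    _ = K * (1 + ∑ i, ((∫⁻ ω, ENNReal.ofReal (net din dout p (θ p) φ x w (l + 1) (ι i) ω ^ 2) ∂(P p))
        + ∫⁻ ω, ENNReal.ofReal (net din dout p (θ p) φ x w' (l + 1) (ι i) ω ^ 2) ∂(P p))) := by
        rw [lintegral_const_mul' _ _ ENNReal.coe_ne_top, lintegral_add_left measurable_const,
          lintegral_const, measure_univ, mul_one]
        simp only [sqNorm, netPair]
        rw [lintegral_finsetSum _ fun i _ => (hm hw i).fun_add (hm hw' i)]
        congr 2
        exact Finset.sum_congr rfl fun i _ => lintegral_add_left (hm hw i) _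
    _ ≤ K * (1 + ∑ _i : Fin m, ((M : ℝ≥0∞) + M)) := by
        gcongr with i
        · exact hM p _ (hι i) w hw hwa
        · exact hM p _ (hι i) w' hw' hwa'
    _ = _ := by simp [mul_add]

variable {T : Type*} [Fintype T] {typ : ℝ≥0 → Option T} (htyp : ∀ o, MeasurableSet (typ ⁻¹' {o}))

include hφ hθ htyp in
-- The induction carries all numbers of nodes and all functions of quadratic growth, because one
-- step turns `F` on `m` nodes into `gaussMean` functions on `k` nodes for every `k`. The
-- coefficients have Poisson limits, the expectations converge by induction, and dominated
-- convergence sums over `k`.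
lemma exists_tendsto_lintegral_netPair {C : ℝ≥0} (hC : ∀ i n, meanSum (μ i) n ≤ C)
    {wt wt' : T → ℝ} (hwa : ∀ a : ℝ≥0, typeWeight typ wt a ^ 2 ≤ a)
    (hwa' : ∀ a : ℝ≥0, typeWeight typ wt' a ^ 2 ≤ a)
    (hr : ∀ i t, ∃ r, Tendsto (fun n : ℕ+ => (n : ℝ) * (μ i n : Measure ℝ≥0).real
      (typ ⁻¹' {some t})) atTop (𝓝 r)) (l : ℕ) (hl : l ≤ L) :
    ∀ (m : ℕ) (ι : Fin m → ℕ), Function.Injective ι →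
      (∀ᶠ p : Fin L → ℕ+ in atTop, ∀ i, ι i < width din dout p (l + 1)) →
      ∀ (K : ℝ≥0) (F : (Fin m → ℝ × ℝ) → ℝ≥0∞), Measurable F → (∀ z, F z ≤ K * (1 + sqNorm z)) →
      ∃ c : ℝ≥0, Tendsto (fun p => ∫⁻ ω, F (netPair din dout p (θ p) φ x (typeWeight typ wt)
        (typeWeight typ wt') (l + 1) ι ω) ∂(P p)) atTop (𝓝 c) := by
  have hw := measurable_typeWeight htyp wt
  have hw' := measurable_typeWeight htyp wt'
  obtain ⟨A, hA, hA'⟩ : ∃ A : ℝ, (∀ t, wt t ^ 2 ≤ A) ∧ ∀ t, wt' t ^ 2 ≤ A := by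
    refine ⟨∑ t, (wt t ^ 2 + wt' t ^ 2), fun t => ?_, fun t => ?_⟩
    · exact (le_add_of_nonneg_right (sq_nonneg _)).trans (Finset.single_le_sum
        (f := fun t => wt t ^ 2 + wt' t ^ 2) (fun _ _ => by positivity) (Finset.mem_univ t))
    · exact (le_add_of_nonneg_left (sq_nonneg _)).trans (Finset.single_le_sum
        (f := fun t => wt t ^ 2 + wt' t ^ 2) (fun _ _ => by positivity) (Finset.mem_univ t))
  -- Limits are kept finite by the uniform moment bound, since limits of products in `ℝ≥0∞` need to
  -- avoid `0 * ⊤`.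
  have hfin : ∀ {l : ℕ}, l ≤ L → ∀ {m : ℕ} {ι : Fin m → ℕ},
      (∀ᶠ p : Fin L → ℕ+ in atTop, ∀ i, ι i < width din dout p (l + 1)) →
      ∀ {K : ℝ≥0} {F : (Fin m → ℝ × ℝ) → ℝ≥0∞}, (∀ z, F z ≤ K * (1 + sqNorm z)) →
      (∃ c : ℝ≥0∞, Tendsto (fun p => ∫⁻ ω, F (netPair din dout p (θ p) φ x (typeWeight typ wt)
        (typeWeight typ wt') (l + 1) ι ω) ∂(P p)) atTop (𝓝 c)) →
      ∃ c : ℝ≥0, Tendsto (fun p => ∫⁻ ω, F (netPair din dout p (θ p) φ x (typeWeight typ wt)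
        (typeWeight typ wt') (l + 1) ι ω) ∂(P p)) atTop (𝓝 c) := by
    rintro l hl m ι hι K F hF ⟨c, hc⟩
    obtain ⟨M, hM⟩ := exists_lintegral_netPair_le hφ hθ x hC hw hw' hwa hwa' hl
    have hle := le_of_tendsto hc (hι.mono fun p hp => hM p m ι hp K F hF)
    have hne : c ≠ ⊤ := ne_top_of_le_ne_top (by finiteness) hle
    exact ⟨c.toNNReal, by rwa [ENNReal.coe_toNNReal hne]⟩
  induction l with
  | zero =>
    intro m ι hinj hι K F hF hFK
    exact hfin hl hι hFK ⟨_, tendsto_nhds_of_eventually_eq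
      (hι.mono fun p hp => (hθ p).lintegral_netPair_one x _ _ hp hinj hF)⟩
  | succ l ih =>
    intro m ι hinj hι K F hF hFK
    refine hfin hl hι hFK ?_
    set K' : ℝ≥0 := K * (1 + Fintype.card (Fin m) * (2 * σb ^ 2
      + (A * cLip φ ^ 2).toNNReal * σv ^ 2)) with hK'
    let G : ∀ k, (Fin k → T) → (Fin k → ℝ × ℝ) → ℝ≥0∞ := fun k τ =>
      gaussMean σb σv φ (fun j => wt (τ j)) (fun j => wt' (τ j)) F
    have hG : ∀ k τ, Measurable (G k τ) := fun k τ => measurable_gaussMean σb σv hφ.measurable _ _ hF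
    have hGK : ∀ k τ z, G k τ z ≤ K' * (1 + sqNorm z) := fun k τ z =>
      gaussMean_le σb σv hφ (fun j => hA (τ j)) (fun j => hA' (τ j)) hFK z
    have hlt : ∀ k : ℕ, ∀ᶠ p : Fin L → ℕ+ in atTop, ∀ i : Fin k, (i : ℕ) < width din dout p (l + 1) :=
      fun k => (eventually_lt_width din dout (l := l) (k := k) (by omega) (by omega)).mono
        fun p hp i => i.2.trans hp
    choose c hc using fun (k : ℕ) (τ : Fin k → T) => ih (by omega) k (fun j => (j : ℕ))
      Fin.val_injective (hlt k) K' (G k τ) (hG k τ) (hGK k τ)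
    choose d hd using fun (k : ℕ) (τ : Fin k → T) =>
      exists_tendsto_choose_mul_types htyp (hr ⟨l, hl⟩) τ
    obtain ⟨S, hS⟩ := exists_forall_eventually_mul_sum_le (hr ⟨l, hl⟩)
    obtain ⟨M, hM⟩ := exists_lintegral_netPair_le hφ hθ x hC hw hw' hwa hwa' (l := l) (by omega)
    let E : (Fin L → ℕ+) → ∀ k, (Fin k → T) → ℝ≥0∞ := fun p k τ =>
      ∫⁻ ω, G k τ (netPair din dout p (θ p) φ x (typeWeight typ wt) (typeWeight typ wt') (l + 1)
        (fun j : Fin k => (j : ℕ)) ω) ∂(P p)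
    let q : (Fin L → ℕ+) → ∀ k, (Fin k → T) → ℝ≥0∞ := fun p k τ =>
      (μ ⟨l, hl⟩ (p ⟨l, hl⟩) : Measure ℝ≥0) (typ ⁻¹' {none}) ^ ((p ⟨l, hl⟩ : ℕ) - k)
        * ∏ j, (μ ⟨l, hl⟩ (p ⟨l, hl⟩) : Measure ℝ≥0) (typ ⁻¹' {some (τ j)})
    -- The finite sum over `k` is extended to all of `ℕ`, the binomial coefficient being `0` beyond
    -- the width, so that the index set no longer depends on `p`.
    let f : (Fin L → ℕ+) → ℕ → ℝ≥0∞ := fun p k =>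
      (p ⟨l, hl⟩ : ℕ).choose k * ∑ τ : Fin k → T, q p k τ * E p k τ
    have hsum : ∀ᶠ p in atTop, ∑' k, f p k = ∫⁻ ω, F (netPair din dout p (θ p) φ x
        (typeWeight typ wt) (typeWeight typ wt') (l + 2) ι ω) ∂(P p) := by
      filter_upwards [hι] with p hp
      rw [(hθ p).lintegral_netPair_eq_sum_choose hφ.measurable x htyp wt wt' hl hp hinj hF]
      refine tsum_eq_sum fun k hk => ?_
      have : (p ⟨l, hl⟩ : ℕ).choose k = 0 :=
        Nat.choose_eq_zero_of_lt (by simpa using hk)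
      simp [f, this]
    have hfb : ∀ᶠ p in atTop, ∀ k, f p k ≤ S ^ k / k.factorial * (K' * (1 + k * M)) := by
      filter_upwards [(tendsto_apply_atTop (⟨l, hl⟩ : Fin L)).eventually hS] with p hp k
      rcases lt_or_ge (p ⟨l, hl⟩ : ℕ) k with hk | hk
      · simp [f, Nat.choose_eq_zero_of_lt hk]
      · have hE : ∀ τ, E p k τ ≤ K' * (1 + k * M) := fun τ =>
          hM p k _ (fun j => by rw [width_succ _ _ _ hl]; exact j.2.trans_le hk) K' _ (hGK k τ)
        calc f p k ≤ (p ⟨l, hl⟩ : ℕ).choose k * ∑ τ : Fin k → T, q p k τ * (K' * (1 + k * M)) := by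
              simp only [f]
              gcongr with τ
              exact hE τ
          _ = ((p ⟨l, hl⟩ : ℕ).choose k * ∑ τ : Fin k → T, q p k τ) * (K' * (1 + k * M)) := by
              rw [← Finset.sum_mul, mul_assoc]
          _ ≤ _ := by
              gcongr
              refine (choose_mul_sum_types_le _ _ _).trans ?_
              gcongr
    have hlim : ∀ k, Tendsto (fun p => f p k) atTop (𝓝 (∑ τ : Fin k → T, (d k τ : ℝ≥0∞) * c k τ)) := by
      intro k
      simp only [f, Finset.mul_sum, ← mul_assoc]
      refine tendsto_finsetSum _ fun τ _ => ?_
      exact ENNReal.Tendsto.mul ((hd k τ).comp (tendsto_apply_atTop (⟨l, hl⟩ : Fin L)))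
        (Or.inr ENNReal.coe_ne_top) (hc k τ) (Or.inr ENNReal.coe_ne_top)
    exact ⟨_, (tendsto_tsum_of_dominated (tsum_pow_div_factorial_mul_ne_top K' M S) hfb
      hlim).congr' hsum⟩

end Limit

/-! ### Convergence of the pruning error -/

/-- Young's inequality for the cross term of `(g + (f - g))²`. A factor `1 + t` close to `1` in
front of `g²` is needed to compare second moments up to a small error. -/
lemma lintegral_sq_le_add {Ω : Type*} [MeasurableSpace Ω] {P : Measure Ω} {f g : Ω → ℝ}
    (hg : Measurable g) {t : ℝ≥0} (ht : 0 < t) :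
    ∫⁻ ω, ENNReal.ofReal (f ω ^ 2) ∂P ≤ (1 + t : ℝ≥0) * ∫⁻ ω, ENNReal.ofReal (g ω ^ 2) ∂P
      + (1 + t⁻¹ : ℝ≥0) * ∫⁻ ω, ENNReal.ofReal ((f ω - g ω) ^ 2) ∂P := by
  rw [← lintegral_const_mul' _ _ ENNReal.coe_ne_top, ← lintegral_const_mul' _ _ ENNReal.coe_ne_top,
    ← lintegral_add_left (by fun_prop)]
  refine lintegral_mono fun ω => ?_
  simp only
  rw [← ENNReal.ofReal_coe_nnreal, ← ENNReal.ofReal_coe_nnreal (p := 1 + t⁻¹),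
    ← ENNReal.ofReal_mul (NNReal.coe_nonneg _), ← ENNReal.ofReal_mul (NNReal.coe_nonneg _),
    ← ENNReal.ofReal_add (by positivity) (by positivity)]
  refine ENNReal.ofReal_le_ofReal ?_
  push_cast
  have ht' : (0 : ℝ) < t := ht
  have h1 : 0 ≤ (t * g ω - (f ω - g ω)) ^ 2 * (t : ℝ)⁻¹ := by positivity
  have h2 : (t * g ω - (f ω - g ω)) ^ 2 * (t : ℝ)⁻¹
      = t * g ω ^ 2 - 2 * (g ω * (f ω - g ω)) + (t : ℝ)⁻¹ * (f ω - g ω) ^ 2 := by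
    field_simp
    ring
  nlinarith [h1, h2]

lemma ofReal_sq_sub_le (a b : ℝ) :
    ENNReal.ofReal ((a - b) ^ 2) ≤ 2 * (ENNReal.ofReal (a ^ 2) + ENNReal.ofReal (b ^ 2)) := by
  rw [← ENNReal.ofReal_add (sq_nonneg _) (sq_nonneg _), ← ENNReal.ofReal_ofNat 2,
    ← ENNReal.ofReal_mul zero_le_two]
  refine ENNReal.ofReal_le_ofReal ?_
  nlinarith [sq_nonneg (a + b)]

lemma lintegral_sq_sub_le {Ω : Type*} [MeasurableSpace Ω] {P : Measure Ω} {f g : Ω → ℝ}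
    (hf : Measurable f) :
    ∫⁻ ω, ENNReal.ofReal ((f ω - g ω) ^ 2) ∂P
      ≤ 2 * (∫⁻ ω, ENNReal.ofReal (f ω ^ 2) ∂P + ∫⁻ ω, ENNReal.ofReal (g ω ^ 2) ∂P) := by
  rw [← lintegral_add_left (by fun_prop), ← lintegral_const_mul' _ _ (by simp)]
  refine lintegral_mono fun ω => ?_
  exact ofReal_sq_sub_le _ _

lemma exists_tendsto_of_approx {β : Type*} {l : Filter β} [l.NeBot] {f : β → ℝ≥0∞}
    (h : ∀ η : ℝ≥0, 0 < η → ∃ (g : β → ℝ≥0∞) (c : ℝ≥0), Tendsto g l (𝓝 c) ∧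
      ∀ᶠ b in l, f b ≤ g b + η ∧ g b ≤ f b + η) : ∃ e, Tendsto f l (𝓝 e) := by
  refine ⟨liminf f l, tendsto_of_le_liminf_of_limsup_le le_rfl ?_⟩
  refine ENNReal.le_of_forall_pos_le_add fun η hη _ => ?_
  obtain ⟨g, c, hg, hfg⟩ := h (η / 2) (half_pos hη)
  have h1 : limsup f l ≤ c + (η / 2 : ℝ≥0) := by
    rw [← (hg.add_const ((η / 2 : ℝ≥0) : ℝ≥0∞)).limsup_eq]
    exact limsup_le_limsup (hfg.mono fun b hb => hb.1)
  have h2 : (c : ℝ≥0∞) - (η / 2 : ℝ≥0) ≤ liminf f l := by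
    rw [← (ENNReal.Tendsto.sub hg tendsto_const_nhds (Or.inl ENNReal.coe_ne_top)).liminf_eq]
    exact liminf_le_liminf (hfg.mono fun b hb => tsub_le_iff_right.2 hb.2)
  calc limsup f l ≤ c + (η / 2 : ℝ≥0) := h1
    _ ≤ liminf f l + (η / 2 : ℝ≥0) + (η / 2 : ℝ≥0) := by
        gcongr
        exact tsub_le_iff_right.1 h2
    _ = _ := by rw [add_assoc, ← ENNReal.coe_add, add_halves]

section Approximation

variable {L : ℕ} {din dout : ℕ+} {σb σv : ℝ≥0} {φ : ℝ → ℝ} (hφ : PosHomogeneous φ)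
  {μ : Fin L → ℕ+ → ProbabilityMeasure ℝ≥0}
  {Ω : (Fin L → ℕ+) → Type*} [∀ p, MeasurableSpace (Ω p)]
  {P : ∀ p, Measure (Ω p)} [∀ p, IsProbabilityMeasure (P p)] {θ : ∀ p, Params (Ω p)}
  (hθ : ∀ p, IsMoGP din dout σb σv μ p (P p) (θ p)) (x : Fin din → ℝ)

include hφ hθ

/-- `L²` stability in the weights: `w φ(z) - w' φ(z') = (w - w') φ(z) + w' (φ(z) - φ(z'))`, the
first part being new and the second inherited. What matters is that `K` depends neither on the
widths nor on the weights. -/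
lemma exists_lintegral_sq_net_sub_le {C : ℝ≥0} (hC : ∀ i n, meanSum (μ i) n ≤ C) (l : ℕ)
    (hl : l ≤ L) :
    ∃ K : ℝ≥0, ∀ p (ζ : ℝ≥0) (w w' : ℝ≥0 → ℝ), Measurable w → Measurable w' →
      (∀ a : ℝ≥0, w a ^ 2 ≤ a) → (∀ a : ℝ≥0, w' a ^ 2 ≤ a) →
      (∀ i, weightErr (μ i) w w' (p i) ≤ ζ) → ∀ k < width din dout p (l + 1),
      ∫⁻ ω, ENNReal.ofReal ((net din dout p (θ p) φ x w (l + 1) k ω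
        - net din dout p (θ p) φ x w' (l + 1) k ω) ^ 2) ∂(P p) ≤ (K * ζ : ℝ≥0) := by
  induction l with
  | zero => exact ⟨0, fun p ζ w w' _ _ _ _ _ k _ => by simp [net]⟩
  | succ l ih =>
    obtain ⟨K, hK⟩ := ih (by omega)
    obtain ⟨M, hM⟩ := exists_lintegral_sq_net_le hφ hθ x hC l (by omega)
    set c : ℝ≥0 := (2 * cLip φ ^ 2).toNNReal with hc
    have hc' : (c : ℝ) = 2 * cLip φ ^ 2 := Real.coe_toNNReal _ (by positivity)
    refine ⟨σv ^ 2 * (c * M + c * C * K), fun p ζ w w' hw hw' hwa hwa' hζ k hk => ?_⟩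
    have hcm : Measurable fun a : ℝ≥0 => (a : ℝ≥0∞) := by fun_prop
    have hdm : Measurable fun a : ℝ≥0 => ENNReal.ofReal ((w a - w' a) ^ 2) := by fun_prop
    refine ((hθ p).lintegral_sq_net_sub_net_le hφ.measurable x hw hw'
      (f := fun a => c * ENNReal.ofReal ((w a - w' a) ^ 2)) (g := fun a => c * a)
      (measurable_const.mul hdm) (measurable_const.mul hcm) (fun a z z' => ?_) hl
      (fun j hj => hM p j hj w hw hwa)
      (fun j hj => hK p ζ w w' hw hw' hwa hwa' hζ j hj) hk).trans ?_
    · rw [← ENNReal.ofReal_coe_nnreal, ← ENNReal.ofReal_coe_nnreal (p := a),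
        ← ENNReal.ofReal_mul c.coe_nonneg, ← ENNReal.ofReal_mul c.coe_nonneg,
        ← ENNReal.ofReal_mul (by positivity), ← ENNReal.ofReal_mul (by positivity),
        ← ENNReal.ofReal_add (by positivity) (by positivity), hc']
      refine ENNReal.ofReal_le_ofReal ?_
      have h1 := mul_le_mul_of_nonneg_left (hφ.sq_le z) (sq_nonneg (w a - w' a))
      have h2 := mul_le_mul (hwa' a) (hφ.sq_sub_le z z') (sq_nonneg _) a.coe_nonneg
      have h3 := sq_nonneg ((w a - w' a) * φ z - w' a * (φ z - φ z'))
      nlinarith [h1, h2, h3]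
    · rw [lintegral_const_mul _ hdm, lintegral_const_mul _ hcm, mul_left_comm,
        mul_left_comm _ (c : ℝ≥0∞), ← meanSum_eq]
      change _ * (c * weightErr (μ ⟨l, hl⟩) w w' (p ⟨l, hl⟩) * _ + _) ≤ _
      calc _ ≤ ((σv ^ 2 : ℝ≥0) : ℝ≥0∞) * (c * ζ * M + c * C * (K * ζ : ℝ≥0)) := by
            gcongr
            · exact hζ _
            · exact hC _ _
        _ = _ := by push_cast; ring

open Classical in
-- The discretised full and pruned networks are functions of the same node types, so the second
-- moment of their difference converges. It is eventually within `η` of the pruning error by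
-- stability in the weights.
lemma exists_tendsto_pruningError {ρ : Measure ℝ} (hρ : IsLevyMeasure ρ)
    (hμ : ∀ i, SumTendstoID (μ i) 0 ρ) (hUI : ∀ i, UI (μ i) 0 ρ) {ε : ℝ} (hε : 0 < ε)
    (hρε : ρ {ε} = 0) (hM₁ : firstMoment ρ < ⊤) {l : ℕ} (hl : l ≤ L) {k : ℕ}
    (hk : l = L → k < dout) :
    ∃ e, Tendsto (fun p => pruningError din dout p (θ p) φ x (P p) ε (l + 1) k) atTop (𝓝 e) := by
  obtain ⟨C, hC⟩ := exists_forall_meanSum_le hUI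
  obtain ⟨M, hM⟩ := exists_lintegral_sq_net_le hφ hθ x hC l hl
  obtain ⟨K, hK⟩ := exists_lintegral_sq_net_sub_le hφ hθ x hC l hl
  refine exists_tendsto_of_approx fun η hη => ?_
  have hη2 : 0 < η / 2 := half_pos hη
  -- `4 M` bounds the second moment of a difference of two networks, and `4 K ζ` the squared
  -- distance between the true and the discretised differences. So `t` is chosen first for Young's
  -- inequality, then `ζ` to beat `1 + t⁻¹`; the added `1` keeps the denominators positive.
  obtain ⟨t, ht, htB⟩ : ∃ t : ℝ≥0, 0 < t ∧ t * (4 * M) ≤ η / 2 := by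
    refine ⟨η / 2 / (4 * M + 1), by positivity, ?_⟩
    rw [div_mul_eq_mul_div]
    exact div_le_of_le_mul₀ (by positivity) (by positivity) (by gcongr; exact le_self_add)
  obtain ⟨ζ, hζ, hζK⟩ : ∃ ζ : ℝ≥0, 0 < ζ ∧ (1 + t⁻¹) * (4 * K * ζ) ≤ η / 2 := by
    refine ⟨η / 2 / ((1 + t⁻¹) * (4 * K) + 1), by positivity, ?_⟩
    rw [← mul_assoc, mul_div_assoc']
    refine div_le_of_le_mul₀ (by positivity) (by positivity) ?_
    rw [mul_comm]
    gcongr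
    exact le_self_add
  obtain ⟨h, N, hh, hnull, hgrid⟩ := exists_grid hρ hM₁ hε hρε (η := ζ) (by exact_mod_cast hζ)
  set wt : Finset.Icc (-(N : ℤ)) N → ℝ := fun i => gridWeight ε h i with hwt
  set wt' : Finset.Icc (-(N : ℤ)) N → ℝ :=
    fun i => gridWeight ε h i * if 1 ≤ (i : ℤ) then 1 else 0 with hwt'
  have htyp := measurableSet_gridType hε hh (N := N)
  set w := typeWeight (gridType ε h N) wt with hw
  set w' := typeWeight (gridType ε h N) wt' with hw'
  have hwm : Measurable w := measurable_typeWeight htyp wt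
  have hwm' : Measurable w' := measurable_typeWeight htyp wt'
  have hw'eq : ∀ a, w' a = w a * if ε < (a : ℝ) then 1 else 0 := typeWeight_pruned hε hh N
  have hwa : ∀ a : ℝ≥0, w a ^ 2 ≤ a := fun a => by
    obtain ⟨h1, h2⟩ := typeWeight_gridType_mem hε hh N a
    calc w a ^ 2 ≤ Real.sqrt a ^ 2 := pow_le_pow_left₀ h1 h2 2
      _ = a := Real.sq_sqrt a.coe_nonneg
  have hcut : ∀ (b : ℝ) (a : ℝ≥0), (b * if ε < (a : ℝ) then 1 else 0) ^ 2 ≤ b ^ 2 := fun b a => by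
    split_ifs <;> simp [sq_nonneg]
  have hwa' : ∀ a : ℝ≥0, w' a ^ 2 ≤ a := fun a => by
    rw [hw'eq]; exact (hcut _ _).trans (hwa a)
  have hs : ∀ a : ℝ≥0, Real.sqrt a ^ 2 ≤ a := fun a => (Real.sq_sqrt a.coe_nonneg).le
  have hs' : ∀ a : ℝ≥0, (Real.sqrt a * if ε < (a : ℝ) then 1 else 0) ^ 2 ≤ a := fun a =>
    (hcut _ _).trans (hs a)
  -- Both pruned weights carry the same exact cutoff, so pruning only decreases the discretisation
  -- error; no separate estimate near `ε` is needed.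
  have herr : ∀ i n, weightErr (μ i) (fun a => Real.sqrt a * if ε < (a : ℝ) then 1 else 0) w' n
      ≤ weightErr (μ i) (fun a => Real.sqrt a) w n := fun i n => by
    unfold weightErr
    refine mul_le_mul_right (lintegral_mono fun a => ENNReal.ofReal_le_ofReal ?_) _
    rw [hw'eq, ← sub_mul]
    exact hcut _ _
  let F : (Fin 1 → ℝ × ℝ) → ℝ≥0∞ := fun z => ENNReal.ofReal (((z 0).1 - (z 0).2) ^ 2)
  have hF : Measurable F := by fun_prop
  have hFK : ∀ z, F z ≤ (2 : ℝ≥0) * (1 + sqNorm z) := fun z => by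
    refine (ofReal_sq_sub_le _ _).trans ?_
    simp only [sqNorm, Finset.univ_unique, Finset.sum_singleton, Fin.default_eq_zero]
    exact mul_le_mul_right le_add_self _
  have hwidth := eventually_lt_width (L := L) din dout hl hk
  obtain ⟨c, hc⟩ := exists_tendsto_lintegral_netPair hφ hθ x htyp hC hwa hwa'
    (fun i t => tendsto_mul_measure_gridType hρ hM₁ hε hh hnull (hμ i) N t) l hl 1 (fun _ => k)
    (Function.injective_of_subsingleton _) (hwidth.mono fun p hp _ => hp) 2 F hF hFK
  refine ⟨_, c, hc, ?_⟩
  have hgrid' : ∀ᶠ p : Fin L → ℕ+ in atTop, ∀ i, weightErr (μ i) (fun a => Real.sqrt a) w (p i) ≤ ζ :=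
    eventually_all.2 fun i => (tendsto_apply_atTop i).eventually
      (hgrid (μ i) (hμ i) (by simpa using (hUI i).tendsto_meanSum))
  filter_upwards [hgrid', hwidth] with p hp hkp
  rw [pruningError_eq]
  simp only [F, netPair]
  set Z := net din dout p (θ p) φ x (fun a => Real.sqrt a) (l + 1) k with hZ
  set Z' := net din dout p (θ p) φ x (fun a => Real.sqrt a * if ε < (a : ℝ) then 1 else 0)
    (l + 1) k with hZ'
  set Y := net din dout p (θ p) φ x w (l + 1) k with hY
  set Y' := net din dout p (θ p) φ x w' (l + 1) k with hY'
  have hmeas : ∀ {v : ℝ≥0 → ℝ}, Measurable v →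
      Measurable (net din dout p (θ p) φ x v (l + 1) k) := fun hv =>
    (hθ p).measurable_net hφ.measurable x hv (by omega) hkp
  have mZ : Measurable Z := hmeas measurable_sqrt_coe
  have mZ' : Measurable Z' := hmeas (measurable_sqrt_mul_ite ε)
  have mY : Measurable Y := hmeas hwm
  have mY' : Measurable Y' := hmeas hwm'
  have key : ∀ f g : Ω p → ℝ, Measurable g → ∫⁻ ω, ENNReal.ofReal (g ω ^ 2) ∂(P p) ≤ (4 * M : ℝ≥0) →
      ∫⁻ ω, ENNReal.ofReal ((f ω - g ω) ^ 2) ∂(P p) ≤ (4 * K * ζ : ℝ≥0) →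
      ∫⁻ ω, ENNReal.ofReal (f ω ^ 2) ∂(P p) ≤ ∫⁻ ω, ENNReal.ofReal (g ω ^ 2) ∂(P p) + η := by
    intro f g hg h1 h2
    calc ∫⁻ ω, ENNReal.ofReal (f ω ^ 2) ∂(P p)
        ≤ (1 + t : ℝ≥0) * ∫⁻ ω, ENNReal.ofReal (g ω ^ 2) ∂(P p)
          + (1 + t⁻¹ : ℝ≥0) * ∫⁻ ω, ENNReal.ofReal ((f ω - g ω) ^ 2) ∂(P p) :=
          lintegral_sq_le_add hg ht
      _ ≤ ∫⁻ ω, ENNReal.ofReal (g ω ^ 2) ∂(P p) + (t * (4 * M) : ℝ≥0)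
          + ((1 + t⁻¹) * (4 * K * ζ) : ℝ≥0) := by
          rw [ENNReal.coe_add 1 t, add_mul, ENNReal.coe_one, one_mul, ENNReal.coe_mul t,
            ENNReal.coe_mul (1 + t⁻¹)]
          gcongr
      _ ≤ ∫⁻ ω, ENNReal.ofReal (g ω ^ 2) ∂(P p) + (η / 2 : ℝ≥0) + (η / 2 : ℝ≥0) := by gcongr
      _ = _ := by rw [add_assoc, ← ENNReal.coe_add, add_halves]
  have hfour : ∀ {a b : ℝ≥0∞} {r : ℝ≥0}, a ≤ r → b ≤ r → 2 * (a + b) ≤ (4 * r : ℝ≥0) := by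
    intro a b r ha hb
    calc 2 * (a + b) ≤ 2 * ((r : ℝ≥0∞) + r) := by gcongr
      _ = _ := by push_cast; ring
  have hbound : ∀ {v v' : ℝ≥0 → ℝ}, Measurable v → Measurable v' → (∀ a : ℝ≥0, v a ^ 2 ≤ a) →
      (∀ a : ℝ≥0, v' a ^ 2 ≤ a) → ∫⁻ ω, ENNReal.ofReal ((net din dout p (θ p) φ x v (l + 1) k ω
        - net din dout p (θ p) φ x v' (l + 1) k ω) ^ 2) ∂(P p) ≤ (4 * M : ℝ≥0) :=
    fun hv hv' hva hva' => (lintegral_sq_sub_le (hmeas hv)).trans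
      (hfour (hM p k hkp _ hv hva) (hM p k hkp _ hv' hva'))
  have hZY := hK p ζ _ w measurable_sqrt_coe hwm hs hwa hp k hkp
  have hZY' := hK p ζ _ w' (measurable_sqrt_mul_ite ε) hwm' hs' hwa'
    (fun i => (herr i _).trans (hp i)) k hkp
  have hdiff : ∫⁻ ω, ENNReal.ofReal (((Z ω - Z' ω) - (Y ω - Y' ω)) ^ 2) ∂(P p)
      ≤ (4 * K * ζ : ℝ≥0) := by
    rw [mul_assoc]
    refine le_trans (le_of_eq_of_le (lintegral_congr fun ω => ?_)
      (lintegral_sq_sub_le (f := fun ω => Z ω - Y ω) (g := fun ω => Z' ω - Y' ω) (mZ.fun_sub mY)))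
      (hfour hZY hZY')
    rw [sub_sub_sub_comm]
  constructor
  · exact key (fun ω => Z ω - Z' ω) (fun ω => Y ω - Y' ω) (mY.fun_sub mY')
      (hbound hwm hwm' hwa hwa') hdiff
  · refine key (fun ω => Y ω - Y' ω) (fun ω => Z ω - Z' ω) (mZ.fun_sub mZ')
      (hbound measurable_sqrt_coe (measurable_sqrt_mul_ite ε) hs hs') ?_
    refine le_of_eq_of_le (lintegral_congr fun ω => ?_) hdiff
    rw [← neg_sub, neg_sq]

end Approximation

end MoGP

/-- The limit as `min(p₁, …, p_L) → ∞` is taken along `atTop` on `Fin L → ℕ+`. -/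
theorem mainTheorem10
    (ρ : Measure ℝ) (hρ : MoGP.IsLevyMeasure ρ)
    (α : ℝ) (hα0 : 0 ≤ α) (hα1 : α < 1)
    (Lsv : ℝ → ℝ) (hLsv : MoGP.SlowlyVarying Lsv) (hA3 : MoGP.TailRegularAtZero ρ α Lsv)
    (δ : ℝ) (hδ0 : 0 < δ) (hδ1 : δ < 1 - α) :
    ∃ ε₀ : ℝ, 0 < ε₀ ∧ ∀ ε : ℝ, 0 < ε → ε < ε₀ →
      ∀ (L : ℕ) (din dout : ℕ+) (σb σv : ℝ≥0) (_ : 0 < σv)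
        (φ : ℝ → ℝ) (_ : MoGP.PosHomogeneous φ)
        (μ : Fin L → ℕ+ → ProbabilityMeasure ℝ≥0)
        (_ : ∀ i, MoGP.SumTendstoID (μ i) 0 ρ)
        (_ : ∀ i, MoGP.UI (μ i) 0 ρ)
        (Ω : (Fin L → ℕ+) → Type*) [∀ p, MeasurableSpace (Ω p)]
        (P : ∀ p, Measure (Ω p)) [∀ p, IsProbabilityMeasure (P p)]
        (θ : ∀ p, MoGP.Params (Ω p))
        (_ : ∀ p, MoGP.IsMoGP din dout σb σv μ p (P p) (θ p))
        (x : Fin din → ℝ) (l : ℕ), 1 ≤ l → l ≤ L →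
        (∀ l', 1 ≤ l' → l' ≤ l → MoGP.supSecondMoment din dout P θ φ x l' < ⊤) ∧
        ∀ k : ℕ, (l = L → k < dout) →
          let err : (Fin L → ℕ+) → ℝ≥0∞ :=
            fun p => MoGP.pruningError din dout p (θ p) φ x (P p) ε (l + 1) k
          let bound : ℝ :=
            MoGP.pruningConst σv (MoGP.cLip φ) (MoGP.firstMoment ρ).toReal α δ
              (fun l' => (MoGP.supSecondMoment din dout P θ φ x l').toReal) l
            * ε ^ (1 - (α + δ))
          limsup err atTop ≤ ENNReal.ofReal bound ∧
          (ρ {ε} = 0 → ∃ e : ℝ≥0∞, Tendsto err atTop (𝓝 e) ∧ e ≤ ENNReal.ofReal bound) := by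
  obtain ⟨ε₀, hε₀, htail⟩ := MoGP.exists_tail_le_rpow hρ hα0 hLsv hA3 hδ0
  refine ⟨ε₀, hε₀, fun ε hε hεε L din dout σb σv _ φ hφ μ hμ hUI Ω _ P _ θ hθ x l hl1 hlL => ?_⟩
  obtain ⟨C, hC⟩ := MoGP.exists_forall_meanSum_le hUI
  refine ⟨fun l' h1 h2 => ?_, fun k hk => ?_⟩
  · obtain ⟨n, rfl⟩ := Nat.exists_eq_add_of_le' h1
    exact MoGP.supSecondMoment_lt_top hφ hθ x hC (by omega)
  · have hlim := MoGP.limsup_pruningError_le hφ hθ x hρ hμ hUI (by linarith) htail hε hεε hlL hk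
    refine ⟨hlim, fun hρε => ?_⟩
    -- Finiteness of `M₁` is part of (UI), hence is read off at some hidden layer; one exists
    -- because `1 ≤ l ≤ L`.
    obtain ⟨e, he⟩ := MoGP.exists_tendsto_pruningError hφ hθ x hρ hμ hUI hε hρε
      (hUI ⟨0, by omega⟩).firstMoment_lt_top hlL hk
    exact ⟨e, he, by rw [← he.limsup_eq]; exact hlim⟩
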